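/- Let $(W,I)$ be a complex manifold, let $(\Sigma,j)$ be a Riemann surface, and let $\sigma:W\to\Sigma$ be a holomorphic map that is a smooth fiber bundle. (The complex structure of $W$ is not assumed to be locally a product.) Write $V=\ker d\sigma\subseteq TW$ for the vertical bundle, with fiber $V_w$ over $w\in W$. Let $\Omega$ be a smooth real 3-form on $W$ that is CRMS, i.e. such that 1. $d\Omega=0$; 2. $\Omega$ is 1-horizontal: $\Omega(v_1,v_2,v_3)=0$ for all $w\in W$ and $v_1,v_2,v_3\in V_w$; 3. $\Omega$ is fiberwise non-degenerate: for every $w\in W$ and $\xi\in T_wW$ with $d\sigma(\xi)\neq0$, the bilinear form $\Omega(\xi,\cdot,\cdot)$ is non-degenerate on $V_w$; 4. $\Omega$ is $I$-compatible: $\Omega(I\xi,v_1,v_2)=-\Omega(\xi,v_1,Iv_2)$ for all $w\in W$, $\xi\in T_wW$ and $v_1,v_2\in V_w$. Then for every point $w\in W$ there are an integer $n\ge 0$ with $\dim_{\mathbb C}W=2n+1$, an open set $\mathbb U\subseteq W$ containing $w$, open sets $S\subseteq\mathbb C$ and $U\subseteq\mathbb C^{2n}$, a diffeomorphism $\psi:\mathbb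 U\to S\times U$, a diffeomorphism $\chi=(t_1,t_2):\sigma(\mathbb U)\to S$ (with $\sigma(\mathbb U)$ open in $\Sigma$), and a smooth function $H:S\times U\to\mathbb R$, $H_t=H(t,\cdot)$, such that * $\mathrm{pr}\circ\psi=\chi\circ\sigma$ on $\mathbb U$, where $\mathrm{pr}:\mathbb C\times\mathbb C^{2n}\to\mathbb C$ is the projection; * $(\psi^{-1})^*\Omega=\Omega_{\mathrm{std}}-dH_t\wedge dt_1\wedge dt_2$ on $S\times U$, where $dH_t$ is the differential of $H$ in the $U$-directions; * $\chi$ is biholomorphic; * $d\psi(Iv)=i\,d\psi(v)$ for every vertical vector $v\in V_x$, $x\in\mathbb U$, where $i$ is the standard complex structure on $\mathbb C\times\mathbb C^{2n}$. Here $t=t_1+it_2$ is the coordinate of $\mathbb C$, and $\Omega_{\mathrm{std}}=\omega_1\wedge dt_2-\omega_2\wedge dt_1$, where, writing the coordinates of $\mathbb C^{2n}=\mathbb C^n\times\mathbb C^n$ as $(q,z)$ with $q^k=q^k_1+iq^k_2$ and $z^k=p^k_1-ip^k_2$, $$\omega_1=\sum_{k=1}^n\left(dp^k_1\wedge dq^k_1+dp^k_2\wedge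 dq^k_2\right),\qquad \omega_2=\sum_{k=1}^n\left(dp^k_1\wedge dq^k_2-dp^k_2\wedge dq^k_1\right).$$ -/

import Mathlib

open scoped Manifold ContDiff Topology

noncomputable section

/-! ### Differential forms on real manifolds -/

/-- A (not necessarily smooth) real differential 3-form on a manifold `M` modelled on `E`: an
alternating trilinear form on each tangent space. -/
abbrev Form3 (E : Type*) [NormedAddCommGroup E] [NormedSpace ℝ E]
    (M : Type*) [TopologicalSpace M] [ChartedSpace E M] :=
  ∀ x : M, TangentSpace 𝓘(ℝ, E) x [⋀^Fin 3]→L[ℝ] ℝ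

/-- The pullback `f^*Ω` of a 3-form `Ω` along `f`, at a point `x`. -/
def pullback3 {E : Type*} [NormedAddCommGroup E] [NormedSpace ℝ E]
    {M : Type*} [TopologicalSpace M] [ChartedSpace E M]
    {E' : Type*} [NormedAddCommGroup E'] [NormedSpace ℝ E']
    {M' : Type*} [TopologicalSpace M'] [ChartedSpace E' M']
    (f : M → M') (Ω : Form3 E' M') : Form3 E M := fun x =>
  (Ω (f x)).compContinuousLinearMap (mfderiv 𝓘(ℝ, E) 𝓘(ℝ, E') f x)

/-- The expression `(e⁻¹)^*Ω` of a 3-form in a chart `e`, as a 3-form on the model space. It is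
meaningful on the open set `e.target`. -/
def chartForm3 {E : Type*} [NormedAddCommGroup E] [NormedSpace ℝ E]
    {M : Type*} [TopologicalSpace M] [ChartedSpace E M]
    (e : OpenPartialHomeomorph M E) (Ω : Form3 E M) : E → E [⋀^Fin 3]→L[ℝ] ℝ :=
  pullback3 (M := E) e.symm Ω

/-- `Ω` is a smooth form: its expression in every chart of the atlas is smooth. -/
def IsSmoothForm3 {E : Type*} [NormedAddCommGroup E] [NormedSpace ℝ E]
    {M : Type*} [TopologicalSpace M] [ChartedSpace E M] (Ω : Form3 E M) : Prop :=
  ∀ e ∈ atlas E M, ContDiffOn ℝ ∞ (chartForm3 e Ω) e.target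

/-- `dΩ = 0`, expressed in every chart of the atlas. -/
def IsClosedForm3 {E : Type*} [NormedAddCommGroup E] [NormedSpace ℝ E]
    {M : Type*} [TopologicalSpace M] [ChartedSpace E M] (Ω : Form3 E M) : Prop :=
  ∀ e ∈ atlas E M, ∀ y ∈ e.target, extDeriv (chartForm3 e Ω) y = 0

/-! ### Complex-regularized multisymplectic bundles -/

/-- The complex structure `I` on the real tangent space at a point `x` of a complex manifold `M`
modelled on the complex vector space `E`: multiplication by the imaginary unit. (The tangent space
is identified with `E` by a chart at `x`; as transition maps are holomorphic, the result does not
depend on the chart.) -/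
def complexStructure {E : Type*} [NormedAddCommGroup E] [NormedSpace ℂ E]
    {M : Type*} [TopologicalSpace M] [ChartedSpace E M] (x : M) :
    TangentSpace 𝓘(ℝ, E) x →L[ℝ] TangentSpace 𝓘(ℝ, E) x :=
  (Complex.I • ContinuousLinearMap.id ℝ E : E →L[ℝ] E)

/-- The vertical space `V_w = ker (dσ)_w` of a map `σ` from `W` to a surface `B`. -/
def verticalSpace {E : Type*} [NormedAddCommGroup E] [NormedSpace ℂ E]
    {W : Type*} [TopologicalSpace W] [ChartedSpace E W]
    {B : Type*} [TopologicalSpace B] [ChartedSpace ℂ B]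
    (σ : W → B) (w : W) : Submodule ℝ (TangentSpace 𝓘(ℝ, E) w) :=
  (mfderiv 𝓘(ℝ, E) 𝓘(ℝ, ℂ) σ w).ker

/-- `σ : W → B` is a smooth fiber bundle with typical fiber the real manifold `F`: it is locally
over the base diffeomorphic to the projection from a product with `F`. -/
def IsSmoothFiberBundle {E : Type*} [NormedAddCommGroup E] [NormedSpace ℂ E]
    {W : Type*} [TopologicalSpace W] [ChartedSpace E W]
    {B : Type*} [TopologicalSpace B] [ChartedSpace ℂ B]
    (EF : Type*) [NormedAddCommGroup EF] [NormedSpace ℝ EF]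
    (F : Type*) [TopologicalSpace F] [ChartedSpace EF F]
    (σ : W → B) : Prop :=
  ∀ b : B, ∃ T : Bundle.Trivialization F σ, b ∈ T.baseSet ∧
    ContMDiffOn 𝓘(ℝ, E) (𝓘(ℝ, ℂ).prod 𝓘(ℝ, EF)) ∞ T.toOpenPartialHomeomorph T.source ∧
    ContMDiffOn (𝓘(ℝ, ℂ).prod 𝓘(ℝ, EF)) 𝓘(ℝ, E) ∞ T.toOpenPartialHomeomorph.symm T.target

/-- A 3-form `Ω` on the total space `W` of a bundle `σ : W → B` is complex-regularized
multisymplectic (CRMS) if it is smooth, closed, 1-horizontal, fiberwise non-degenerate and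
`I`-compatible. -/
structure IsCRMS {E : Type*} [NormedAddCommGroup E] [NormedSpace ℂ E]
    {W : Type*} [TopologicalSpace W] [ChartedSpace E W]
    {B : Type*} [TopologicalSpace B] [ChartedSpace ℂ B]
    (σ : W → B) (Ω : Form3 E W) : Prop where
  smooth : IsSmoothForm3 Ω
  closed : IsClosedForm3 Ω
  horizontal : ∀ w, ∀ v₁ ∈ verticalSpace σ w, ∀ v₂ ∈ verticalSpace σ w,
    ∀ v₃ ∈ verticalSpace σ w, Ω w ![v₁, v₂, v₃] = 0
  nondegenerate : ∀ w, ∀ ξ : TangentSpace 𝓘(ℝ, E) w, mfderiv 𝓘(ℝ, E) 𝓘(ℝ, ℂ) σ w ξ ≠ 0 →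
    ∀ v₁ ∈ verticalSpace σ w, (∀ v₂ ∈ verticalSpace σ w, Ω w ![ξ, v₁, v₂] = 0) → v₁ = 0
  compatible : ∀ w, ∀ ξ : TangentSpace 𝓘(ℝ, E) w,
    ∀ v₁ ∈ verticalSpace σ w, ∀ v₂ ∈ verticalSpace σ w,
      Ω w ![complexStructure w ξ, v₁, v₂] = - Ω w ![ξ, v₁, complexStructure w v₂]

/-! ### The standard forms on `ℂ × ℂ²ⁿ` -/

/-- `ℂ²ⁿ = ℂⁿ × ℂⁿ`, with points `(q, z)`. The real coordinates are `q₁, q₂, p₁, p₂` with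
`q = q₁ + i q₂` and `z = p₁ - i p₂`. -/
abbrev C2n (n : ℕ) := (Fin n → ℂ) × (Fin n → ℂ)

/-- The wedge product of two 1-forms on a vector space. -/
def wedge11 {V : Type*} (α β : V → ℝ) : V → V → ℝ := fun u v => α u * β v - α v * β u

/-- The wedge product of a 2-form and a 1-form on a vector space. -/
def wedge21 {V : Type*} (θ : V → V → ℝ) (β : V → ℝ) : V → V → V → ℝ := fun a b c =>
  θ a b * β c + θ b c * β a + θ c a * β b

/-- The coordinate 1-form `dq₁ᵏ`. -/
def dq₁ {n : ℕ} (k : Fin n) : C2n n → ℝ := fun u => (u.1 k).re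
/-- The coordinate 1-form `dq₂ᵏ`. -/
def dq₂ {n : ℕ} (k : Fin n) : C2n n → ℝ := fun u => (u.1 k).im
/-- The coordinate 1-form `dp₁ᵏ`. -/
def dp₁ {n : ℕ} (k : Fin n) : C2n n → ℝ := fun u => (u.2 k).re
/-- The coordinate 1-form `dp₂ᵏ`; recall that `z = p₁ - i p₂`. -/
def dp₂ {n : ℕ} (k : Fin n) : C2n n → ℝ := fun u => -(u.2 k).im

/-- The standard form `ω₁ = ∑ₖ dp₁ᵏ ∧ dq₁ᵏ + dp₂ᵏ ∧ dq₂ᵏ` on `ℂ²ⁿ`. -/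
def omega₁ (n : ℕ) : C2n n → C2n n → ℝ := fun u v =>
  ∑ k : Fin n, (wedge11 (dp₁ k) (dq₁ k) u v + wedge11 (dp₂ k) (dq₂ k) u v)

/-- The standard form `ω₂ = ∑ₖ dp₁ᵏ ∧ dq₂ᵏ - dp₂ᵏ ∧ dq₁ᵏ` on `ℂ²ⁿ`. -/
def omega₂ (n : ℕ) : C2n n → C2n n → ℝ := fun u v =>
  ∑ k : Fin n, (wedge11 (dp₁ k) (dq₂ k) u v - wedge11 (dp₂ k) (dq₁ k) u v)

/-- The coordinate 1-form `dt₁` on `ℂ × ℂ²ⁿ`, where `t = t₁ + i t₂` is the first coordinate. -/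
def dt₁ {n : ℕ} : ℂ × C2n n → ℝ := fun a => a.1.re
/-- The coordinate 1-form `dt₂` on `ℂ × ℂ²ⁿ`. -/
def dt₂ {n : ℕ} : ℂ × C2n n → ℝ := fun a => a.1.im

/-- `Ω_std = ω₁ ∧ dt₂ - ω₂ ∧ dt₁` on `ℂ × ℂ²ⁿ` (a constant form). -/
def omegaStd (n : ℕ) (a b c : ℂ × C2n n) : ℝ :=
  wedge21 (fun u v => omega₁ n u.2 v.2) dt₂ a b c - wedge21 (fun u v => omega₂ n u.2 v.2) dt₁ a b c

/-- The 1-form `dH_t` at `y = (t, u)`: the differential at `u` of `H_t = H (t, ·)`, applied to the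
`ℂ²ⁿ`-component of a tangent vector. -/
def dHt {n : ℕ} (H : ℂ × C2n n → ℝ) (y : ℂ × C2n n) : ℂ × C2n n → ℝ := fun a =>
  fderiv ℝ (fun u : C2n n => H (y.1, u)) y.2 a.2

end

/-! Since σ has local sections, it is a submersion, and holomorphic coordinates (t, x) ∈ ℂ × ℂ²ⁿ
exist near w in which σ is t. Contracting Ω with ∂t₁ and ∂t₂ and restricting to the fibers gives two
families β₁, β₂ of 2-forms on ℂ²ⁿ with parameter t, and I-compatibility reads β₂(u, v) = -β₁(u, Iv).
It also makes -β₁ the imaginary part of a complex bilinear form, alternating and non-degenerate, so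
a complex symplectic basis at w (`exists_symplectic_equiv`, `IsCompatibleForm.exists_equiv`) gives
β₁ = -ω₂ and β₂ = ω₁ at that point.

By dΩ = 0 and 1-horizontality both families are closed along the fibers
(`eventually_closed_horizontalContraction`), and Moser's argument makes them constant, with t as a
parameter (`exists_darboux_map`). One vector field X serves both families: the deviations δᵢ from
the constant forms bᵢ and their homotopy primitives αᵢ satisfy δ₂ = -δ₁(·, I·) and α₂ = -α₁ ∘ I, so
the equation for i = 2 is the equation for i = 1 evaluated at Iv. The primitives, hence X, vanish to
first order at the base point. Therefore the time-one map exists near that point and is smooth, by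
the inverse function theorem in the Banach space of curves (`exists_timeOne_map`).

The resulting map preserves t, so Ω now has the components of Ω_std on at least two vertical
arguments. The remaining component Ω(∂t₁, ∂t₂, ·) is closed along the fibers, again by dΩ = 0, and
the Poincaré lemma with parameters writes it as -dH_t (`exists_hamiltonian`).

The Moser map is constructed only as a real map. Complex linearity on vertical vectors is recovered
afterwards: a non-degenerate form together with compatibility determines I on the fibers
(`map_I_smul_of_normalForm`). -/

noncomputable section

open Filter Set

universe u

/-! ### Smooth extension and local inverses -/

/-- A function that is smooth near a point agrees near it with a globally smooth function. -/
theorem exists_contDiff_eventuallyEq {E F : Type*} [NormedAddCommGroup E] [NormedSpace ℝ E]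
    [HasContDiffBump E] [NormedAddCommGroup F] [NormedSpace ℝ F] {f : E → F} {a : E}
    (h : ∀ᶠ x in 𝓝 a, ContDiffAt ℝ ∞ f x) : ∃ g : E → F, ContDiff ℝ ∞ g ∧ g =ᶠ[𝓝 a] f := by
  obtain ⟨r, hr, hball⟩ := Metric.eventually_nhds_iff_ball.1 h
  -- The cutoff vanishes outside the ball of radius r / 2, well inside the ball where f is smooth,
  -- so the product with f is smooth everywhere.
  let b : ContDiffBump a := ⟨r / 4, r / 2, by positivity, by linarith⟩
  refine ⟨fun x => b x • f x, ?_, ?_⟩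
  · rw [contDiff_iff_contDiffAt]
    intro x
    by_cases hx : x ∈ Metric.ball a r
    · exact b.contDiffAt.smul (hball x hx)
    · have : (fun x => b x • f x) =ᶠ[𝓝 x] fun _ => 0 := by
        have hx' : x ∈ (Metric.closedBall a (r / 2))ᶜ := by
          simp only [Metric.mem_ball, not_lt] at hx
          simp only [mem_compl_iff, Metric.mem_closedBall, not_le]
          linarith
        filter_upwards [Metric.isClosed_closedBall.isOpen_compl.mem_nhds hx'] with z hz
        have : b z = 0 := b.zero_of_le_dist (by
          simp only [mem_compl_iff, Metric.mem_closedBall, not_le] at hz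
          exact hz.le)
        simp [this]
      exact contDiffAt_const.congr_of_eventuallyEq this
  · filter_upwards [b.eventuallyEq_one] with x hx
    simp [hx]

/-- Inverse function theorem, with smoothness on whole neighbourhoods. -/
theorem exists_openPartialHomeomorph_of_contDiffAt {𝕂 : Type*} [RCLike 𝕂] {E F : Type*}
    [NormedAddCommGroup E] [NormedSpace 𝕂 E] [NormedAddCommGroup F] [NormedSpace 𝕂 F]
    [CompleteSpace E] {n : ℕ∞ω} (hn : n ≠ 0) {f : E → F} {a : E} {f' : E ≃L[𝕂] F}
    {O : Set E} (hO : O ∈ 𝓝 a)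
    (h : ∀ᶠ x in 𝓝 a, ContDiffAt 𝕂 n f x) (hf' : HasFDerivAt f (f' : E →L[𝕂] F) a) :
    ∃ e : OpenPartialHomeomorph E F, a ∈ e.source ∧ e.source ⊆ O ∧ (e : E → F) = f ∧
      (∀ x ∈ e.source, ContDiffAt 𝕂 n f x ∧ ∃ g : E ≃L[𝕂] F, HasFDerivAt f (g : E →L[𝕂] F) x) ∧
      (∀ y ∈ e.target, ContDiffAt 𝕂 n e.symm y) := by
  have ha := h.self_of_nhds
  let e₀ := ha.toOpenPartialHomeomorph f hf' hn
  have he₀ : (e₀ : E → F) = f := ha.toOpenPartialHomeomorph_coe hf' hn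
  have hcont : ContinuousAt (fderiv 𝕂 f) a :=
    (ha.fderiv_right (m := 0) (by simpa using ENat.one_le_iff_ne_zero_withTop.2 hn)).continuousAt
  -- Invertible operators form an open set, so the derivative stays invertible near a. Restricting
  -- to such points makes the inverse smooth on its whole domain and not only at the image of a.
  have hinv : ∀ᶠ x in 𝓝 a, fderiv 𝕂 f x ∈ range ((↑) : (E ≃L[𝕂] F) → E →L[𝕂] F) := by
    refine hcont ?_
    rw [hf'.fderiv]
    exact f'.nhds
  obtain ⟨s, hs, hso, has⟩ := eventually_nhds_iff.1 ((h.and hinv).and hO)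
  have hmem : a ∈ e₀.source := ha.mem_toOpenPartialHomeomorph_source hf' hn
  refine ⟨e₀.restrOpen s hso, ⟨hmem, has⟩, fun x hx => (hs x hx.2).2, he₀, ?_, ?_⟩
  · rintro x ⟨-, hx⟩
    obtain ⟨⟨h1, g, hg⟩, -⟩ := hs x hx
    exact ⟨h1, g, hg ▸ (h1.differentiableAt hn).hasFDerivAt⟩
  · intro y hy
    have hys : (e₀.restrOpen s hso).symm y ∈ s := ((e₀.restrOpen s hso).map_target hy).2
    obtain ⟨⟨h1, g, hg⟩, -⟩ := hs _ hys
    refine (e₀.restrOpen s hso).contDiffAt_symm hy (f₀' := g) ?_ ?_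
    · change HasFDerivAt e₀ _ _
      rw [he₀, hg]
      exact (h1.differentiableAt hn).hasFDerivAt
    · change ContDiffAt 𝕂 n e₀ _
      rw [he₀]; exact h1

/-! ### Composition operators on spaces of continuous maps -/

section Nemytskii

variable {K : Type*} [TopologicalSpace K] [CompactSpace K]

variable (K) in
/-- Pointwise application of a family of linear maps, as a bilinear operation on continuous maps. -/
def pointwiseApply (Z F : Type*)
    [NormedAddCommGroup Z] [NormedSpace ℝ Z] [NormedAddCommGroup F] [NormedSpace ℝ F] :
    C(K, Z →L[ℝ] F) →L[ℝ] C(K, Z) →L[ℝ] C(K, F) :=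
  LinearMap.mkContinuous₂
    (LinearMap.mk₂ ℝ (fun (A : C(K, Z →L[ℝ] F)) (h : C(K, Z)) =>
        (⟨fun k => A k (h k), A.continuous.clm_apply h.continuous⟩ : C(K, F)))
      (fun _ _ _ => by ext; simp) (fun _ _ _ => by ext; simp)
      (fun _ _ _ => by ext; simp) (fun _ _ _ => by ext; simp)) 1
    (fun A h => by
      rw [ContinuousMap.norm_le _ (by positivity)]
      intro k
      rw [one_mul]
      exact (A k).le_of_opNorm_le_of_le (A.norm_coe_le_norm k) (h.norm_coe_le_norm k))

@[simp]
theorem pointwiseApply_apply {Z F : Type*}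
    [NormedAddCommGroup Z] [NormedSpace ℝ Z] [NormedAddCommGroup F] [NormedSpace ℝ F]
    (A : C(K, Z →L[ℝ] F)) (h : C(K, Z)) (k : K) : pointwiseApply K Z F A h k = A k (h k) := rfl

/-- The range of γ is compact, so f' varies by at most ε within a distance δ of it, with the same δ
at all points of the range. The mean value inequality then bounds the remainder by ε‖h‖ uniformly in
k. -/
theorem hasFDerivAt_continuousMap_comp {Z F : Type*}
    [NormedAddCommGroup Z] [NormedSpace ℝ Z] [NormedAddCommGroup F] [NormedSpace ℝ F]
    (f : C(Z, F)) (f' : C(Z, Z →L[ℝ] F)) (hf : ∀ z, HasFDerivAt f (f' z) z) (γ : C(K, Z)) :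
    HasFDerivAt (fun γ : C(K, Z) => f.comp γ) (pointwiseApply K Z F (f'.comp γ)) γ := by
  rw [hasFDerivAt_iff_isLittleO_nhds_zero, Asymptotics.isLittleO_iff]
  intro ε hε
  have hS : IsCompact (range γ) := isCompact_range γ.continuous
  have hu := hS.uniformContinuousAt_of_continuousAt f' (fun a _ => f'.continuous.continuousAt)
    (Metric.dist_mem_uniformity hε)
  obtain ⟨δ, hδ, hδ'⟩ := Metric.mem_uniformity_dist.1 hu
  filter_upwards [Metric.ball_mem_nhds (0 : C(K, Z)) hδ] with h hh
  rw [ContinuousMap.norm_le _ (by positivity)]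
  intro k
  have hhk : ‖h k‖ < δ := (h.norm_coe_le_norm k).trans_lt (by simpa using hh)
  have := (convex_ball (γ k) δ).norm_image_sub_le_of_norm_hasFDerivWithin_le' (𝕜 := ℝ)
    (f := f) (f' := f') (φ := f' (γ k)) (C := ε) (x := γ k) (y := γ k + h k)
    (fun z _ => (hf z).hasFDerivWithinAt) (fun z hz => by
      rw [← dist_eq_norm, dist_comm]
      exact (hδ' (by rwa [Metric.mem_ball, dist_comm] at hz) (mem_range_self k)).le)
    (Metric.mem_ball_self hδ) (by simpa using hhk)
  refine le_trans ?_ (this.trans ?_)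
  · simp
  · rw [add_sub_cancel_left]
    gcongr
    exact h.norm_coe_le_norm k

/-- The derivative of a composition operator is a bounded linear image of the composition operator
of f', which drives the induction on n. The codomain F is generalized because it changes to Z →L F,
which stays in the same universe. -/
theorem contDiff_continuousMap_comp_nat {Z : Type u} [NormedAddCommGroup Z] [NormedSpace ℝ Z]
    (n : ℕ) : ∀ {F : Type u} [NormedAddCommGroup F] [NormedSpace ℝ F] (f : C(Z, F)),
    ContDiff ℝ ∞ f → ContDiff ℝ n (fun γ : C(K, Z) => f.comp γ) := by
  induction n with
  | zero =>
    intro F _ _ f _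
    exact contDiff_zero.2 (ContinuousMap.continuous_postcomp f)
  | succ n ih =>
    intro F _ _ f hf
    have hf' : ContDiff ℝ ∞ (fderiv ℝ f) := hf.fderiv_right (by simp)
    rw [Nat.cast_succ, contDiff_succ_iff_hasFDerivAt]
    have h₁ := ih (⟨fderiv ℝ f, hf'.continuous⟩ : C(Z, Z →L[ℝ] F)) hf'
    have h₂ : ContDiff ℝ n (pointwiseApply K Z F) := ContinuousLinearMap.contDiff _
    exact ⟨fun γ => pointwiseApply K Z F
        ((⟨fderiv ℝ f, hf'.continuous⟩ : C(Z, Z →L[ℝ] F)).comp γ),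
      h₂.comp h₁,
      hasFDerivAt_continuousMap_comp f ⟨_, hf'.continuous⟩
        (fun z => (hf.differentiable (by simp) z).hasFDerivAt)⟩

theorem contDiff_continuousMap_comp {Z F : Type u} [NormedAddCommGroup Z] [NormedSpace ℝ Z]
    [NormedAddCommGroup F] [NormedSpace ℝ F] (f : C(Z, F)) (hf : ContDiff ℝ ∞ f) :
    ContDiff ℝ ∞ (fun γ : C(K, Z) => f.comp γ) :=
  contDiff_infty.2 fun n => contDiff_continuousMap_comp_nat n f hf

end Nemytskii

/-! ### Integration along curves and integrals depending on a parameter -/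

/-- The constant map with a given value, as a continuous linear map. -/
def constMapCLM (K V : Type*) [TopologicalSpace K] [CompactSpace K]
    [NormedAddCommGroup V] [NormedSpace ℝ V] : V →L[ℝ] C(K, V) :=
  LinearMap.mkContinuous
    { toFun := ContinuousMap.const K, map_add' := fun _ _ => rfl, map_smul' := fun _ _ => rfl } 1
    fun v => by
      rw [ContinuousMap.norm_le _ (by positivity), one_mul]
      exact fun _ => le_rfl

@[simp]
theorem constMapCLM_apply {K V : Type*} [TopologicalSpace K] [CompactSpace K]
    [NormedAddCommGroup V] [NormedSpace ℝ V] (v : V) (k : K) : constMapCLM K V v k = v := rfl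

/-- Pairing of continuous maps, as a continuous linear map. -/
def pairMapCLM (K A B : Type*) [TopologicalSpace K] [CompactSpace K]
    [NormedAddCommGroup A] [NormedSpace ℝ A] [NormedAddCommGroup B] [NormedSpace ℝ B] :
    C(K, A) × C(K, B) →L[ℝ] C(K, A × B) :=
  ((ContinuousLinearMap.inl ℝ A B).compLeftContinuous ℝ K).comp (.fst ℝ _ _) +
    ((ContinuousLinearMap.inr ℝ A B).compLeftContinuous ℝ K).comp (.snd ℝ _ _)

@[simp]
theorem pairMapCLM_apply {K A B : Type*} [TopologicalSpace K] [CompactSpace K]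
    [NormedAddCommGroup A] [NormedSpace ℝ A] [NormedAddCommGroup B] [NormedSpace ℝ B]
    (p : C(K, A) × C(K, B)) (k : K) : pairMapCLM K A B p k = (p.1 k, p.2 k) := by
  simp [pairMapCLM]

/-- The inclusion of the unit interval, as a continuous map. -/
def unitIncl : C(unitInterval, ℝ) := ⟨Subtype.val, continuous_subtype_val⟩

@[simp]
theorem unitIncl_apply (s : unitInterval) : unitIncl s = s := rfl

/-- The operator `f ↦ (s ↦ ∫₀ˢ f)` on continuous curves. -/
def primitiveCLM (V : Type*) [NormedAddCommGroup V] [NormedSpace ℝ V] :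
    C(unitInterval, V) →L[ℝ] C(unitInterval, V) :=
  LinearMap.mkContinuous
    { toFun := fun f => (⟨fun s => ∫ r in (0 : ℝ)..s, IccExtend zero_le_one f r,
        (intervalIntegral.continuous_primitive
          (fun _ _ => (f.continuous.Icc_extend' (h := zero_le_one)).intervalIntegrable _ _) 0).comp
          continuous_subtype_val⟩ : C(unitInterval, V))
      map_add' := fun f g => by
        ext s
        exact intervalIntegral.integral_add
          ((f.continuous.Icc_extend' (h := zero_le_one)).intervalIntegrable _ _)
          ((g.continuous.Icc_extend' (h := zero_le_one)).intervalIntegrable _ _)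
      map_smul' := fun c f => by
        ext s
        exact intervalIntegral.integral_smul c _ } 1
    fun f => by
      rw [ContinuousMap.norm_le _ (by positivity), one_mul]
      intro s
      refine (intervalIntegral.norm_integral_le_of_norm_le_const (C := ‖f‖)
        (fun r _ => f.norm_coe_le_norm _)).trans ?_
      rw [sub_zero, abs_of_nonneg s.2.1]
      exact mul_le_of_le_one_right (norm_nonneg _) s.2.2

theorem primitiveCLM_apply {V : Type*} [NormedAddCommGroup V] [NormedSpace ℝ V]
    (f : C(unitInterval, V)) (s : unitInterval) :
    primitiveCLM V f s = ∫ r in (0 : ℝ)..s, IccExtend zero_le_one f r := rfl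

/-- Extending the curve by constants beyond [0, 1] keeps it continuous on ℝ, so the derivative is
two-sided even at the endpoints. -/
theorem hasDerivAt_integral_IccExtend {V : Type*} [NormedAddCommGroup V] [NormedSpace ℝ V]
    [CompleteSpace V] (f : C(unitInterval, V)) (s : ℝ) :
    HasDerivAt (fun s => ∫ r in (0 : ℝ)..s, IccExtend zero_le_one f r)
      (IccExtend zero_le_one f s) s := by
  have hc : Continuous (IccExtend zero_le_one f) := f.continuous.Icc_extend'
  exact intervalIntegral.integral_hasDerivAt_right (hc.intervalIntegrable _ _)
    hc.aestronglyMeasurable.stronglyMeasurableAtFilter hc.continuousAt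

theorem integral_IccExtend_one {V : Type*} [NormedAddCommGroup V] [NormedSpace ℝ V]
    {f : C(unitInterval, V)} {g : ℝ → V} (h : ∀ s : unitInterval, f s = g s) :
    primitiveCLM V f 1 = ∫ r in (0 : ℝ)..1, g r := by
  rw [primitiveCLM_apply]
  refine intervalIntegral.integral_congr fun r hr => ?_
  rw [Icc.coe_one, uIcc_of_le zero_le_one] at hr
  rw [IccExtend_of_mem _ _ hr, h]

section ParametricIntegral

variable {Y G : Type u} [NormedAddCommGroup Y] [NormedSpace ℝ Y]
  [NormedAddCommGroup G] [NormedSpace ℝ G]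

theorem contDiff_pairMap_unitIncl_const :
    ContDiff ℝ ∞ (fun y : Y => pairMapCLM unitInterval ℝ Y (unitIncl, constMapCLM _ _ y)) := by
  have h : ContDiff ℝ ∞ (pairMapCLM unitInterval ℝ Y) := ContinuousLinearMap.contDiff _
  have h' : ContDiff ℝ ∞ (constMapCLM unitInterval Y) := ContinuousLinearMap.contDiff _
  exact h.comp (contDiff_const.prodMk h')

/-- The integral factors as y ↦ (s ↦ (s, y)), then composition with f, then integration of curves.
The outer two maps are affine and linear, and the middle one is a smooth composition operator. The
chain rule for the same factorization differentiates under the integral sign below. -/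
theorem contDiff_integral_unitInterval {f : ℝ × Y → G} (hf : ContDiff ℝ ∞ f) :
    ContDiff ℝ ∞ (fun y => ∫ r in (0 : ℝ)..1, f (r, y)) := by
  let f' : C(ℝ × Y, G) := ⟨f, hf.continuous⟩
  have hp : ContDiff ℝ ∞ (primitiveCLM G) := ContinuousLinearMap.contDiff _
  have he : ContDiff ℝ ∞ (ContinuousMap.evalCLM ℝ 1 : C(unitInterval, G) →L[ℝ] G) :=
    ContinuousLinearMap.contDiff _
  have := he.comp (hp.comp ((contDiff_continuousMap_comp (K := unitInterval) f' hf).comp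
    contDiff_pairMap_unitIncl_const))
  convert this using 2 with y
  exact (integral_IccExtend_one fun s => by simp [f']).symm

theorem fderiv_integral_unitInterval {f : ℝ × Y → G} (hf : ContDiff ℝ ∞ f) (y v : Y) :
    fderiv ℝ (fun y => ∫ r in (0 : ℝ)..1, f (r, y)) y v =
      ∫ r in (0 : ℝ)..1, fderiv ℝ f (r, y) (0, v) := by
  let f' : C(ℝ × Y, G) := ⟨f, hf.continuous⟩
  have hdf : ContDiff ℝ ∞ (fderiv ℝ f) := hf.fderiv_right (by simp)
  let f'' : C(ℝ × Y, ℝ × Y →L[ℝ] G) := ⟨fderiv ℝ f, hdf.continuous⟩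
  have h₁ : HasFDerivAt (fun y : Y => pairMapCLM unitInterval ℝ Y (unitIncl, constMapCLM _ _ y))
      ((pairMapCLM unitInterval ℝ Y).comp
        ((ContinuousLinearMap.inr ℝ _ _).comp (constMapCLM unitInterval Y))) y := by
    have h : HasFDerivAt (fun y : Y => (unitIncl, constMapCLM unitInterval Y y))
        ((ContinuousLinearMap.inr ℝ _ _).comp (constMapCLM unitInterval Y)) y :=
      (hasFDerivAt_const _ y).prodMk (constMapCLM unitInterval Y).hasFDerivAt
    exact (pairMapCLM unitInterval ℝ Y).hasFDerivAt.comp y h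
  have h₂ := (hasFDerivAt_continuousMap_comp (K := unitInterval) f' f''
    (fun z => (hf.differentiable (by simp) z).hasFDerivAt) _).comp y h₁
  have h₃ := ((ContinuousMap.evalCLM ℝ (1 : unitInterval)).comp
    (primitiveCLM G)).hasFDerivAt.comp y h₂
  have h₄ : (fun y => ∫ r in (0 : ℝ)..1, f (r, y)) = fun y => primitiveCLM G (f'.comp
      (pairMapCLM unitInterval ℝ Y (unitIncl, constMapCLM unitInterval Y y))) 1 := by
    ext y
    exact (integral_IccExtend_one fun s => by simp [f']).symm
  rw [h₄]
  refine (congrArg (· v) (HasFDerivAt.fderiv h₃)).trans ?_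
  exact integral_IccExtend_one fun s => by simp [f'']

end ParametricIntegral

/-! ### The Poincaré lemma with parameters, in degrees one and two -/

section Poincare

variable {P V G : Type u} [NormedAddCommGroup P] [NormedSpace ℝ P]
  [NormedAddCommGroup V] [NormedSpace ℝ V]
  [NormedAddCommGroup G] [NormedSpace ℝ G]

/-- The map `(r, (p, x)) ↦ (p, r x)` and its derivative. -/
theorem hasFDerivAt_scale_snd (r : ℝ) (p : P) (x : V) :
    HasFDerivAt (fun z : ℝ × (P × V) => (z.2.1, z.1 • z.2.2))
      ((ContinuousLinearMap.fst ℝ P V ∘L ContinuousLinearMap.snd ℝ ℝ (P × V)).prod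
        (r • (ContinuousLinearMap.snd ℝ P V ∘L ContinuousLinearMap.snd ℝ ℝ (P × V)) +
          (ContinuousLinearMap.fst ℝ ℝ (P × V)).smulRight x)) (r, (p, x)) := by
  have h₁ : HasFDerivAt (fun z : ℝ × (P × V) => z.1) (ContinuousLinearMap.fst ℝ ℝ (P × V))
    (r, (p, x)) := hasFDerivAt_fst
  have h₂ : HasFDerivAt (fun z : ℝ × (P × V) => z.2.2)
    (ContinuousLinearMap.snd ℝ P V ∘L ContinuousLinearMap.snd ℝ ℝ (P × V)) (r, (p, x)) :=
    (ContinuousLinearMap.snd ℝ P V ∘L ContinuousLinearMap.snd ℝ ℝ (P × V)).hasFDerivAt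
  have h₃ : HasFDerivAt (fun z : ℝ × (P × V) => z.2.1)
    (ContinuousLinearMap.fst ℝ P V ∘L ContinuousLinearMap.snd ℝ ℝ (P × V)) (r, (p, x)) :=
    (ContinuousLinearMap.fst ℝ P V ∘L ContinuousLinearMap.snd ℝ ℝ (P × V)).hasFDerivAt
  exact h₃.prodMk (h₁.smul h₂)

theorem contDiff_scale_snd :
    ContDiff ℝ ∞ (fun z : ℝ × (P × V) => (z.2.1, z.1 • z.2.2)) := by fun_prop

-- Balls around (p₀, 0) in the product norm are stable under shrinking the V-component. Hypotheses
-- valid only near the base point thus hold along the whole segment used by the homotopy formula.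
omit [NormedSpace ℝ P] in
theorem eventually_segment {p₀ : P} {q : P × V → Prop} (h : ∀ᶠ y in 𝓝 (p₀, (0 : V)), q y) :
    ∀ᶠ y in 𝓝 (p₀, (0 : V)), ∀ r ∈ Icc (0 : ℝ) 1, q (y.1, r • y.2) := by
  obtain ⟨ε, hε, hb⟩ := Metric.eventually_nhds_iff_ball.1 h
  filter_upwards [Metric.ball_mem_nhds _ hε] with y hy r hr
  refine hb _ ?_
  rw [Metric.mem_ball, Prod.dist_eq, max_lt_iff] at hy ⊢
  refine ⟨hy.1, lt_of_le_of_lt ?_ hy.2⟩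
  simp only [dist_zero_right, norm_smul, Real.norm_eq_abs, abs_of_nonneg hr.1]
  exact mul_le_of_le_one_left (norm_nonneg _) hr.2

/-- The primitive `(p, x) ↦ ∫₀¹ α (p, r x) x dr` of a family of 1-forms. -/
def homotopyPrimitive₁ (α : P × V → V →L[ℝ] G) (y : P × V) : G :=
  ∫ r in (0 : ℝ)..1, α (y.1, r • y.2) y.2

theorem contDiff_homotopyPrimitive₁ {α : P × V → V →L[ℝ] G} (hα : ContDiff ℝ ∞ α) :
    ContDiff ℝ ∞ (homotopyPrimitive₁ α) :=
  contDiff_integral_unitInterval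
    (f := fun z : ℝ × (P × V) => α (z.2.1, z.1 • z.2.2) z.2.2)
    ((hα.comp contDiff_scale_snd).clm_apply (by fun_prop))

/-- By symmetry of the fiber derivative, the integrand of the differentiated primitive is d/dr (r
α(p, r x) v), whose integral over [0, 1] is α(p, x) v. -/
theorem eventually_fderiv_homotopyPrimitive₁ [CompleteSpace G] {α : P × V → V →L[ℝ] G}
    (hα : ContDiff ℝ ∞ α) {p₀ : P}
    (hsymm : ∀ᶠ y in 𝓝 (p₀, (0 : V)), ∀ u v, fderiv ℝ α y (0, u) v = fderiv ℝ α y (0, v) u) :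
    ∀ᶠ y in 𝓝 (p₀, (0 : V)), ∀ v, fderiv ℝ (homotopyPrimitive₁ α) y (0, v) = α y v := by
  filter_upwards [eventually_segment hsymm]
  rintro ⟨p, x⟩ hy v
  have hd := hα.differentiable (by simp)
  have key : ∀ r : ℝ, HasFDerivAt (fun z : ℝ × (P × V) => α (z.2.1, z.1 • z.2.2) z.2.2) _
      (r, (p, x)) := fun r =>
    ((hd _).hasFDerivAt.comp (r, (p, x)) (hasFDerivAt_scale_snd r p x)).clm_apply
      (ContinuousLinearMap.snd ℝ P V ∘L ContinuousLinearMap.snd ℝ ℝ (P × V)).hasFDerivAt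
  have hsm : ContDiff ℝ ∞ (fun z : ℝ × (P × V) => α (z.2.1, z.1 • z.2.2) z.2.2) :=
    (hα.comp contDiff_scale_snd).clm_apply (by fun_prop)
  refine (fderiv_integral_unitInterval hsm (p, x) (0, v)).trans ?_
  have hprim : ∀ r : ℝ, HasDerivAt (fun r : ℝ => r • α (p, r • x) v)
      (r • fderiv ℝ α (p, r • x) (0, x) v + α (p, r • x) v) r := by
    intro r
    have h₁ : HasDerivAt (fun r : ℝ => (p, r • x)) ((0 : P), x) r := by
      simpa using (hasDerivAt_const r p).prodMk ((hasDerivAt_id r).smul_const x)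
    have h₂ : HasDerivAt (fun r : ℝ => α (p, r • x) v) (fderiv ℝ α (p, r • x) (0, x) v) r := by
      simpa using ((hd _).hasFDerivAt.comp_hasDerivAt r h₁).clm_apply (hasDerivAt_const r v)
    simpa using (hasDerivAt_id' r).fun_smul h₂
  have hint := intervalIntegral.integral_eq_sub_of_hasDerivAt (a := 0) (b := 1)
    (fun r _ => hprim r) (Continuous.intervalIntegrable (by
      have h₁ := hα.continuous
      have h₂ : Continuous (fderiv ℝ α) := (hα.fderiv_right (m := 0) (by simp)).continuous
      fun_prop) _ _)
  simp only [one_smul, zero_smul, sub_zero] at hint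
  rw [← hint]
  refine intervalIntegral.integral_congr fun r hr => ?_
  rw [uIcc_of_le zero_le_one] at hr
  rw [(key r).fderiv, ← hy r hr v x]
  have h0 : fderiv ℝ α (p, r • x) (0, r • v) = r • fderiv ℝ α (p, r • x) (0, v) := by
    rw [← map_smul]; simp
  simp [h0, add_comm]

/-- The primitive `(p, x) ↦ ∫₀¹ r β (p, r x) (x, ·) dr` of a family of 2-forms. -/
def homotopyPrimitive₂ (β : P × V → V →L[ℝ] V →L[ℝ] G) (y : P × V) : V →L[ℝ] G :=
  ∫ r in (0 : ℝ)..1, r • β (y.1, r • y.2) y.2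

theorem contDiff_homotopyPrimitive₂_integrand {β : P × V → V →L[ℝ] V →L[ℝ] G}
    (hβ : ContDiff ℝ ∞ β) :
    ContDiff ℝ ∞ (fun z : ℝ × (P × V) => z.1 • β (z.2.1, z.1 • z.2.2) z.2.2) :=
  contDiff_fst.smul ((hβ.comp contDiff_scale_snd).clm_apply (by fun_prop))

theorem contDiff_homotopyPrimitive₂ {β : P × V → V →L[ℝ] V →L[ℝ] G} (hβ : ContDiff ℝ ∞ β) :
    ContDiff ℝ ∞ (homotopyPrimitive₂ β) :=
  contDiff_integral_unitInterval (contDiff_homotopyPrimitive₂_integrand hβ)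

theorem fderiv_homotopyPrimitive₂_apply [CompleteSpace G] {β : P × V → V →L[ℝ] V →L[ℝ] G}
    (hβ : ContDiff ℝ ∞ β) (p : P) (x u v : V) :
    fderiv ℝ (homotopyPrimitive₂ β) (p, x) (0, u) v =
      ∫ r in (0 : ℝ)..1, (r ^ 2 • fderiv ℝ β (p, r • x) (0, u) x v + r • β (p, r • x) u v) := by
  have hd := hβ.differentiable (by simp)
  have key : ∀ r : ℝ, HasFDerivAt
      (fun z : ℝ × (P × V) => z.1 • β (z.2.1, z.1 • z.2.2) z.2.2) _ (r, (p, x)) := fun r =>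
    (hasFDerivAt_fst (p := (r, (p, x)))).smul
    (((hd _).hasFDerivAt.comp (r, (p, x)) (hasFDerivAt_scale_snd r p x)).clm_apply
      (ContinuousLinearMap.snd ℝ P V ∘L ContinuousLinearMap.snd ℝ ℝ (P × V)).hasFDerivAt)
  have hf := contDiff_homotopyPrimitive₂_integrand hβ
  have h₁ := fderiv_integral_unitInterval hf (p, x) (0, u)
  have hc : Continuous fun r : ℝ => fderiv ℝ
      (fun z : ℝ × (P × V) => z.1 • β (z.2.1, z.1 • z.2.2) z.2.2) (r, (p, x)) (0, (0, u)) := by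
    have : Continuous (fderiv ℝ (fun z : ℝ × (P × V) => z.1 • β (z.2.1, z.1 • z.2.2) z.2.2)) :=
      (hf.fderiv_right (m := 0) (by simp)).continuous
    fun_prop
  refine (congrArg (· v) h₁).trans ?_
  refine (ContinuousLinearMap.intervalIntegral_apply (hc.intervalIntegrable _ _) v).trans ?_
  refine intervalIntegral.integral_congr fun r _ => ?_
  rw [(key r).fderiv]
  have h0 : fderiv ℝ β (p, r • x) (0, r • u) = r • fderiv ℝ β (p, r • x) (0, u) := by
    rw [← map_smul]; simp
  simp [h0, smul_smul, pow_two, add_comm]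

/-- Closedness and skewness turn the antisymmetrized integrand into r² D_xβ(u, v) + 2r β(u, v) =
d/dr (r² β(p, r x)(u, v)), which integrates to β(p, x)(u, v). -/
theorem eventually_extDeriv_homotopyPrimitive₂ [CompleteSpace G]
    {β : P × V → V →L[ℝ] V →L[ℝ] G} (hβ : ContDiff ℝ ∞ β) {p₀ : P}
    (halt : ∀ᶠ y in 𝓝 (p₀, (0 : V)), ∀ u v, β y u v = - β y v u)
    (hclosed : ∀ᶠ y in 𝓝 (p₀, (0 : V)), ∀ u v w, fderiv ℝ β y (0, u) v w =
      fderiv ℝ β y (0, v) u w - fderiv ℝ β y (0, w) u v) :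
    ∀ᶠ y in 𝓝 (p₀, (0 : V)), ∀ u v, fderiv ℝ (homotopyPrimitive₂ β) y (0, u) v -
      fderiv ℝ (homotopyPrimitive₂ β) y (0, v) u = β y u v := by
  filter_upwards [eventually_segment hclosed, eventually_segment halt]
  rintro ⟨p, x⟩ hy hy' u v
  have hd := hβ.differentiable (by simp)
  have hcont := hβ.continuous
  have hcont' : Continuous (fderiv ℝ β) := (hβ.fderiv_right (m := 0) (by simp)).continuous
  rw [fderiv_homotopyPrimitive₂_apply hβ, fderiv_homotopyPrimitive₂_apply hβ,
    ← intervalIntegral.integral_sub (Continuous.intervalIntegrable (by fun_prop) _ _)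
      (Continuous.intervalIntegrable (by fun_prop) _ _)]
  have hprim : ∀ r : ℝ, HasDerivAt (fun r : ℝ => r ^ 2 • β (p, r • x) u v)
      (r ^ 2 • fderiv ℝ β (p, r • x) (0, x) u v + (2 * r) • β (p, r • x) u v) r := by
    intro r
    have h₁ : HasDerivAt (fun r : ℝ => (p, r • x)) ((0 : P), x) r := by
      simpa using (hasDerivAt_const r p).prodMk ((hasDerivAt_id r).smul_const x)
    have h₂ : HasDerivAt (fun r : ℝ => β (p, r • x) u v)
        (fderiv ℝ β (p, r • x) (0, x) u v) r := by
      simpa using (((hd _).hasFDerivAt.comp_hasDerivAt r h₁).clm_apply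
        (hasDerivAt_const r u)).clm_apply (hasDerivAt_const r v)
    simpa using (hasDerivAt_pow 2 r).fun_smul h₂
  have hint := intervalIntegral.integral_eq_sub_of_hasDerivAt (a := 0) (b := 1)
    (fun r _ => hprim r) (Continuous.intervalIntegrable (by fun_prop) _ _)
  simp only [one_smul, one_pow, ne_eq, OfNat.ofNat_ne_zero, not_false_eq_true, zero_pow,
    zero_smul, sub_zero] at hint
  rw [← hint]
  refine intervalIntegral.integral_congr fun r hr => ?_
  rw [uIcc_of_le zero_le_one] at hr
  rw [hy r hr x u v, hy' r hr v u, two_mul, add_smul, smul_sub, smul_neg]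
  abel

end Poincare

/-! ### Smooth dependence of integral curves on initial conditions and parameters -/

section Flow

variable {P V : Type u} [NormedAddCommGroup P] [NormedSpace ℝ P]
  [NormedAddCommGroup V] [NormedSpace ℝ V]

/-- The curve `s ↦ (s, (p, γ s))` attached to `(p, x)` and `γ`. -/
def graphCurve (z : (P × V) × C(unitInterval, V)) : C(unitInterval, ℝ × (P × V)) :=
  pairMapCLM _ _ _ (unitIncl, pairMapCLM _ _ _ (constMapCLM _ _ z.1.1, z.2))

/-- The linear part of `graphCurve`. -/
def graphCurveCLM (P V : Type u) [NormedAddCommGroup P] [NormedSpace ℝ P]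
    [NormedAddCommGroup V] [NormedSpace ℝ V] :
    ((P × V) × C(unitInterval, V)) →L[ℝ] C(unitInterval, ℝ × (P × V)) :=
  (pairMapCLM unitInterval ℝ (P × V)) ∘L (ContinuousLinearMap.inr ℝ _ _) ∘L
    (pairMapCLM unitInterval P V) ∘L
      (((constMapCLM unitInterval P) ∘L (ContinuousLinearMap.fst ℝ P V) ∘L
        (ContinuousLinearMap.fst ℝ (P × V) C(unitInterval, V))).prod
        (ContinuousLinearMap.snd ℝ (P × V) C(unitInterval, V)))

theorem graphCurve_eq (z : (P × V) × C(unitInterval, V)) :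
    graphCurve z = graphCurve 0 + graphCurveCLM P V z := by
  ext s <;> simp [graphCurve, graphCurveCLM]

@[simp]
theorem graphCurve_apply (z : (P × V) × C(unitInterval, V)) (s : unitInterval) :
    graphCurve z s = ((s : ℝ), (z.1.1, z.2 s)) := by
  simp [graphCurve]

@[simp]
theorem graphCurveCLM_apply (z : (P × V) × C(unitInterval, V)) (s : unitInterval) :
    graphCurveCLM P V z s = (0, (z.1.1, z.2 s)) := by
  simp [graphCurveCLM]

theorem hasFDerivAt_graphCurve (z : (P × V) × C(unitInterval, V)) :
    HasFDerivAt graphCurve (graphCurveCLM P V) z := by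
  have : (graphCurve : (P × V) × C(unitInterval, V) → _) =
      fun z => graphCurve 0 + graphCurveCLM P V z := funext graphCurve_eq
  rw [this]
  exact (graphCurveCLM P V).hasFDerivAt.const_add _

theorem contDiff_graphCurve :
    ContDiff ℝ ∞ (graphCurve : (P × V) × C(unitInterval, V) → _) := by
  have : (graphCurve : (P × V) × C(unitInterval, V) → _) =
      fun z => graphCurve 0 + graphCurveCLM P V z := funext graphCurve_eq
  rw [this]
  have h : ContDiff ℝ ∞ (graphCurveCLM P V) := ContinuousLinearMap.contDiff _
  exact contDiff_const.add h

/-- The constant curve at the initial value. -/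
def initialCurveCLM (P V : Type u) [NormedAddCommGroup P] [NormedSpace ℝ P]
    [NormedAddCommGroup V] [NormedSpace ℝ V] :
    ((P × V) × C(unitInterval, V)) →L[ℝ] C(unitInterval, V) :=
  constMapCLM unitInterval V ∘L ContinuousLinearMap.snd ℝ P V ∘L
    ContinuousLinearMap.fst ℝ (P × V) C(unitInterval, V)

@[simp]
theorem initialCurveCLM_apply (z : (P × V) × C(unitInterval, V)) :
    initialCurveCLM P V z = constMapCLM _ _ z.1.2 := rfl

/-- The Picard operator `((p, x), γ) ↦ (s ↦ x + ∫₀ˢ f (r, (p, γ r)) dr)`. -/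
def picardOperator (f : C(ℝ × (P × V), V)) (z : (P × V) × C(unitInterval, V)) :
    C(unitInterval, V) :=
  initialCurveCLM P V z + primitiveCLM V (f.comp (graphCurve z))

/-- The derivative of the Picard operator. -/
def picardDeriv (f' : C(ℝ × (P × V), ℝ × (P × V) →L[ℝ] V)) (z : (P × V) × C(unitInterval, V)) :
    ((P × V) × C(unitInterval, V)) →L[ℝ] C(unitInterval, V) :=
  initialCurveCLM P V + primitiveCLM V ∘L
    pointwiseApply unitInterval _ V (f'.comp (graphCurve z)) ∘L graphCurveCLM P V

theorem contDiff_picardOperator {f : C(ℝ × (P × V), V)} (hf : ContDiff ℝ ∞ f) :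
    ContDiff ℝ ∞ (picardOperator f) := by
  have h₁ : ContDiff ℝ ∞ (initialCurveCLM P V) := ContinuousLinearMap.contDiff _
  have h₂ : ContDiff ℝ ∞ (primitiveCLM V) := ContinuousLinearMap.contDiff _
  exact h₁.add (h₂.comp ((contDiff_continuousMap_comp f hf).comp contDiff_graphCurve))

theorem hasFDerivAt_picardOperator {f : C(ℝ × (P × V), V)}
    {f' : C(ℝ × (P × V), ℝ × (P × V) →L[ℝ] V)} (hf : ∀ z, HasFDerivAt f (f' z) z)
    (z : (P × V) × C(unitInterval, V)) :
    HasFDerivAt (picardOperator f) (picardDeriv f' z) z := by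
  have h := (hasFDerivAt_continuousMap_comp (K := unitInterval) f f' hf (graphCurve z)).comp z
    (hasFDerivAt_graphCurve z)
  have h₂ : HasFDerivAt (fun z => primitiveCLM V (f.comp (graphCurve z))) _ z :=
    (primitiveCLM V).hasFDerivAt.comp z h
  exact (initialCurveCLM P V).hasFDerivAt.add h₂

/-- The shear `(y, γ) ↦ (y, γ - const x)`, `y = (p, x)`. -/
def shearEquiv (P V : Type u) [NormedAddCommGroup P] [NormedSpace ℝ P]
    [NormedAddCommGroup V] [NormedSpace ℝ V] :
    ((P × V) × C(unitInterval, V)) ≃L[ℝ] ((P × V) × C(unitInterval, V)) :=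
  ContinuousLinearEquiv.equivOfInverse
    ((ContinuousLinearMap.fst ℝ (P × V) C(unitInterval, V)).prod
      (ContinuousLinearMap.snd ℝ (P × V) C(unitInterval, V) - initialCurveCLM P V))
    ((ContinuousLinearMap.fst ℝ (P × V) C(unitInterval, V)).prod
      (ContinuousLinearMap.snd ℝ (P × V) C(unitInterval, V) + initialCurveCLM P V))
    (fun z => by ext <;> simp) (fun z => by ext <;> simp)

/-- Near a common zero of first order, the time-one map of a smooth time- and parameter-dependent
vector field exists and is smooth; its derivative solves the linearized equation. -/
theorem exists_timeOne_map [CompleteSpace P] [CompleteSpace V] {f : ℝ × (P × V) → V}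
    (hf : ContDiff ℝ ∞ f) {p₀ : P} (h0 : ∀ s, f (s, (p₀, 0)) = 0)
    (h0' : ∀ s w, fderiv ℝ f (s, (p₀, 0)) (0, w) = 0) :
    ∃ φ : P × V → V, (∀ᶠ y in 𝓝 (p₀, (0 : V)), ContDiffAt ℝ ∞ φ y) ∧ φ (p₀, 0) = 0 ∧
      (∀ w, fderiv ℝ φ (p₀, 0) w = w.2) ∧
      ∀ q : P × V → Prop, (∀ᶠ y in 𝓝 (p₀, (0 : V)), q y) → ∀ᶠ y in 𝓝 (p₀, (0 : V)),
        ∃ c : ℝ → V, c 0 = y.2 ∧ c 1 = φ y ∧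
          (∀ s ∈ Icc (0 : ℝ) 1, q (y.1, c s) ∧ HasDerivAt c (f (s, (y.1, c s))) s) ∧
          ∀ u, ∃ Y : ℝ → V, Y 0 = u ∧ Y 1 = fderiv ℝ φ y (0, u) ∧
            ∀ s ∈ Icc (0 : ℝ) 1,
              HasDerivAt Y (fderiv ℝ f (s, (y.1, c s)) (0, (0, Y s))) s := by
  let F : C(ℝ × (P × V), V) := ⟨f, hf.continuous⟩
  have hdf : ContDiff ℝ ∞ (fderiv ℝ f) := hf.fderiv_right (by simp)
  let F' : C(ℝ × (P × V), ℝ × (P × V) →L[ℝ] V) := ⟨fderiv ℝ f, hdf.continuous⟩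
  have hF' : ∀ z, HasFDerivAt F (F' z) z := fun z =>
    (hf.differentiable (by simp) z).hasFDerivAt
  have hR := contDiff_picardOperator (f := F) hf
  have hR' := hasFDerivAt_picardOperator hF'
  -- Solutions of Φ(y, γ) = (y, 0) are exactly the fixed points of the Picard operator, that is, the
  -- integral curves over [0, 1] with initial value and parameter given by y.
  let Φ : (P × V) × C(unitInterval, V) → (P × V) × C(unitInterval, V) :=
    fun z => (z.1, z.2 - picardOperator F z)
  have hΦ : ContDiff ℝ ∞ Φ := contDiff_fst.prodMk (contDiff_snd.sub hR)
  let z₀ : (P × V) × C(unitInterval, V) := ((p₀, 0), 0)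
  have hpw : ∀ w, pointwiseApply unitInterval _ V (F'.comp (graphCurve z₀))
      (graphCurveCLM P V w) = 0 := by
    intro w; ext s; simp [F', z₀, h0']
  -- As f has vanishing derivative in all directions except time along the constant solution, the
  -- integral term contributes nothing, and the derivative of Φ is the invertible shear.
  have hd₀ : picardDeriv F' z₀ = initialCurveCLM P V := by
    refine ContinuousLinearMap.ext fun w => ?_
    simp [picardDeriv, hpw]
  have hΦ' : HasFDerivAt Φ (shearEquiv P V : _ →L[ℝ] _) z₀ := by
    have h := hR' z₀
    rw [hd₀] at h
    exact hasFDerivAt_fst.prodMk (hasFDerivAt_snd.sub h)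
  obtain ⟨e, hz₀, -, he, -, hesymm⟩ := exists_openPartialHomeomorph_of_contDiffAt (𝕂 := ℝ)
    (n := ∞) (by simp) (O := univ) univ_mem (Eventually.of_forall fun z => hΦ.contDiffAt) hΦ'
  have hR₀ : picardOperator F z₀ = 0 := by
    have : F.comp (graphCurve z₀) = 0 := by ext s; simp [F, z₀, h0]
    rw [picardOperator, this]; ext s; simp [z₀]
  have hez₀ : e z₀ = ((p₀, 0), 0) := by
    rw [he]; simp only [Φ, hR₀]; simp [z₀]
  have htar : ((p₀, (0 : V)), (0 : C(unitInterval, V))) ∈ e.target := hez₀ ▸ e.map_source hz₀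
  let Γ : P × V → C(unitInterval, V) := fun y => (e.symm (y, 0)).2
  have hj : ContDiff ℝ ∞ (fun y : P × V => (y, (0 : C(unitInterval, V)))) :=
    contDiff_id.prodMk contDiff_const
  have hnear : ∀ᶠ y in 𝓝 (p₀, (0 : V)), (y, (0 : C(unitInterval, V))) ∈ e.target :=
    hj.continuous.continuousAt.eventually_mem (e.open_target.mem_nhds htar)
  have hΓ : ∀ᶠ y in 𝓝 (p₀, (0 : V)), ContDiffAt ℝ ∞ Γ y := by
    filter_upwards [hnear] with y hy
    exact contDiffAt_snd.comp y ((hesymm _ hy).comp y hj.contDiffAt)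
  have hfix : ∀ᶠ y in 𝓝 (p₀, (0 : V)), Γ y = picardOperator F (y, Γ y) := by
    filter_upwards [hnear] with y hy
    have h := e.right_inv hy
    rw [he] at h
    simp only [Φ, Prod.mk.injEq] at h
    have h2 : e.symm (y, 0) = (y, Γ y) := Prod.ext h.1 rfl
    rw [h2] at h
    exact sub_eq_zero.1 h.2
  have hΓ₀ : Γ (p₀, 0) = 0 := by
    have : e.symm ((p₀, 0), 0) = z₀ := by rw [← hez₀, e.left_inv hz₀]
    simp only [Γ, this, z₀]
  -- Differentiating the fixed-point equation in y gives the integrated form of the linearized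
  -- equation.
  have hΓ' : ∀ᶠ y in 𝓝 (p₀, (0 : V)), ∀ w,
      fderiv ℝ Γ y w = picardDeriv F' (y, Γ y) (w, fderiv ℝ Γ y w) := by
    filter_upwards [hΓ, hfix.eventually_nhds] with y hy hy' w
    have h₁ : HasFDerivAt Γ (fderiv ℝ Γ y) y := (hy.differentiableAt (by simp)).hasFDerivAt
    have h₃ : HasFDerivAt (fun y => (y, Γ y)) _ y := (hasFDerivAt_id y).prodMk h₁
    have h₂ : HasFDerivAt (fun y => picardOperator F (y, Γ y)) _ y :=
      HasFDerivAt.comp (f := fun y => (y, Γ y)) y (hR' (y, Γ y)) h₃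
    exact congrArg (· w) (h₁.unique (h₂.congr_of_eventuallyEq hy'))
  let ev : C(unitInterval, V) →L[ℝ] V := ContinuousMap.evalCLM ℝ 1
  have hev : ContDiff ℝ ∞ ev := ContinuousLinearMap.contDiff _
  have hφ' : ∀ᶠ y in 𝓝 (p₀, (0 : V)), ∀ w,
      fderiv ℝ (fun y => ev (Γ y)) y w = fderiv ℝ Γ y w 1 := by
    filter_upwards [hΓ] with y hy w
    have h₁ : HasFDerivAt Γ (fderiv ℝ Γ y) y := (hy.differentiableAt (by simp)).hasFDerivAt
    have h₂ : HasFDerivAt (fun y => ev (Γ y)) (ev ∘L fderiv ℝ Γ y) y :=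
      ev.hasFDerivAt.comp y h₁
    rw [h₂.fderiv]; rfl
  refine ⟨fun y => ev (Γ y), ?_, ?_, ?_, ?_⟩
  · filter_upwards [hΓ] with y hy
    exact hev.contDiffAt.comp y hy
  · simp [hΓ₀]
  · intro w
    rw [hφ'.self_of_nhds w, hΓ'.self_of_nhds w, hΓ₀]
    change picardDeriv F' z₀ _ 1 = _
    rw [hd₀]; rfl
  · intro q hq
    obtain ⟨ε, hε, hb⟩ := Metric.eventually_nhds_iff_ball.1 hq
    have hsmall : ∀ᶠ y in 𝓝 (p₀, (0 : V)), ‖Γ y‖ < ε := by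
      have hc : ContinuousAt Γ (p₀, 0) := hΓ.self_of_nhds.continuousAt
      have := hc.norm
      simp only [ContinuousAt, hΓ₀, norm_zero] at this
      exact this.eventually_lt_const hε
    filter_upwards [hsmall, Metric.ball_mem_nhds _ hε, hfix, hΓ', hφ'] with y hy₁ hy₂ hy₃ hy₄ hy₅
    rw [Metric.mem_ball, Prod.dist_eq, max_lt_iff] at hy₂
    -- The curve is redefined on ℝ by the right-hand side of the integral equation, so that it is
    -- differentiable at 0 and 1 as well. On [0, 1] it agrees with Γ y.
    let c : ℝ → V := fun s => y.2 + ∫ r in (0 : ℝ)..s,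
      IccExtend zero_le_one (F.comp (graphCurve (y, Γ y))) r
    have hc : ∀ s : unitInterval, c s = Γ y s := fun s =>
      (congrArg (fun g : C(unitInterval, V) => g s) hy₃).symm
    refine ⟨c, by simp [c], ?_, ?_, ?_⟩
    · exact hc 1
    · intro s hs
      have hcs := hc ⟨s, hs⟩
      refine ⟨hb _ ?_, ?_⟩
      · rw [Metric.mem_ball, Prod.dist_eq, max_lt_iff]
        refine ⟨hy₂.1, ?_⟩
        rw [dist_zero_right]
        change ‖c (⟨s, hs⟩ : unitInterval)‖ < ε
        rw [hcs]
        exact ((Γ y).norm_coe_le_norm _).trans_lt hy₁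
      · have h := (hasDerivAt_integral_IccExtend (F.comp (graphCurve (y, Γ y))) s).const_add y.2
        rw [IccExtend_of_mem _ _ hs] at h
        convert h using 1
        simp [F, ← hcs]
    · intro u
      let A : C(unitInterval, V) := pointwiseApply unitInterval _ V
        (F'.comp (graphCurve (y, Γ y))) (graphCurveCLM P V ((0, u), fderiv ℝ Γ y (0, u)))
      let Y : ℝ → V := fun s => u + ∫ r in (0 : ℝ)..s, IccExtend zero_le_one A r
      have hY : ∀ s : unitInterval, Y s = fderiv ℝ Γ y (0, u) s := fun s =>
        (congrArg (fun g : C(unitInterval, V) => g s) (hy₄ (0, u))).symm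
      refine ⟨Y, by simp [Y], ?_, ?_⟩
      · rw [hy₅]; exact hY 1
      · intro s hs
        have hcs := hc ⟨s, hs⟩
        have hYs := hY ⟨s, hs⟩
        have h := (hasDerivAt_integral_IccExtend A s).const_add u
        rw [IccExtend_of_mem _ _ hs] at h
        convert h using 1
        simp [A, F', ← hcs, ← hYs]

end Flow

/-! ### Moser's argument -/

section Moser

variable {P V : Type} [NormedAddCommGroup P] [NormedSpace ℝ P]
  [NormedAddCommGroup V] [NormedSpace ℝ V]

/-- Pointwise hypotheses under which the flow of `X` transports the form `b` to `b + s δ`. -/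
structure IsMoserPoint (b : V →L[ℝ] V →L[ℝ] ℝ) (δ : P × V → V →L[ℝ] V →L[ℝ] ℝ)
    (α : P × V → V →L[ℝ] ℝ) (X : ℝ × (P × V) → V) (y : P × V) : Prop where
  skew : ∀ u v, δ y u v = - δ y v u
  closed : ∀ u v w, fderiv ℝ δ y (0, u) v w = fderiv ℝ δ y (0, v) u w - fderiv ℝ δ y (0, w) u v
  primitive : ∀ u v, fderiv ℝ α y (0, u) v - fderiv ℝ α y (0, v) u = δ y u v
  contraction : ∀ᶠ z in 𝓝 y, ∀ s ∈ Icc (0 : ℝ) 1, ∀ v,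
    b (X (s, z)) v + s * δ z (X (s, z)) v = - α z v

/-- The contraction identity holds in a neighbourhood of y, hence may be differentiated there at
fixed s and v in the fiber direction u. -/
theorem IsMoserPoint.fderiv_contraction {b : V →L[ℝ] V →L[ℝ] ℝ}
    {δ : P × V → V →L[ℝ] V →L[ℝ] ℝ} {α : P × V → V →L[ℝ] ℝ} {X : ℝ × (P × V) → V} {y : P × V}
    (h : IsMoserPoint b δ α X y) (hδ : ContDiff ℝ ∞ δ) (hα : ContDiff ℝ ∞ α)
    (hX : ContDiff ℝ ∞ X) {s : ℝ} (hs : s ∈ Icc (0 : ℝ) 1) (u v : V) :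
    b (fderiv ℝ X (s, y) (0, (0, u))) v + s * (fderiv ℝ δ y (0, u) (X (s, y)) v +
      δ y (fderiv ℝ X (s, y) (0, (0, u))) v) = - fderiv ℝ α y (0, u) v := by
  have hXd : HasFDerivAt (fun z => X (s, z))
      (fderiv ℝ X (s, y) ∘L ContinuousLinearMap.inr ℝ ℝ (P × V)) y :=
    HasFDerivAt.comp (f := fun z => (s, z)) y (hX.differentiable (by simp) _).hasFDerivAt
      (hasFDerivAt_prodMk_right s y)
  have hδd := (hδ.differentiable (by simp) y).hasFDerivAt
  have hαd := (hα.differentiable (by simp) y).hasFDerivAt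
  have h₁ := ((b.hasFDerivAt.comp y hXd).clm_apply (hasFDerivAt_const v y)).add
    (((hδd.clm_apply hXd).clm_apply (hasFDerivAt_const v y)).const_mul s)
  have h₂ := ((hαd.clm_apply (hasFDerivAt_const v y)).neg)
  have h₃ : (fun z => - α z v) =ᶠ[𝓝 y]
      fun z => b (X (s, z)) v + s * δ z (X (s, z)) v := by
    filter_upwards [h.contraction] with z hz
    exact (hz s hs v).symm
  have := congrArg (fun L => L (0, u)) (h₁.unique (h₂.congr_of_eventuallyEq h₃.symm))
  simpa [add_comm, mul_add] using this

/-- Y and Z are tangent vectors carried along by the flow. By Cartan's formula for the fiberwise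
closed form b + s δ, the derivative of (b + s δ)(Y, Z) is (δ + d ι_X(b + s δ))(Y, Z) = (δ - dα)(Y,
Z) = 0. -/
theorem IsMoserPoint.invariance {b : V →L[ℝ] V →L[ℝ] ℝ} (hb : ∀ u v, b u v = - b v u)
    {δ : P × V → V →L[ℝ] V →L[ℝ] ℝ} {α : P × V → V →L[ℝ] ℝ} {X : ℝ × (P × V) → V}
    (hδ : ContDiff ℝ ∞ δ) (hα : ContDiff ℝ ∞ α) (hX : ContDiff ℝ ∞ X) {p : P}
    {c Y Z : ℝ → V} (hc : ∀ s ∈ Icc (0 : ℝ) 1, IsMoserPoint b δ α X (p, c s))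
    (hc' : ∀ s ∈ Icc (0 : ℝ) 1, HasDerivAt c (X (s, (p, c s))) s)
    (hY : ∀ s ∈ Icc (0 : ℝ) 1, HasDerivAt Y (fderiv ℝ X (s, (p, c s)) (0, (0, Y s))) s)
    (hZ : ∀ s ∈ Icc (0 : ℝ) 1, HasDerivAt Z (fderiv ℝ X (s, (p, c s)) (0, (0, Z s))) s) :
    b (Y 1) (Z 1) + δ (p, c 1) (Y 1) (Z 1) = b (Y 0) (Z 0) := by
  have key : ∀ s ∈ Icc (0 : ℝ) 1,
      HasDerivAt (fun s => b (Y s) (Z s) + s * δ (p, c s) (Y s) (Z s)) 0 s := by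
    intro s hs
    have hp : HasDerivAt (fun s => (p, c s)) ((0 : P), X (s, (p, c s))) s :=
      (hasDerivAt_const s p).prodMk (hc' s hs)
    have hδs : HasDerivAt (fun s => δ (p, c s)) (fderiv ℝ δ (p, c s) (0, X (s, (p, c s)))) s :=
      ((hδ.differentiable (by simp) _).hasFDerivAt).comp_hasDerivAt s hp
    have h₁ := ((b.hasFDerivAt.comp_hasDerivAt s (hY s hs)).clm_apply (hZ s hs)).add
      ((hasDerivAt_id s).mul ((hδs.clm_apply (hY s hs)).clm_apply (hZ s hs)))
    refine h₁.congr_deriv ?_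
    have e₁ := (hc s hs).fderiv_contraction hδ hα hX hs (Y s) (Z s)
    have e₂ := (hc s hs).fderiv_contraction hδ hα hX hs (Z s) (Y s)
    have e₃ := (hc s hs).primitive (Y s) (Z s)
    have e₄ := (hc s hs).closed (X (s, (p, c s))) (Y s) (Z s)
    have e₅ := (hc s hs).skew (Y s) (fderiv ℝ X (s, (p, c s)) (0, (0, Z s)))
    have e₆ := hb (Y s) (fderiv ℝ X (s, (p, c s)) (0, (0, Z s)))
    simp only [Function.comp, id, add_apply, one_mul]
    rw [e₅, e₆, e₄]
    linear_combination e₁ - e₂ - e₃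
  have h := constant_of_derivWithin_zero (a := 0) (b := 1)
    (fun s hs => (key s hs).differentiableAt.differentiableWithinAt)
    (fun s hs => by
      have hs' := Ico_subset_Icc_self hs
      exact (key s hs').hasDerivWithinAt.derivWithin
        (uniqueDiffOn_Icc zero_lt_one s hs')) 1 (right_mem_Icc.2 zero_le_one)
  simpa using h

omit [NormedAddCommGroup P] [NormedSpace ℝ P] in
theorem homotopyPrimitive₂_zero {G : Type} [NormedAddCommGroup G] [NormedSpace ℝ G]
    (δ : P × V → V →L[ℝ] V →L[ℝ] G) (p : P) : homotopyPrimitive₂ δ (p, 0) = 0 := by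
  simp [homotopyPrimitive₂]

/-- Along P × {0} the primitive vanishes identically, which handles the P-directions. In the
V-directions both terms of the integrand vanish at x = 0 because δ(p₀, 0) = 0. This is the
first-order vanishing required of the Moser field. -/
theorem fderiv_homotopyPrimitive₂_eq_zero {δ : P × V → V →L[ℝ] V →L[ℝ] ℝ}
    (hδ : ContDiff ℝ ∞ δ) {p₀ : P} (h0 : δ (p₀, 0) = 0) :
    fderiv ℝ (homotopyPrimitive₂ δ) (p₀, 0) = 0 := by
  have hα := contDiff_homotopyPrimitive₂ hδ
  have hP : ∀ a, fderiv ℝ (homotopyPrimitive₂ δ) (p₀, 0) (a, 0) = 0 := by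
    intro a
    have h := HasFDerivAt.comp (f := fun p : P => (p, (0 : V))) p₀
      (hα.differentiable (by simp) _).hasFDerivAt (hasFDerivAt_prodMk_left p₀ (0 : V))
    have h' : homotopyPrimitive₂ δ ∘ (fun p : P => (p, (0 : V))) = fun _ => 0 :=
      funext fun p => homotopyPrimitive₂_zero δ p
    rw [h'] at h
    exact congrArg (· a) (h.unique (hasFDerivAt_const _ _))
  have hV : ∀ u, fderiv ℝ (homotopyPrimitive₂ δ) (p₀, 0) (0, u) = 0 := by
    intro u
    ext v
    rw [fderiv_homotopyPrimitive₂_apply hδ]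
    simp [h0]
  refine ContinuousLinearMap.ext fun w => ?_
  have : w = (w.1, 0) + (0, w.2) := by simp
  rw [this, map_add, hP, hV]; simp

/-- With A = S⁻¹δ the equation is solved by X = -(1 + sA)⁻¹ S⁻¹α. As A vanishes at the base point, 1
+ sA is near the identity for all s ∈ [0, 1] at once; there inversion agrees with the globally
smooth g. -/
theorem exists_moser_vectorField [FiniteDimensional ℝ V]
    {δ : P × V → V →L[ℝ] V →L[ℝ] ℝ} (hδ : ContDiff ℝ ∞ δ) {α : P × V → V →L[ℝ] ℝ}
    (hα : ContDiff ℝ ∞ α) {p₀ : P} (h0 : δ (p₀, 0) = 0) (hα0 : α (p₀, 0) = 0)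
    (hα0' : fderiv ℝ α (p₀, 0) = 0) (S : V ≃L[ℝ] V →L[ℝ] ℝ) :
    ∃ X : ℝ × (P × V) → V, ContDiff ℝ ∞ X ∧ (∀ s, X (s, (p₀, 0)) = 0) ∧
      (∀ s w, fderiv ℝ X (s, (p₀, 0)) (0, w) = 0) ∧
      ∀ᶠ y in 𝓝 (p₀, (0 : V)), ∀ s ∈ Icc (0 : ℝ) 1, ∀ v,
        S (X (s, y)) v + s * δ y (X (s, y)) v = - α y v := by
  have hinv : ∀ᶠ T in 𝓝 (1 : V →L[ℝ] V), ContDiffAt ℝ ∞ Ring.inverse T := by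
    filter_upwards [Units.isOpen.mem_nhds (isUnit_one : IsUnit (1 : V →L[ℝ] V))] with T hT
    obtain ⟨u, rfl⟩ := hT
    exact contDiffAt_ringInverse ℝ u
  obtain ⟨g, hg, hg'⟩ := exists_contDiff_eventuallyEq hinv
  have hgT : ∀ᶠ T in 𝓝 (1 : V →L[ℝ] V), ∀ x, T (g T x) = x := by
    filter_upwards [hg', Units.isOpen.mem_nhds (isUnit_one : IsUnit (1 : V →L[ℝ] V))]
      with T hT hu x
    rw [hT]
    exact congrArg (· x) (Ring.mul_inverse_cancel T hu)
  let A : P × V → V →L[ℝ] V := fun y => (S.symm : (V →L[ℝ] ℝ) →L[ℝ] V) ∘L δ y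
  have hA : ContDiff ℝ ∞ A := contDiff_const.clm_comp hδ
  have hA0 : A (p₀, 0) = 0 := by simp [A, h0]
  let X : ℝ × (P × V) → V := fun z => - g (1 + z.1 • A z.2) (S.symm (α z.2))
  have hN : ContDiff ℝ ∞ (fun z : ℝ × (P × V) => g (1 + z.1 • A z.2)) :=
    hg.comp (contDiff_const.add (contDiff_fst.smul (hA.comp contDiff_snd)))
  have hm : ContDiff ℝ ∞ (fun z : ℝ × (P × V) => S.symm (α z.2)) :=
    S.symm.contDiff.comp (hα.comp contDiff_snd)
  refine ⟨X, (hN.clm_apply hm).neg, fun s => by simp [X, hα0], ?_, ?_⟩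
  · intro s w
    have h₁ := (hN.differentiable (by simp) (s, (p₀, (0 : V)))).hasFDerivAt
    -- In the product rule for X, both the value and the derivative of this factor vanish at the
    -- base point, so the derivative of g is not needed.
    have h₂ : HasFDerivAt (fun z : ℝ × (P × V) => S.symm (α z.2)) (0 : _ →L[ℝ] V)
        (s, (p₀, 0)) := by
      have h₃ := (hα.differentiable (by simp) (p₀, (0 : V))).hasFDerivAt
      rw [hα0'] at h₃
      have h₄ := S.symm.hasFDerivAt.comp (s, (p₀, (0 : V)))
        (HasFDerivAt.comp (s, (p₀, (0 : V))) (f := Prod.snd) h₃ hasFDerivAt_snd)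
      rwa [ContinuousLinearMap.zero_comp, ContinuousLinearMap.comp_zero] at h₄
    have h₅ : HasFDerivAt X _ (s, (p₀, 0)) := (h₁.clm_apply h₂).neg
    rw [h₅.fderiv]
    simp [hα0]
  · obtain ⟨ε, hε, hb⟩ := Metric.eventually_nhds_iff_ball.1 hgT
    have hsm : ∀ᶠ y in 𝓝 (p₀, (0 : V)), ‖A y‖ < ε := by
      have h := (hA.continuous.continuousAt (x := (p₀, (0 : V)))).norm
      simp only [ContinuousAt, hA0, norm_zero] at h
      exact h.eventually_lt_const hε
    filter_upwards [hsm] with y hy s hs v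
    have hT := hb (1 + s • A y) (by
      rw [mem_ball_iff_norm, add_sub_cancel_left, norm_smul, Real.norm_eq_abs,
        abs_of_nonneg hs.1]
      exact (mul_le_of_le_one_left (norm_nonneg _) hs.2).trans_lt hy) (S.symm (α y))
    have h₁ := congrArg S hT
    have h₂ := congrArg (fun L : V →L[ℝ] ℝ => L v) h₁
    simp only [X, A, add_apply, one_apply_eq_self, map_add, smul_apply, map_smul,
      ContinuousLinearMap.comp_apply, ContinuousLinearEquiv.coe_coe,
      ContinuousLinearEquiv.apply_symm_apply, smul_eq_mul, map_neg, neg_apply] at h₂ ⊢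
    linarith

/-- Relative Darboux theorem: two families of closed 2-forms related by `J` are simultaneously
brought to constant form by a map depending smoothly on the parameter. -/
theorem exists_darboux_map [FiniteDimensional ℝ P] [FiniteDimensional ℝ V]
    {β₁ β₂ : P × V → V →L[ℝ] V →L[ℝ] ℝ} {b₁ b₂ : V →L[ℝ] V →L[ℝ] ℝ} (J : V →L[ℝ] V) {p₀ : P}
    (hβ₁ : ∀ᶠ y in 𝓝 (p₀, (0 : V)), ContDiffAt ℝ ∞ β₁ y)
    (hβ₂ : ∀ᶠ y in 𝓝 (p₀, (0 : V)), ContDiffAt ℝ ∞ β₂ y)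
    (hskew₁ : ∀ᶠ y in 𝓝 (p₀, (0 : V)), ∀ u v, β₁ y u v = - β₁ y v u)
    (hskew₂ : ∀ᶠ y in 𝓝 (p₀, (0 : V)), ∀ u v, β₂ y u v = - β₂ y v u)
    (hclosed₁ : ∀ᶠ y in 𝓝 (p₀, (0 : V)), ∀ u v w, fderiv ℝ β₁ y (0, u) v w =
      fderiv ℝ β₁ y (0, v) u w - fderiv ℝ β₁ y (0, w) u v)
    (hclosed₂ : ∀ᶠ y in 𝓝 (p₀, (0 : V)), ∀ u v w, fderiv ℝ β₂ y (0, u) v w =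
      fderiv ℝ β₂ y (0, v) u w - fderiv ℝ β₂ y (0, w) u v)
    (hJ : ∀ᶠ y in 𝓝 (p₀, (0 : V)), ∀ u v, β₂ y u v = - β₁ y u (J v))
    (h₁ : β₁ (p₀, 0) = b₁) (h₂ : β₂ (p₀, 0) = b₂)
    (S : V ≃L[ℝ] V →L[ℝ] ℝ) (hS : ∀ v, S v = b₁ v) :
    ∃ φ : P × V → V, (∀ᶠ y in 𝓝 (p₀, (0 : V)), ContDiffAt ℝ ∞ φ y) ∧ φ (p₀, 0) = 0 ∧
      (∀ w, fderiv ℝ φ (p₀, 0) w = w.2) ∧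
      ∀ᶠ y in 𝓝 (p₀, (0 : V)), ∀ u v,
        β₁ (y.1, φ y) (fderiv ℝ φ y (0, u)) (fderiv ℝ φ y (0, v)) = b₁ u v ∧
        β₂ (y.1, φ y) (fderiv ℝ φ y (0, u)) (fderiv ℝ φ y (0, v)) = b₂ u v := by
  have hb₁ : ∀ u v, b₁ u v = - b₁ v u := h₁ ▸ hskew₁.self_of_nhds
  have hb₂ : ∀ u v, b₂ u v = - b₂ v u := h₂ ▸ hskew₂.self_of_nhds
  have hbJ : ∀ u v, b₂ u v = - b₁ u (J v) := by
    subst h₁ h₂; exact hJ.self_of_nhds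
  obtain ⟨δ₁, hδ₁, e₁⟩ := exists_contDiff_eventuallyEq (f := fun y => β₁ y - b₁)
    (hβ₁.mono fun y hy => hy.sub contDiffAt_const)
  obtain ⟨δ₂, hδ₂, e₂⟩ := exists_contDiff_eventuallyEq (f := fun y => β₂ y - b₂)
    (hβ₂.mono fun y hy => hy.sub contDiffAt_const)
  have d₁ : ∀ᶠ y in 𝓝 (p₀, (0 : V)), fderiv ℝ δ₁ y = fderiv ℝ β₁ y := by
    filter_upwards [e₁.eventuallyEq_nhds, hβ₁] with y hy hy'
    have h := HasFDerivAt.sub_const b₁ (hy'.differentiableAt (by simp)).hasFDerivAt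
    exact (h.congr_of_eventuallyEq hy).fderiv
  have d₂ : ∀ᶠ y in 𝓝 (p₀, (0 : V)), fderiv ℝ δ₂ y = fderiv ℝ β₂ y := by
    filter_upwards [e₂.eventuallyEq_nhds, hβ₂] with y hy hy'
    have h := HasFDerivAt.sub_const b₂ (hy'.differentiableAt (by simp)).hasFDerivAt
    exact (h.congr_of_eventuallyEq hy).fderiv
  have s₁ : ∀ᶠ y in 𝓝 (p₀, (0 : V)), ∀ u v, δ₁ y u v = - δ₁ y v u := by
    filter_upwards [e₁, hskew₁] with y hy hy' u v
    simp only [hy, sub_apply]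
    linarith [hy' u v, hb₁ u v]
  have s₂ : ∀ᶠ y in 𝓝 (p₀, (0 : V)), ∀ u v, δ₂ y u v = - δ₂ y v u := by
    filter_upwards [e₂, hskew₂] with y hy hy' u v
    simp only [hy, sub_apply]
    linarith [hy' u v, hb₂ u v]
  have c₁ : ∀ᶠ y in 𝓝 (p₀, (0 : V)), ∀ u v w, fderiv ℝ δ₁ y (0, u) v w =
      fderiv ℝ δ₁ y (0, v) u w - fderiv ℝ δ₁ y (0, w) u v := by
    filter_upwards [d₁, hclosed₁] with y hy hy' using hy ▸ hy'
  have c₂ : ∀ᶠ y in 𝓝 (p₀, (0 : V)), ∀ u v w, fderiv ℝ δ₂ y (0, u) v w =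
      fderiv ℝ δ₂ y (0, v) u w - fderiv ℝ δ₂ y (0, w) u v := by
    filter_upwards [d₂, hclosed₂] with y hy hy' using hy ▸ hy'
  have hδJ : ∀ᶠ y in 𝓝 (p₀, (0 : V)), ∀ u v, δ₂ y u v = - δ₁ y u (J v) := by
    filter_upwards [e₁, e₂, hJ] with y hy hy' hy'' u v
    simp only [hy, hy', sub_apply]
    linarith [hy'' u v, hbJ u v]
  have hα₁ := contDiff_homotopyPrimitive₂ hδ₁
  have hα₂ := contDiff_homotopyPrimitive₂ hδ₂
  have p₁ := eventually_extDeriv_homotopyPrimitive₂ hδ₁ s₁ c₁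
  have p₂ := eventually_extDeriv_homotopyPrimitive₂ hδ₂ s₂ c₂
  have hαJ : ∀ᶠ y in 𝓝 (p₀, (0 : V)), ∀ v,
      homotopyPrimitive₂ δ₂ y v = - homotopyPrimitive₂ δ₁ y (J v) := by
    filter_upwards [eventually_segment hδJ] with y hy v
    have hc₁ := (contDiff_homotopyPrimitive₂_integrand hδ₁).continuous
    have hc₂ := (contDiff_homotopyPrimitive₂_integrand hδ₂).continuous
    have i₁ : Continuous fun r : ℝ => r • δ₁ (y.1, r • y.2) y.2 :=
      hc₁.comp (by fun_prop : Continuous fun r : ℝ => (r, y))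
    have i₂ : Continuous fun r : ℝ => r • δ₂ (y.1, r • y.2) y.2 :=
      hc₂.comp (by fun_prop : Continuous fun r : ℝ => (r, y))
    rw [homotopyPrimitive₂, homotopyPrimitive₂,
      ContinuousLinearMap.intervalIntegral_apply (i₁.intervalIntegrable _ _),
      ContinuousLinearMap.intervalIntegral_apply (i₂.intervalIntegrable _ _),
      ← intervalIntegral.integral_neg]
    refine intervalIntegral.integral_congr fun r hr => ?_
    rw [uIcc_of_le zero_le_one] at hr
    simp [hy r hr]
  have z₁ : δ₁ (p₀, 0) = 0 := e₁.self_of_nhds.trans (sub_eq_zero.2 h₁)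
  obtain ⟨X, hX, hX0, hX0', hXc⟩ := exists_moser_vectorField hδ₁ hα₁ z₁
    (homotopyPrimitive₂_zero _ _) (fderiv_homotopyPrimitive₂_eq_zero hδ₁ z₁) S
  have hXc₁ : ∀ᶠ y in 𝓝 (p₀, (0 : V)), ∀ s ∈ Icc (0 : ℝ) 1, ∀ v,
      b₁ (X (s, y)) v + s * δ₁ y (X (s, y)) v = - homotopyPrimitive₂ δ₁ y v := by
    simpa only [hS] using hXc
  -- The same field solves the second Moser equation: it is the first one evaluated at J v.
  have hXc₂ : ∀ᶠ y in 𝓝 (p₀, (0 : V)), ∀ s ∈ Icc (0 : ℝ) 1, ∀ v,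
      b₂ (X (s, y)) v + s * δ₂ y (X (s, y)) v = - homotopyPrimitive₂ δ₂ y v := by
    filter_upwards [hXc₁, hδJ, hαJ] with y hy hy' hy'' s hs v
    rw [hbJ, hy', hy'']
    linarith [hy s hs (J v)]
  have m₁ : ∀ᶠ y in 𝓝 (p₀, (0 : V)), IsMoserPoint b₁ δ₁ (homotopyPrimitive₂ δ₁) X y := by
    filter_upwards [s₁, c₁, p₁, hXc₁.eventually_nhds] with y a b c d using ⟨a, b, c, d⟩
  have m₂ : ∀ᶠ y in 𝓝 (p₀, (0 : V)), IsMoserPoint b₂ δ₂ (homotopyPrimitive₂ δ₂) X y := by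
    filter_upwards [s₂, c₂, p₂, hXc₂.eventually_nhds] with y a b c d using ⟨a, b, c, d⟩
  have : CompleteSpace P := FiniteDimensional.complete ℝ P
  have : CompleteSpace V := FiniteDimensional.complete ℝ V
  obtain ⟨φ, hφ, hφ0, hφ', hflow⟩ := exists_timeOne_map hX hX0 hX0'
  refine ⟨φ, hφ, hφ0, hφ', ?_⟩
  filter_upwards [hflow _ ((m₁.and m₂).and (e₁.and e₂))] with y hy u v
  obtain ⟨c, -, hc1, hc, hlin⟩ := hy
  obtain ⟨Y, hY0, hY1, hY⟩ := hlin u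
  obtain ⟨Z, hZ0, hZ1, hZ⟩ := hlin v
  -- At time one b + δ equals β, so invariance along the flow says that the time-one map pulls β
  -- back to b.
  have i₁ := IsMoserPoint.invariance hb₁ hδ₁ hα₁ hX (fun s hs => (hc s hs).1.1.1)
    (fun s hs => (hc s hs).2) hY hZ
  have i₂ := IsMoserPoint.invariance hb₂ hδ₂ hα₂ hX (fun s hs => (hc s hs).1.1.2)
    (fun s hs => (hc s hs).2) hY hZ
  obtain ⟨f₁, f₂⟩ := (hc 1 (right_mem_Icc.2 zero_le_one)).1.2
  rw [f₁, hY0, hY1, hZ0, hZ1, hc1] at i₁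
  rw [f₂, hY0, hY1, hZ0, hZ1, hc1] at i₂
  simp only [sub_apply] at i₁ i₂
  exact ⟨by linarith, by linarith⟩

end Moser

/-! ### Currying of 3-forms -/

section Curry

set_option maxSynthPendingDepth 3

variable (E : Type*) [NormedAddCommGroup E] [NormedSpace ℝ E]

/-- Full currying of alternating 3-forms. -/
def curry₃ : (E [⋀^Fin 3]→L[ℝ] ℝ) →L[ℝ] E →L[ℝ] E →L[ℝ] E →L[ℝ] ℝ :=
  (((((ContinuousAlternatingMap.ofSubsingletonLIE (𝕜 := ℝ) (E := E) (F := ℝ) (0 : Fin 1)).symm :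
      (E [⋀^Fin 1]→L[ℝ] ℝ) →L[ℝ] E →L[ℝ] ℝ).postcomp E) ∘L
    (ContinuousAlternatingMap.curryLeftLI (𝕜 := ℝ) (E := E) (F := ℝ)
      (n := 1)).toContinuousLinearMap).postcomp E) ∘L
    (ContinuousAlternatingMap.curryLeftLI (𝕜 := ℝ) (E := E) (F := ℝ)
      (n := 2)).toContinuousLinearMap

variable {E}

theorem curry₃_apply (A : E [⋀^Fin 3]→L[ℝ] ℝ) (a b c : E) :
    curry₃ E A a b c = A ![a, b, c] := by
  change A (Matrix.vecCons a (Matrix.vecCons b fun _ => c)) = _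
  congr 1
  ext i
  fin_cases i <;> rfl

theorem curry₃_swap_left (A : E [⋀^Fin 3]→L[ℝ] ℝ) (a b c : E) :
    curry₃ E A a b c = - curry₃ E A b a c := by
  have h := A.toAlternatingMap.map_swap ![a, b, c] (i := 0) (j := 1) (by simp)
  have e : ![a, b, c] ∘ Equiv.swap 0 1 = ![b, a, c] := by
    ext i
    fin_cases i <;> rfl
  rw [e] at h
  rw [curry₃_apply, curry₃_apply]
  exact (neg_eq_iff_eq_neg.2 h).symm

theorem curry₃_swap_right (A : E [⋀^Fin 3]→L[ℝ] ℝ) (a b c : E) :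
    curry₃ E A a b c = - curry₃ E A a c b := by
  have h := A.toAlternatingMap.map_swap ![a, b, c] (i := 1) (j := 2) (by simp)
  have e : ![a, b, c] ∘ Equiv.swap 1 2 = ![a, c, b] := by
    ext i
    fin_cases i <;> rfl
  rw [e] at h
  rw [curry₃_apply, curry₃_apply]
  exact (neg_eq_iff_eq_neg.2 h).symm

theorem curry₃_injective : Function.Injective (curry₃ E) := by
  intro A B h
  ext v
  have h' := congrArg (fun T : E →L[ℝ] E →L[ℝ] E →L[ℝ] ℝ => T (v 0) (v 1) (v 2)) h
  simp only [curry₃_apply] at h'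
  convert h' using 2 <;> (ext i; fin_cases i <;> rfl)

theorem extDeriv_eq_zero_curry₃ {Θ : E → E [⋀^Fin 3]→L[ℝ] ℝ} {y : E}
    (hd : DifferentiableAt ℝ Θ y) (h : extDeriv Θ y = 0) (a b c d : E) :
    fderiv ℝ (fun y => curry₃ E (Θ y)) y a b c d - fderiv ℝ (fun y => curry₃ E (Θ y)) y b a c d +
      fderiv ℝ (fun y => curry₃ E (Θ y)) y c a b d -
      fderiv ℝ (fun y => curry₃ E (Θ y)) y d a b c = 0 := by
  have h₁ : fderiv ℝ (fun y => curry₃ E (Θ y)) y = curry₃ E ∘L fderiv ℝ Θ y :=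
    ((curry₃ E).hasFDerivAt.comp y hd.hasFDerivAt).fderiv
  have h₂ : ∑ i : Fin 4, (-1 : ℤ) ^ (i : ℕ) •
      fderiv ℝ Θ y (![a, b, c, d] i) (i.removeNth ![a, b, c, d]) = 0 :=
    (ContinuousAlternatingMap.alternatizeUncurryFin_apply _ _).symm.trans
      (congrArg (fun A => A ![a, b, c, d]) h)
  rw [Fin.sum_univ_four] at h₂
  simp only [h₁, ContinuousLinearMap.comp_apply, curry₃_apply]
  convert h₂ using 1
  have e₀ : Fin.removeNth 0 ![a, b, c, d] = ![b, c, d] := by ext i; fin_cases i <;> rfl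
  have e₁ : Fin.removeNth 1 ![a, b, c, d] = ![a, c, d] := by ext i; fin_cases i <;> rfl
  have e₂ : Fin.removeNth 2 ![a, b, c, d] = ![a, b, d] := by ext i; fin_cases i <;> rfl
  have e₃ : Fin.removeNth 3 ![a, b, c, d] = ![a, b, c] := by ext i; fin_cases i <;> rfl
  rw [e₀, e₁, e₂, e₃]
  simp
  ring

theorem contDiffAt_clm_of_apply {D E F : Type*} [NormedAddCommGroup D] [NormedSpace ℝ D]
    [NormedAddCommGroup E] [NormedSpace ℝ E] [NormedAddCommGroup F] [NormedSpace ℝ F]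
    [FiniteDimensional ℝ E] {n : ℕ∞ω} {f : D → E →L[ℝ] F} {x : D}
    (h : ∀ v, ContDiffAt ℝ n (fun x => f x v) x) : ContDiffAt ℝ n f x := by
  let d := Module.finrank ℝ E
  have hd : d = Module.finrank ℝ (Fin d → ℝ) := (Module.finrank_fin_fun ℝ).symm
  let e₁ := ContinuousLinearEquiv.ofFinrankEq hd
  let e₂ := (e₁.arrowCongr (1 : F ≃L[ℝ] F)).trans (ContinuousLinearEquiv.piRing (Fin d))
  rw [← Function.id_comp f, ← e₂.symm_comp_self]
  exact e₂.symm.contDiff.contDiffAt.comp x (contDiffAt_pi.mpr fun i => h _)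

/-- Currying is an injective linear map between finite-dimensional spaces and so has a linear left
inverse. Smoothness can therefore be tested on values of the form. -/
theorem contDiffAt_of_curry₃ {D : Type*} [NormedAddCommGroup D] [NormedSpace ℝ D]
    [FiniteDimensional ℝ E] {n : ℕ∞ω} {Θ : D → E [⋀^Fin 3]→L[ℝ] ℝ} {x : D}
    (h : ∀ a b c, ContDiffAt ℝ n (fun x => Θ x ![a, b, c]) x) : ContDiffAt ℝ n Θ x := by
  have : FiniteDimensional ℝ (E [⋀^Fin 3]→L[ℝ] ℝ) :=
    FiniteDimensional.of_injective (curry₃ E).toLinearMap curry₃_injective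
  obtain ⟨g, hg⟩ := LinearMap.exists_leftInverse_of_injective (curry₃ E).toLinearMap
    (LinearMap.ker_eq_bot.2 curry₃_injective)
  have h₁ : ContDiffAt ℝ n (fun x => curry₃ E (Θ x)) x :=
    contDiffAt_clm_of_apply fun a => contDiffAt_clm_of_apply fun b =>
      contDiffAt_clm_of_apply fun c => by simpa only [curry₃_apply] using h a b c
  have h₂ : Θ = fun x => LinearMap.toContinuousLinearMap g (curry₃ E (Θ x)) :=
    funext fun x => (congrArg (fun L => L (Θ x)) hg).symm
  rw [h₂]
  exact (LinearMap.toContinuousLinearMap g).contDiff.contDiffAt.comp x h₁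

end Curry

/-! ### Pullback of 3-forms between normed spaces -/

section Pullback

set_option maxSynthPendingDepth 3

variable {E E' : Type*} [NormedAddCommGroup E] [NormedSpace ℝ E] [FiniteDimensional ℝ E]
  [NormedAddCommGroup E'] [NormedSpace ℝ E']

/-- Pullback of a 3-form along a map between normed spaces. -/
def pullbackForm (g : E → E') (Θ : E' → E' [⋀^Fin 3]→L[ℝ] ℝ) (y : E) : E [⋀^Fin 3]→L[ℝ] ℝ :=
  (Θ (g y)).compContinuousLinearMap (fderiv ℝ g y)

omit [FiniteDimensional ℝ E] in
theorem pullbackForm_apply (g : E → E') (Θ : E' → E' [⋀^Fin 3]→L[ℝ] ℝ) (y a b c : E) :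
    pullbackForm g Θ y ![a, b, c] =
      Θ (g y) ![fderiv ℝ g y a, fderiv ℝ g y b, fderiv ℝ g y c] := by
  change Θ (g y) _ = _
  congr 1
  ext i
  fin_cases i <;> rfl

theorem contDiffAt_pullbackForm {g : E → E'} {Θ : E' → E' [⋀^Fin 3]→L[ℝ] ℝ} {y : E}
    (hg : ContDiffAt ℝ ∞ g y) (hΘ : ContDiffAt ℝ ∞ Θ (g y)) :
    ContDiffAt ℝ ∞ (pullbackForm g Θ) y := by
  refine contDiffAt_of_curry₃ fun a b c => ?_
  have h₀ : (fun y => pullbackForm g Θ y ![a, b, c]) = fun y =>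
      curry₃ E' (Θ (g y)) (fderiv ℝ g y a) (fderiv ℝ g y b) (fderiv ℝ g y c) :=
    funext fun y => (pullbackForm_apply g Θ y a b c).trans (curry₃_apply _ _ _ _).symm
  rw [h₀]
  have h₁ : ContDiffAt ℝ ∞ (fun y => curry₃ E' (Θ (g y))) y :=
    ContDiffAt.comp (g := fun A => curry₃ E' A) y
      (ContinuousLinearMap.contDiff (curry₃ E')).contDiffAt (hΘ.comp y hg)
  have h₂ : ContDiffAt ℝ ∞ (fderiv ℝ g) y := hg.fderiv_right (by simp)
  exact ((h₁.clm_apply (h₂.clm_apply contDiffAt_const)).clm_apply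
    (h₂.clm_apply contDiffAt_const)).clm_apply (h₂.clm_apply contDiffAt_const)

omit [FiniteDimensional ℝ E] in
theorem extDeriv_pullbackForm_eq_zero {g : E → E'} {Θ : E' → E' [⋀^Fin 3]→L[ℝ] ℝ} {y : E}
    (hg : ContDiffAt ℝ ∞ g y) (hΘ : ContDiffAt ℝ ∞ Θ (g y)) (h : extDeriv Θ (g y) = 0) :
    extDeriv (pullbackForm g Θ) y = 0 := by
  have := extDeriv_pullback (𝕜 := ℝ) (r := ∞) (hΘ.differentiableAt (by simp)) hg
    (by simpa using (WithTop.coe_le_coe.2 le_top : ((2 : ℕ∞) : ℕ∞ω) ≤ ∞))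
  refine this.trans ?_
  rw [h]; ext; simp

end Pullback

/-! ### The standard forms -/

section Standard

/-- The complex symplectic form `ω₁ + i ω₂ = ∑ dzᵏ ∧ dqᵏ`. -/
def omegaC (n : ℕ) (u v : C2n n) : ℂ := ∑ k, (u.2 k * v.1 k - v.2 k * u.1 k)

theorem omega₁_eq_re (n : ℕ) (u v : C2n n) : omega₁ n u v = (omegaC n u v).re := by
  simp only [omega₁, omegaC, Complex.re_sum]
  refine Finset.sum_congr rfl fun k _ => ?_
  simp [wedge11, dq₁, dq₂, dp₁, dp₂]
  ring

theorem omega₂_eq_im (n : ℕ) (u v : C2n n) : omega₂ n u v = (omegaC n u v).im := by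
  simp only [omega₂, omegaC, Complex.im_sum]
  refine Finset.sum_congr rfl fun k _ => ?_
  simp [wedge11, dq₁, dq₂, dp₁, dp₂]
  ring

theorem omegaC_smul_right (n : ℕ) (u v : C2n n) (a : ℂ) :
    omegaC n u (a • v) = a * omegaC n u v := by
  simp only [omegaC, Finset.mul_sum]
  refine Finset.sum_congr rfl fun k _ => ?_
  simp
  ring

theorem omega₂_I_smul (n : ℕ) (u v : C2n n) : omega₂ n u (Complex.I • v) = omega₁ n u v := by
  rw [omega₂_eq_im, omega₁_eq_re, omegaC_smul_right]; simp

theorem eq_zero_of_omega₂ {n : ℕ} {u : C2n n} (h : ∀ v, omega₂ n u v = 0) : u = 0 := by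
  -- Pairing (q, z) with (i z̄, -i q̄) gives i(|q|² + |z|²), so ω₂ of this pair is the squared
  -- length of u.
  have h₁ := h (fun k => Complex.I * star (u.2 k), fun k => - (Complex.I * star (u.1 k)))
  have h₂ : omegaC n u (fun k => Complex.I * star (u.2 k), fun k => - (Complex.I * star (u.1 k))) =
      ((∑ k, (Complex.normSq (u.1 k) + Complex.normSq (u.2 k)) : ℝ) : ℂ) * Complex.I := by
    simp only [omegaC, Complex.ofReal_sum, Finset.sum_mul]
    refine Finset.sum_congr rfl fun k _ => ?_
    rw [Complex.ofReal_add, ← Complex.mul_conj, ← Complex.mul_conj]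
    simp only [RCLike.star_def]
    ring
  rw [omega₂_eq_im, h₂, Complex.im_ofReal_mul, Complex.I_im, mul_one,
    Finset.sum_eq_zero_iff_of_nonneg
      (fun k _ => add_nonneg (Complex.normSq_nonneg _) (Complex.normSq_nonneg _))] at h₁
  have h₃ : ∀ k, u.1 k = 0 ∧ u.2 k = 0 := fun k => by
    have := h₁ k (Finset.mem_univ k)
    rw [add_eq_zero_iff_of_nonneg (Complex.normSq_nonneg _) (Complex.normSq_nonneg _),
      Complex.normSq_eq_zero, Complex.normSq_eq_zero] at this
    exact this
  ext k
  · exact (h₃ k).1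
  · exact (h₃ k).2

theorem exists_equiv_of_nondegenerate {V : Type*} [NormedAddCommGroup V] [NormedSpace ℝ V]
    [FiniteDimensional ℝ V] (b : V →L[ℝ] V →L[ℝ] ℝ) (h : ∀ u, (∀ v, b u v = 0) → u = 0) :
    ∃ S : V ≃L[ℝ] V →L[ℝ] ℝ, ∀ v, S v = b v := by
  have hinj : Function.Injective b.toLinearMap := by
    rw [← LinearMap.ker_eq_bot, LinearMap.ker_eq_bot']
    exact fun u hu => h u fun v => congrArg (· v) hu
  have hdim : Module.finrank ℝ V = Module.finrank ℝ (V →L[ℝ] ℝ) := by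
    rw [← (LinearMap.toContinuousLinearMap (𝕜 := ℝ) (E := V) (F' := ℝ)).finrank_eq]
    exact (Subspace.dual_finrank_eq (K := ℝ) (V := V)).symm
  exact ⟨(LinearMap.linearEquivOfInjective b.toLinearMap hinj hdim).toContinuousLinearEquiv,
    fun v => rfl⟩

end Standard

/-! ### Components of a 3-form on `ℂ × V` -/

section Components

set_option maxSynthPendingDepth 3

variable {V : Type} [NormedAddCommGroup V] [NormedSpace ℝ V]

/-- Restriction of bilinear forms on `ℂ × V` to `V`. -/
def verticalRestrict (V : Type) [NormedAddCommGroup V] [NormedSpace ℝ V] :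
    ((ℂ × V) →L[ℝ] (ℂ × V) →L[ℝ] ℝ) →L[ℝ] V →L[ℝ] V →L[ℝ] ℝ :=
  (((ContinuousLinearMap.inr ℝ ℂ V).precomp ℝ).postcomp V) ∘L
    ((ContinuousLinearMap.inr ℝ ℂ V).precomp ((ℂ × V) →L[ℝ] ℝ))

/-- The vertical 2-form obtained by contracting a trilinear form with the horizontal
vector `(τ, 0)`. -/
def horizontalContraction (V : Type) [NormedAddCommGroup V] [NormedSpace ℝ V] (τ : ℂ) :
    ((ℂ × V) →L[ℝ] (ℂ × V) →L[ℝ] (ℂ × V) →L[ℝ] ℝ) →L[ℝ] V →L[ℝ] V →L[ℝ] ℝ :=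
  verticalRestrict V ∘L ContinuousLinearMap.apply ℝ _ (τ, (0 : V))

/-- The vertical 1-form obtained by contracting a trilinear form with `∂ₜ₁` and `∂ₜ₂`. -/
def baseContraction (V : Type) [NormedAddCommGroup V] [NormedSpace ℝ V] :
    ((ℂ × V) →L[ℝ] (ℂ × V) →L[ℝ] (ℂ × V) →L[ℝ] ℝ) →L[ℝ] V →L[ℝ] ℝ :=
  ((ContinuousLinearMap.inr ℝ ℂ V).precomp ℝ) ∘L
    (ContinuousLinearMap.apply ℝ _ ((Complex.I, 0) : ℂ × V)) ∘L
    (ContinuousLinearMap.apply ℝ _ ((1, 0) : ℂ × V))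

theorem prod_decomp (a : ℂ × V) :
    a = a.1.re • ((1, 0) : ℂ × V) + a.1.im • ((Complex.I, 0) : ℂ × V) + (0, a.2) := by
  ext <;> simp

/-- A vector is a combination of ∂t₁, ∂t₂ and a vertical vector, so trilinearity and antisymmetry
reduce the form to four types of components. The identities `r₁` to `r₉` list the orderings. -/
theorem curry₃_eq_of_components {n : ℕ} {A : (ℂ × C2n n) [⋀^Fin 3]→L[ℝ] ℝ}
    {h : C2n n → ℝ}
    (h₀ : ∀ u v w : C2n n, curry₃ _ A (0, u) (0, v) (0, w) = 0)
    (h₁ : ∀ u v : C2n n, curry₃ _ A (1, 0) (0, u) (0, v) = - omega₂ n u v)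
    (h₂ : ∀ u v : C2n n, curry₃ _ A (Complex.I, 0) (0, u) (0, v) = omega₁ n u v)
    (h₃ : ∀ u : C2n n, curry₃ _ A (1, 0) (Complex.I, 0) (0, u) = - h u)
    (a b c : ℂ × C2n n) :
    curry₃ _ A a b c =
      omegaStd n a b c - wedge21 (wedge11 (fun a => h a.2) dt₁) dt₂ a b c := by
  have sl := curry₃_swap_left A
  have sr := curry₃_swap_right A
  have aa : ∀ x y, curry₃ _ A x x y = 0 := fun x y => by linarith [sl x x y]
  have bb : ∀ x y, curry₃ _ A x y y = 0 := fun x y => by linarith [sr x y y]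
  have cc : ∀ x y, curry₃ _ A x y x = 0 := fun x y => by linarith [sr x y x, aa x y]
  have r₁ : ∀ u v : C2n n, curry₃ _ A (0, u) (1, 0) (0, v) = omega₂ n u v := fun u v => by
    linarith [sl (0, u) (1, 0) (0, v), h₁ u v]
  have r₂ : ∀ u v : C2n n, curry₃ _ A (0, u) (0, v) (1, 0) = - omega₂ n u v := fun u v => by
    linarith [sr (0, u) (0, v) (1, 0), r₁ u v]
  have r₃ : ∀ u v : C2n n, curry₃ _ A (0, u) (Complex.I, 0) (0, v) = - omega₁ n u v :=
    fun u v => by linarith [sl (0, u) (Complex.I, 0) (0, v), h₂ u v]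
  have r₄ : ∀ u v : C2n n, curry₃ _ A (0, u) (0, v) (Complex.I, 0) = omega₁ n u v :=
    fun u v => by linarith [sr (0, u) (0, v) (Complex.I, 0), r₃ u v]
  have r₅ : ∀ u : C2n n, curry₃ _ A (1, 0) (0, u) (Complex.I, 0) = h u := fun u => by
    linarith [sr (1, 0) (0, u) (Complex.I, 0), h₃ u]
  have r₆ : ∀ u : C2n n, curry₃ _ A (0, u) (1, 0) (Complex.I, 0) = - h u := fun u => by
    linarith [sl (0, u) (1, 0) (Complex.I, 0), r₅ u]
  have r₇ : ∀ u : C2n n, curry₃ _ A (0, u) (Complex.I, 0) (1, 0) = h u := fun u => by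
    linarith [sr (0, u) (Complex.I, 0) (1, 0), r₆ u]
  have r₈ : ∀ u : C2n n, curry₃ _ A (Complex.I, 0) (0, u) (1, 0) = - h u := fun u => by
    linarith [sl (Complex.I, 0) (0, u) (1, 0), r₇ u]
  have r₉ : ∀ u : C2n n, curry₃ _ A (Complex.I, 0) (1, 0) (0, u) = h u := fun u => by
    linarith [sr (Complex.I, 0) (1, 0) (0, u), r₈ u]
  have skew₁ : ∀ u v, omega₁ n u v = - omega₁ n v u := fun u v => by
    linarith [h₂ u v, h₂ v u, sr (Complex.I, 0) (0, u) (0, v)]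
  have skew₂ : ∀ u v, omega₂ n u v = - omega₂ n v u := fun u v => by
    linarith [h₁ u v, h₁ v u, sr (1, 0) (0, u) (0, v)]
  have e : curry₃ _ A a b c = curry₃ _ A
      (a.1.re • ((1, 0) : ℂ × C2n n) + a.1.im • ((Complex.I, 0) : ℂ × C2n n) + (0, a.2))
      (b.1.re • ((1, 0) : ℂ × C2n n) + b.1.im • ((Complex.I, 0) : ℂ × C2n n) + (0, b.2))
      (c.1.re • ((1, 0) : ℂ × C2n n) + c.1.im • ((Complex.I, 0) : ℂ × C2n n) + (0, c.2)) := by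
    rw [← prod_decomp, ← prod_decomp, ← prod_decomp]
  rw [e]
  simp only [map_add, map_smul, add_apply, smul_apply, aa, bb, cc, h₀, h₁, h₂, h₃, r₁, r₂, r₃, r₄,
    r₅, r₆, r₇, r₈, r₉, smul_eq_mul]
  simp only [omegaStd, wedge21, wedge11, dt₁, dt₂]
  rw [skew₁ c.2 a.2, skew₂ c.2 a.2]
  ring

end Components

/-! ### The local normal form on `ℂ × ℂ²ⁿ` -/

section LocalNormalForm

set_option maxSynthPendingDepth 3

theorem dHt_eq {n : ℕ} {H : ℂ × C2n n → ℝ} (hH : ContDiff ℝ ∞ H) (y a : ℂ × C2n n) :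
    dHt H y a = fderiv ℝ H y (0, a.2) := by
  have h := HasFDerivAt.comp (f := fun u : C2n n => (y.1, u)) y.2
    (hH.differentiable (by simp) (y.1, y.2)).hasFDerivAt (hasFDerivAt_prodMk_right y.1 y.2)
  exact congrArg (fun L => L a.2) h.fderiv

/-- A closed 3-form with standard vertical components is `Ω_std - dH ∧ dt₁ ∧ dt₂`. -/
theorem exists_hamiltonian {n : ℕ} {Ψ : ℂ × C2n n → (ℂ × C2n n) [⋀^Fin 3]→L[ℝ] ℝ} {t₀ : ℂ}
    (hΨ : ∀ᶠ y in 𝓝 (t₀, (0 : C2n n)), ContDiffAt ℝ ∞ Ψ y)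
    (hd : ∀ᶠ y in 𝓝 (t₀, (0 : C2n n)), extDeriv Ψ y = 0)
    (h₀ : ∀ᶠ y in 𝓝 (t₀, (0 : C2n n)), ∀ u v w, curry₃ _ (Ψ y) (0, u) (0, v) (0, w) = 0)
    (h₁ : ∀ᶠ y in 𝓝 (t₀, (0 : C2n n)), ∀ u v,
      curry₃ _ (Ψ y) (1, 0) (0, u) (0, v) = - omega₂ n u v)
    (h₂ : ∀ᶠ y in 𝓝 (t₀, (0 : C2n n)), ∀ u v,
      curry₃ _ (Ψ y) (Complex.I, 0) (0, u) (0, v) = omega₁ n u v) :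
    ∃ H : ℂ × C2n n → ℝ, ContDiff ℝ ∞ H ∧ ∀ᶠ y in 𝓝 (t₀, (0 : C2n n)), ∀ a b c,
      Ψ y ![a, b, c] = omegaStd n a b c - wedge21 (wedge11 (dHt H y) dt₁) dt₂ a b c := by
  let T : ℂ × C2n n → _ := fun y => curry₃ (ℂ × C2n n) (Ψ y)
  have hT : ∀ᶠ y in 𝓝 (t₀, (0 : C2n n)), ContDiffAt ℝ ∞ T y := hΨ.mono fun y hy =>
    ContDiffAt.comp (g := fun A => curry₃ (ℂ × C2n n) A) y
      (ContinuousLinearMap.contDiff (curry₃ (ℂ × C2n n))).contDiffAt hy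
  have hα₀ : ∀ᶠ y in 𝓝 (t₀, (0 : C2n n)),
      ContDiffAt ℝ ∞ (fun y => - baseContraction (C2n n) (T y)) y := hT.mono fun y hy =>
    (ContDiffAt.comp (g := fun A => baseContraction (C2n n) A) y
      (ContinuousLinearMap.contDiff (baseContraction (C2n n))).contDiffAt hy).neg
  obtain ⟨α, hα, hαe⟩ := exists_contDiff_eventuallyEq hα₀
  -- In dΨ(∂t₁, ∂t₂, u, v) = 0 the terms differentiating Ψ(∂tᵢ, u, v) drop out, those components
  -- being constant near y. What is left says that α = -Ψ(∂t₁, ∂t₂, ·) is closed along the fibers.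
  have hsymm : ∀ᶠ y in 𝓝 (t₀, (0 : C2n n)), ∀ u v,
      fderiv ℝ α y (0, u) v = fderiv ℝ α y (0, v) u := by
    filter_upwards [hΨ, hT, hd, hαe.eventuallyEq_nhds, h₁.eventually_nhds, h₂.eventually_nhds]
      with y k₁ k₂ k₃ k₄ k₅ k₆ u v
    have hTd := (k₂.differentiableAt (by simp)).hasFDerivAt
    have e₁ : fderiv ℝ α y = - (baseContraction (C2n n) ∘L fderiv ℝ T y) := by
      rw [k₄.fderiv_eq]
      exact (((baseContraction (C2n n)).hasFDerivAt.comp y hTd).neg).fderiv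
    have e₂ : ∀ (τ : ℂ) (θ : C2n n → C2n n → ℝ), (∀ᶠ z in 𝓝 y, ∀ u v,
        T z (τ, 0) (0, u) (0, v) = θ u v) → ∀ w,
        fderiv ℝ T y w (τ, 0) (0, u) (0, v) = 0 := by
      intro τ θ hθ w
      have h : HasFDerivAt (fun z => T z (τ, 0) (0, u) (0, v)) _ y :=
        ((hTd.clm_apply (hasFDerivAt_const (τ, (0 : C2n n)) y)).clm_apply
          (hasFDerivAt_const ((0 : ℂ), u) y)).clm_apply (hasFDerivAt_const ((0 : ℂ), v) y)
      have h' : HasFDerivAt (fun z => T z (τ, 0) (0, u) (0, v)) (0 : _ →L[ℝ] ℝ) y :=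
        (hasFDerivAt_const (θ u v) y).congr_of_eventuallyEq (hθ.mono fun z hz => hz u v)
      simpa using congrArg (fun L => L w) (h.unique h')
    have e₃ := e₂ 1 _ k₅ (Complex.I, 0)
    have e₄ := e₂ Complex.I _ k₆ (1, 0)
    have e₅ := extDeriv_eq_zero_curry₃ (k₁.differentiableAt (by simp)) k₃
      (1, 0) (Complex.I, 0) (0, u) (0, v)
    change fderiv ℝ T y _ _ _ _ - fderiv ℝ T y _ _ _ _ + fderiv ℝ T y _ _ _ _ -
      fderiv ℝ T y _ _ _ _ = 0 at e₅
    rw [e₁]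
    change - (fderiv ℝ T y (0, u) (1, 0) (Complex.I, 0) (0, v)) =
      - (fderiv ℝ T y (0, v) (1, 0) (Complex.I, 0) (0, u))
    linarith
  refine ⟨homotopyPrimitive₁ α, contDiff_homotopyPrimitive₁ hα, ?_⟩
  filter_upwards [eventually_fderiv_homotopyPrimitive₁ hα hsymm, hαe, h₀, h₁, h₂]
    with y k k' k₀ k₁ k₂ a b c
  rw [← curry₃_apply, curry₃_eq_of_components (h := fun u => α y u) k₀ k₁ k₂ (fun u => by
    rw [k']; change _ = - - _; rw [neg_neg]; rfl)]
  have : dHt (homotopyPrimitive₁ α) y = fun a => α y a.2 := funext fun a => by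
    rw [dHt_eq (contDiff_homotopyPrimitive₁ hα), k]
  rw [this]

/-- In dΘ(τ, u, v, w) = 0 the term differentiating Θ(u, v, w) vanishes by 1-horizontality. The other
three are the fiberwise exterior derivative of the contraction with τ. -/
theorem eventually_closed_horizontalContraction {V : Type} [NormedAddCommGroup V]
    [NormedSpace ℝ V] {Θ : ℂ × V → (ℂ × V) [⋀^Fin 3]→L[ℝ] ℝ} {y₀ : ℂ × V} (τ : ℂ)
    (hΘ : ∀ᶠ y in 𝓝 y₀, ContDiffAt ℝ ∞ Θ y) (hd : ∀ᶠ y in 𝓝 y₀, extDeriv Θ y = 0)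
    (h₀ : ∀ᶠ y in 𝓝 y₀, ∀ u v w, curry₃ _ (Θ y) (0, u) (0, v) (0, w) = 0) :
    ∀ᶠ y in 𝓝 y₀, ∀ u v w,
      fderiv ℝ (fun y => horizontalContraction V τ (curry₃ _ (Θ y))) y (0, u) v w =
      fderiv ℝ (fun y => horizontalContraction V τ (curry₃ _ (Θ y))) y (0, v) u w -
      fderiv ℝ (fun y => horizontalContraction V τ (curry₃ _ (Θ y))) y (0, w) u v := by
  filter_upwards [hΘ, hd, h₀.eventually_nhds] with y k₁ k₂ k₃ u v w
  let T : ℂ × V → _ := fun y => curry₃ (ℂ × V) (Θ y)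
  have hTd : HasFDerivAt T (fderiv ℝ T y) y :=
    ((curry₃ (ℂ × V)).hasFDerivAt.comp y
      (k₁.differentiableAt (by simp)).hasFDerivAt).differentiableAt.hasFDerivAt
  have e₁ : fderiv ℝ (fun y => horizontalContraction V τ (curry₃ _ (Θ y))) y =
      horizontalContraction V τ ∘L fderiv ℝ T y :=
    ((horizontalContraction V τ).hasFDerivAt.comp y hTd).fderiv
  have e₂ : fderiv ℝ T y (τ, 0) (0, u) (0, v) (0, w) = 0 := by
    have h : HasFDerivAt (fun z => T z (0, u) (0, v) (0, w)) _ y :=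
      ((hTd.clm_apply (hasFDerivAt_const ((0 : ℂ), u) y)).clm_apply
        (hasFDerivAt_const ((0 : ℂ), v) y)).clm_apply (hasFDerivAt_const ((0 : ℂ), w) y)
    have h' : HasFDerivAt (fun z => T z (0, u) (0, v) (0, w)) (0 : _ →L[ℝ] ℝ) y :=
      (hasFDerivAt_const (0 : ℝ) y).congr_of_eventuallyEq (k₃.mono fun z hz => hz u v w)
    simpa using congrArg (fun L => L (τ, 0)) (h.unique h')
  have e₃ := extDeriv_eq_zero_curry₃ (k₁.differentiableAt (by simp)) k₂
    (τ, 0) (0, u) (0, v) (0, w)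
  change fderiv ℝ T y _ _ _ _ - fderiv ℝ T y _ _ _ _ + fderiv ℝ T y _ _ _ _ -
    fderiv ℝ T y _ _ _ _ = 0 at e₃
  rw [e₁]
  change fderiv ℝ T y (0, u) (τ, 0) (0, v) (0, w) = fderiv ℝ T y (0, v) (τ, 0) (0, u) (0, w) -
    fderiv ℝ T y (0, w) (τ, 0) (0, u) (0, v)
  linarith

/-- The map (t, x) ↦ (t, φ(t, x)) given by the relative Darboux theorem makes the vertical
components constant, after which only the Hamiltonian term remains. -/
theorem exists_local_normalForm {n : ℕ} {Θ : ℂ × C2n n → (ℂ × C2n n) [⋀^Fin 3]→L[ℝ] ℝ} {t₀ : ℂ}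
    (hΘ : ∀ᶠ y in 𝓝 (t₀, (0 : C2n n)), ContDiffAt ℝ ∞ Θ y)
    (hd : ∀ᶠ y in 𝓝 (t₀, (0 : C2n n)), extDeriv Θ y = 0)
    (h₀ : ∀ᶠ y in 𝓝 (t₀, (0 : C2n n)), ∀ u v w, Θ y ![(0, u), (0, v), (0, w)] = 0)
    (hI : ∀ᶠ y in 𝓝 (t₀, (0 : C2n n)), ∀ u v, Θ y ![(Complex.I, 0), (0, u), (0, v)] =
      - Θ y ![(1, 0), (0, u), (0, Complex.I • v)])
    (hstd : ∀ u v, Θ (t₀, 0) ![(1, 0), (0, u), (0, v)] = - omega₂ n u v)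
    {O : Set (ℂ × C2n n)} (hO : O ∈ 𝓝 (t₀, (0 : C2n n))) :
    ∃ (F : OpenPartialHomeomorph (ℂ × C2n n) (ℂ × C2n n)) (r : ℝ) (H : ℂ × C2n n → ℝ), 0 < r ∧
      F.source = Metric.ball t₀ r ×ˢ Metric.ball 0 r ∧ F.target ⊆ O ∧ F (t₀, 0) = (t₀, 0) ∧
      (∀ y, (F y).1 = y.1) ∧ (∀ y ∈ F.source, ContDiffAt ℝ ∞ F y) ∧
      (∀ y ∈ F.target, ContDiffAt ℝ ∞ F.symm y) ∧ ContDiff ℝ ∞ H ∧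
      ∀ y ∈ F.source, ∀ a b c, Θ (F y) ![fderiv ℝ F y a, fderiv ℝ F y b, fderiv ℝ F y c] =
        omegaStd n a b c - wedge21 (wedge11 (dHt H y) dt₁) dt₂ a b c := by
  let β : ℂ → ℂ × C2n n → C2n n →L[ℝ] C2n n →L[ℝ] ℝ := fun τ y =>
    horizontalContraction (C2n n) τ (curry₃ _ (Θ y))
  have hβ_apply : ∀ τ y u v, β τ y u v = Θ y ![(τ, 0), (0, u), (0, v)] := fun τ y u v =>
    curry₃_apply _ _ _ _
  have hβ : ∀ τ, ∀ᶠ y in 𝓝 (t₀, (0 : C2n n)), ContDiffAt ℝ ∞ (β τ) y := fun τ =>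
    hΘ.mono fun y hy => ContDiffAt.comp
      (g := fun A => (horizontalContraction (C2n n) τ ∘L curry₃ (ℂ × C2n n)) A) y
      (ContinuousLinearMap.contDiff _).contDiffAt hy
  have hskew : ∀ τ, ∀ᶠ y in 𝓝 (t₀, (0 : C2n n)), ∀ u v, β τ y u v = - β τ y v u := fun τ =>
    Eventually.of_forall fun y u v => curry₃_swap_right _ _ _ _
  have h₀' : ∀ᶠ y in 𝓝 (t₀, (0 : C2n n)), ∀ u v w,
      curry₃ _ (Θ y) (0, u) (0, v) (0, w) = 0 := by simpa only [curry₃_apply] using h₀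
  have hclosed := fun τ => eventually_closed_horizontalContraction τ hΘ hd h₀'
  let J : C2n n →L[ℝ] C2n n := Complex.I • ContinuousLinearMap.id ℝ (C2n n)
  have hJ : ∀ᶠ y in 𝓝 (t₀, (0 : C2n n)), ∀ u v, β Complex.I y u v = - β 1 y u (J v) := by
    filter_upwards [hI] with y hy u v
    rw [hβ_apply, hβ_apply]
    exact hy u v
  have hb₁ : ∀ u v, β 1 (t₀, 0) u v = - omega₂ n u v := fun u v => by rw [hβ_apply, hstd]
  -- Compatibility forces the second constant form: b₂(u, v) = ω₂(u, iv) = ω₁(u, v).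
  have hb₂ : ∀ u v, β Complex.I (t₀, 0) u v = omega₁ n u v := fun u v => by
    rw [hJ.self_of_nhds, hb₁, neg_neg, ← omega₂_I_smul]; rfl
  obtain ⟨S, hS⟩ := exists_equiv_of_nondegenerate (β 1 (t₀, 0)) fun u hu =>
    eq_zero_of_omega₂ fun v => by rw [← neg_eq_zero, ← hb₁, hu]
  obtain ⟨φ, hφ, hφ0, hφ', hφβ⟩ := exists_darboux_map J (hβ 1) (hβ Complex.I) (hskew 1)
    (hskew Complex.I) (hclosed 1) (hclosed Complex.I) hJ rfl rfl S hS
  let f : ℂ × C2n n → ℂ × C2n n := fun y => (y.1, φ y)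
  have hf : ∀ᶠ y in 𝓝 (t₀, (0 : C2n n)), ContDiffAt ℝ ∞ f y := hφ.mono fun y hy =>
    contDiffAt_fst.prodMk hy
  have hf' : ∀ᶠ y in 𝓝 (t₀, (0 : C2n n)),
      HasFDerivAt f ((ContinuousLinearMap.fst ℝ ℂ (C2n n)).prod (fderiv ℝ φ y)) y :=
    hφ.mono fun y hy => hasFDerivAt_fst.prodMk (hy.differentiableAt (by simp)).hasFDerivAt
  -- The derivative of f at the base point is the identity because the Moser field vanishes there to
  -- first order.
  have hid : HasFDerivAt f (ContinuousLinearEquiv.refl ℝ (ℂ × C2n n) : _ →L[ℝ] _) (t₀, 0) := by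
    convert hf'.self_of_nhds using 1
    exact ContinuousLinearMap.ext fun w => Prod.ext rfl (hφ' w).symm
  have hf₀ : f (t₀, 0) = (t₀, 0) := Prod.ext rfl hφ0
  have hfc : Tendsto f (𝓝 (t₀, (0 : C2n n))) (𝓝 (t₀, (0 : C2n n))) := by
    have := hf.self_of_nhds.continuousAt
    rwa [ContinuousAt, hf₀] at this
  have hcomp : ∀ᶠ y in 𝓝 (t₀, (0 : C2n n)), ∀ a b c, curry₃ _ (pullbackForm f Θ y) a b c =
      curry₃ _ (Θ (f y)) (a.1, fderiv ℝ φ y a) (b.1, fderiv ℝ φ y b) (c.1, fderiv ℝ φ y c) := by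
    filter_upwards [hf'] with y hy a b c
    rw [curry₃_apply, pullbackForm_apply, hy.fderiv, curry₃_apply]
    rfl
  have hvert : ∀ᶠ y in 𝓝 (t₀, (0 : C2n n)), ∀ u v w,
      curry₃ _ (pullbackForm f Θ y) (0, u) (0, v) (0, w) = 0 := by
    filter_upwards [hcomp, hfc.eventually h₀'] with y hy hy' u v w
    rw [hy]; exact hy' _ _ _
  have hcontr : ∀ τ, ∀ᶠ y in 𝓝 (t₀, (0 : C2n n)), ∀ u v,
      curry₃ _ (pullbackForm f Θ y) (τ, 0) (0, u) (0, v) =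
        β τ (f y) (fderiv ℝ φ y (0, u)) (fderiv ℝ φ y (0, v)) := by
    intro τ
    filter_upwards [hcomp, hfc.eventually h₀'] with y hy hy' u v
    rw [hy]
    -- As φ depends on t, the image of a horizontal vector acquires a vertical part. It is invisible
    -- here, since the form vanishes on three vertical vectors.
    have : ((τ, fderiv ℝ φ y (τ, 0)) : ℂ × C2n n) = (τ, 0) + (0, fderiv ℝ φ y (τ, 0)) := by simp
    simp only
    rw [this, map_add, add_apply, add_apply, hy', add_zero]
    rfl
  obtain ⟨H, hH, hHeq⟩ := exists_hamiltonian (Ψ := pullbackForm f Θ) (t₀ := t₀)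
    (by
      filter_upwards [hf, hfc.eventually hΘ] with y hy hy' using contDiffAt_pullbackForm hy hy')
    (by
      filter_upwards [hf, hfc.eventually hΘ, hfc.eventually hd] with y hy hy' hy''
        using extDeriv_pullbackForm_eq_zero hy hy' hy'')
    hvert
    (by
      filter_upwards [hcontr 1, hφβ] with y hy hy' u v
      rw [hy, (hy' u v).1, hb₁])
    (by
      filter_upwards [hcontr Complex.I, hφβ] with y hy hy' u v
      rw [hy, (hy' u v).2, hb₂])
  obtain ⟨r, hr, hball⟩ := Metric.eventually_nhds_iff_ball.1 hHeq
  obtain ⟨e, he, hesub, hef, hes, het⟩ := exists_openPartialHomeomorph_of_contDiffAt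
    (𝕂 := ℝ) (n := ∞) (by simp) (inter_mem (hfc hO) (Metric.ball_mem_nhds _ hr)) hf hid
  obtain ⟨ρ, hρ, hρs⟩ := Metric.isOpen_iff.1 e.open_source _ he
  rw [← ball_prod_same] at hρs
  -- Restricting to a product of balls gives the domain the shape S × U required of the chart.
  let F := e.restrOpen (Metric.ball t₀ ρ ×ˢ Metric.ball 0 ρ)
    (Metric.isOpen_ball.prod Metric.isOpen_ball)
  have hFs : F.source = Metric.ball t₀ ρ ×ˢ Metric.ball 0 ρ := inter_eq_right.2 hρs
  have hFf : (F : _ → _) = f := hef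
  refine ⟨F, ρ, H, hρ, hFs, ?_, by rw [hFf, hf₀], fun y => by rw [hFf], ?_, ?_, hH, ?_⟩
  · intro z hz
    have h := (hesub (F.map_target hz).1).1
    change f (F.symm z) ∈ O at h
    rwa [← hFf, F.right_inv hz] at h
  · intro y hy
    rw [hFf]
    exact (hes y hy.1).1
  · exact fun y hy => het y hy.1
  · intro y hy a b c
    rw [hFf, ← hball y (hesub hy.1).2 a b c, pullbackForm_apply]

end LocalNormalForm

/-! ### Complex symplectic bases -/

section SymplecticBasis

/-- By induction on dimension: a pair with B(ζ, κ) = 1 spans a hyperbolic plane, and its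
B-orthogonal complement N is again non-degenerate and of smaller dimension. -/
theorem exists_symplectic_equiv {K : Type*} [AddCommGroup K] [Module ℂ K] [FiniteDimensional ℂ K]
    (B : K →ₗ[ℂ] K →ₗ[ℂ] ℂ) (halt : ∀ u, B u u = 0) (hnd : ∀ u, (∀ v, B u v = 0) → u = 0) :
    ∃ (n : ℕ) (e : K ≃ₗ[ℂ] C2n n), ∀ u v, B u v = omegaC n (e u) (e v) := by
  obtain ⟨d, hd⟩ : ∃ d, Module.finrank ℂ K = d := ⟨_, rfl⟩
  induction d using Nat.strong_induction_on generalizing K with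
  | _ d ih =>
    have hskew : ∀ u v, B u v = - B v u := fun u v => by
      have h := halt (u + v)
      simp only [map_add, LinearMap.add_apply, halt, zero_add, add_zero] at h
      exact eq_neg_of_add_eq_zero_right h
    by_cases hK : Subsingleton K
    · refine ⟨0, LinearEquiv.ofSubsingleton K (C2n 0), fun u v => ?_⟩
      rw [Subsingleton.elim u 0]
      simp [omegaC]
    have := not_subsingleton_iff_nontrivial.1 hK
    obtain ⟨ζ, hζ⟩ := exists_ne (0 : K)
    obtain ⟨κ₀, hκ₀⟩ : ∃ v, B ζ v ≠ 0 := by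
      by_contra! h
      exact hζ (hnd ζ h)
    let κ := (B ζ κ₀)⁻¹ • κ₀
    have hζκ : B ζ κ = 1 := by simp [κ, hκ₀]
    have hκζ : B κ ζ = -1 := by rw [hskew, hζκ]
    let N : Submodule ℂ K := LinearMap.ker (B ζ) ⊓ LinearMap.ker (B κ)
    have hN : ∀ w : N, B ζ w = 0 ∧ B κ w = 0 := fun w => w.2
    have hN' : ∀ w : N, B w ζ = 0 ∧ B w κ = 0 := fun w => by
      rw [hskew, (hN w).1, hskew _ κ, (hN w).2]; simp
    let π₀ : K →ₗ[ℂ] K := LinearMap.id - (B.flip κ).smulRight ζ - (B ζ).smulRight κ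
    have hπ₀ : ∀ x, π₀ x = x - B x κ • ζ - B ζ x • κ := fun x => rfl
    let π : K →ₗ[ℂ] N := π₀.codRestrict N fun x => by
      constructor
      · change B ζ (π₀ x) = 0
        simp [hπ₀, halt, hζκ]
      · change B κ (π₀ x) = 0
        simp [hπ₀, halt, hκζ, hskew x κ]
    have hπ : ∀ x, x = B x κ • ζ + B ζ x • κ + (π x : K) := fun x => by
      change x = _ + π₀ x
      rw [hπ₀]; abel
    obtain ⟨m, e, he⟩ := ih (Module.finrank ℂ N) (by
        rw [← hd]
        refine Submodule.finrank_lt fun h => ?_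
        have : κ ∈ N := h ▸ Submodule.mem_top
        exact zero_ne_one ((hN ⟨κ, this⟩).1.symm.trans hζκ))
      ((B.domRestrict N).compl₂ N.subtype) (fun u => halt _)
      (fun u hu => by
        have h₁ := hnd u fun v => by
          rw [hπ v]
          simp only [map_add, map_smul, (hN' u).1, (hN' u).2]
          simpa using hu (π v)
        exact Subtype.ext h₁) rfl
    -- The new q-coordinate is the coefficient B(ζ, x) of κ and the new z-coordinate the coefficient
    -- B(x, κ) of ζ, which matches B(ζ, κ) = 1 with the sign of `omegaC`.
    let g : K →ₗ[ℂ] C2n (m + 1) :=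
      { toFun := fun x => (Fin.cons (B ζ x) (e (π x)).1, Fin.cons (B x κ) (e (π x)).2)
        map_add' := fun x y => by
          ext k <;> refine Fin.cases ?_ (fun k => ?_) k <;> simp
        map_smul' := fun c x => by
          ext k <;> refine Fin.cases ?_ (fun k => ?_) k <;> simp }
    have hg : ∀ x y, B x y = omegaC (m + 1) (g x) (g y) := by
      intro x y
      have h₁ : omegaC (m + 1) (g x) (g y) =
          B x κ * B ζ y - B y κ * B ζ x + omegaC m (e (π x)) (e (π y)) := by
        simp only [omegaC, Fin.sum_univ_succ]
        rfl
      rw [h₁, ← he]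
      change _ = _ + B (π x) (π y)
      conv_lhs => rw [hπ x, hπ y]
      simp only [map_add, map_smul, LinearMap.add_apply, LinearMap.smul_apply, halt, hζκ, hκζ,
        (hN _).1, (hN _).2, (hN' _).1, (hN' _).2, smul_eq_mul]
      ring
    have hinj : Function.Injective g := by
      rw [← LinearMap.ker_eq_bot, LinearMap.ker_eq_bot']
      intro x hx
      refine hnd x fun v => ?_
      rw [hg, hx]
      simp [omegaC]
    have hsurj : Function.Surjective g := by
      intro y
      let w : N := e.symm (Fin.tail y.1, Fin.tail y.2)
      let x : K := y.2 0 • ζ + y.1 0 • κ + w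
      have h₁ : B ζ x = y.1 0 := by simp [x, halt, hζκ, (hN w).1]
      have h₂ : B x κ = y.2 0 := by simp [x, halt, hζκ, (hN' w).2]
      have h₃ : π x = w := Subtype.ext (by
        change π₀ x = w
        rw [hπ₀, h₁, h₂]; simp only [x]; abel)
      refine ⟨x, ?_⟩
      change ((Fin.cons (B ζ x) (e (π x)).1, Fin.cons (B x κ) (e (π x)).2) : C2n (m + 1)) = y
      rw [h₁, h₂, h₃]
      simp only [w, LinearEquiv.apply_symm_apply]
      exact Prod.ext (Fin.cons_self_tail _) (Fin.cons_self_tail _)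
    exact ⟨m + 1, LinearEquiv.ofBijective g ⟨hinj, hsurj⟩, hg⟩

end SymplecticBasis

/-! ### Holomorphic straightening of the fibration -/

section Straightening

set_option maxSynthPendingDepth 3

variable {E : Type*} [NormedAddCommGroup E] [NormedSpace ℂ E]

/-- The pointwise conditions on a 3-form relative to a complex linear functional: it vanishes on
the kernel and is compatible with the complex structure. -/
structure IsCompatibleForm (A : E [⋀^Fin 3]→L[ℝ] ℝ) (l : E →L[ℂ] ℂ) : Prop where
  horizontal : ∀ u v w, l u = 0 → l v = 0 → l w = 0 → A ![u, v, w] = 0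
  compatible : ∀ ξ u v, l u = 0 → l v = 0 →
    A ![Complex.I • ξ, u, v] = - A ![ξ, u, Complex.I • v]

/-- Compatibility for (u, v) and for (v, u) have opposite left-hand sides. Hence multiplication by i
is symmetric for A(ξ, ·, ·), which is what makes `bilin` complex linear in its first argument. -/
theorem IsCompatibleForm.I_smul_middle {A : E [⋀^Fin 3]→L[ℝ] ℝ} {l : E →L[ℂ] ℂ}
    (h : IsCompatibleForm A l) (ξ : E) {u v : E} (hu : l u = 0) (hv : l v = 0) :
    A ![ξ, Complex.I • u, v] = A ![ξ, u, Complex.I • v] := by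
  have h₁ := h.compatible ξ u v hu hv
  have h₂ := h.compatible ξ v u hv hu
  simp only [← curry₃_apply] at *
  rw [curry₃_swap_right A ξ (Complex.I • u) v]
  rw [curry₃_swap_right A (Complex.I • ξ) u v] at h₁
  linarith

theorem complex_smul_eq {M : Type*} [AddCommGroup M] [Module ℂ M] [Module ℝ M]
    [IsScalarTower ℝ ℂ M] (c : ℂ) (x : M) : c • x = c.re • x + c.im • (Complex.I • x) := by
  conv_lhs => rw [← Complex.re_add_im c]
  rw [add_smul, mul_smul, ← Complex.coe_algebraMap, algebraMap_smul, algebraMap_smul]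

/-- The complex bilinear form on the kernel of `l` whose imaginary part is `-A (ξ, ·, ·)`. -/
def IsCompatibleForm.bilin {A : E [⋀^Fin 3]→L[ℝ] ℝ} {l : E →L[ℂ] ℂ}
    (h : IsCompatibleForm A l) (ξ : E) :
    LinearMap.ker l.toLinearMap →ₗ[ℂ] LinearMap.ker l.toLinearMap →ₗ[ℂ] ℂ :=
  -- The real part is forced by the imaginary part: Re B(u, v) = Im B(u, iv).
  LinearMap.mk₂ ℂ (fun u v => ((- curry₃ E A ξ u (Complex.I • (v : E)) : ℝ) : ℂ) -
      Complex.I * (curry₃ E A ξ u v : ℝ))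
    (fun u u' v => by
      simp only [Submodule.coe_add, map_add, add_apply]
      push_cast; ring)
    (fun c u v => by
      have h₁ := h.I_smul_middle ξ (u := u) (v := v) u.2 v.2
      have h₂ := h.I_smul_middle ξ (u := u) (v := Complex.I • v) u.2
        (LinearMap.ker l.toLinearMap |>.smul_mem Complex.I v.2)
      simp only [← curry₃_apply, smul_smul, Complex.I_mul_I, neg_smul, one_smul,
        map_neg] at h₁ h₂
      simp only [Submodule.coe_smul]
      rw [complex_smul_eq c (u : E)]
      simp only [map_add, map_smul, add_apply, smul_apply, h₁, h₂, smul_eq_mul]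
      conv_rhs => rw [← Complex.re_add_im c]
      push_cast
      linear_combination ((c.im : ℂ) * (curry₃ E A ξ u v : ℝ)) * Complex.I_sq)
    (fun u v v' => by
      simp only [Submodule.coe_add, smul_add, map_add]
      push_cast; ring)
    (fun c u v => by
      simp only [Submodule.coe_smul]
      rw [smul_comm Complex.I c, complex_smul_eq c (v : E),
        complex_smul_eq c (Complex.I • (v : E)), smul_smul Complex.I Complex.I]
      simp only [map_add, map_smul, smul_eq_mul, Complex.I_mul_I, neg_smul,
        one_smul, map_neg]
      conv_rhs => rw [← Complex.re_add_im c]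
      push_cast
      linear_combination ((c.im : ℂ) * (curry₃ E A ξ u v : ℝ)) * Complex.I_sq)

theorem IsCompatibleForm.bilin_im {A : E [⋀^Fin 3]→L[ℝ] ℝ} {l : E →L[ℂ] ℂ}
    (h : IsCompatibleForm A l) (ξ : E) (u v : LinearMap.ker l.toLinearMap) :
    (h.bilin ξ u v).im = - A ![ξ, u, v] := by
  change (((- curry₃ E A ξ u (Complex.I • (v : E)) : ℝ) : ℂ) -
      Complex.I * (curry₃ E A ξ u v : ℝ)).im = _
  rw [curry₃_apply, curry₃_apply]
  simp

/-- Pointwise normal form. -/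
theorem IsCompatibleForm.exists_equiv [FiniteDimensional ℂ E] {A : E [⋀^Fin 3]→L[ℝ] ℝ}
    {l : E →L[ℂ] ℂ} (h : IsCompatibleForm A l) (hl : l ≠ 0)
    (hnd : ∀ ξ, l ξ ≠ 0 → ∀ u, l u = 0 → (∀ v, l v = 0 → A ![ξ, u, v] = 0) → u = 0) :
    ∃ (n : ℕ) (M : E ≃L[ℂ] ℂ × C2n n), Module.finrank ℂ E = 2 * n + 1 ∧ (∀ x, (M x).1 = l x) ∧
      ∀ u v, A ![M.symm (1, 0), M.symm (0, u), M.symm (0, v)] = - omega₂ n u v := by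
  obtain ⟨ξ₀, hξ₀⟩ : ∃ x, l x ≠ 0 := by
    by_contra! hx
    exact hl (ContinuousLinearMap.ext hx)
  let ξ := (l ξ₀)⁻¹ • ξ₀
  have hξ : l ξ = 1 := by simp [ξ, hξ₀]
  let K := LinearMap.ker l.toLinearMap
  have hK : ∀ u : K, l u = 0 := fun u => u.2
  have hzero : ∀ u, (∀ v, h.bilin ξ u v = 0) → u = 0 := fun u hu =>
    Subtype.ext (hnd ξ (by rw [hξ]; exact one_ne_zero) u (hK u) fun v hv => by
      have := h.bilin_im ξ u ⟨v, hv⟩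
      rw [hu] at this
      simpa using this)
  have halt : ∀ u, h.bilin ξ u u = 0 := by
    have him : ∀ u, (h.bilin ξ u u).im = 0 := fun u => by
      rw [h.bilin_im, ← curry₃_apply]
      linarith [curry₃_swap_right A ξ u u]
    intro u
    -- Only the imaginary part is alternating by construction. Since (1 + i)² = 2i, evaluating it on
    -- (1 + i)u yields the real part as well.
    have h₁ := him (((1 : ℂ) + Complex.I) • u)
    simp only [map_smul, LinearMap.smul_apply, smul_eq_mul] at h₁
    refine Complex.ext ?_ (him u)
    have h₂ := him u
    simp only [Complex.mul_im, Complex.mul_re, Complex.add_re, Complex.add_im, Complex.one_re,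
      Complex.one_im, Complex.I_re, Complex.I_im, h₂] at h₁
    rw [Complex.zero_re]
    linarith
  obtain ⟨n, e, he⟩ := exists_symplectic_equiv (h.bilin ξ) halt hzero
  let p : E →ₗ[ℂ] K := (LinearMap.id - l.toLinearMap.smulRight ξ).codRestrict K fun x => by
    change l (x - l x • ξ) = 0
    simp [hξ]
  have hp : ∀ x, (p x : E) = x - l x • ξ := fun x => rfl
  let M : E ≃ₗ[ℂ] ℂ × C2n n := LinearEquiv.ofLinearMap (l.toLinearMap.prod (e.toLinearMap ∘ₗ p))
    ((LinearMap.toSpanSingleton ℂ E ξ).coprod (K.subtype ∘ₗ e.symm.toLinearMap))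
    (LinearMap.ext fun x => by
      have h₁ : l (x.1 • ξ + (e.symm x.2 : E)) = x.1 := by simp [hξ, hK]
      have h₂ : p (x.1 • ξ + (e.symm x.2 : E)) = e.symm x.2 := Subtype.ext (by
        rw [hp, h₁]; abel)
      change (l (x.1 • ξ + (e.symm x.2 : E)), e (p (x.1 • ξ + (e.symm x.2 : E)))) = x
      rw [h₁, h₂, e.apply_symm_apply])
    (LinearMap.ext fun x => by
      change l x • ξ + (e.symm (e (p x)) : E) = x
      rw [e.symm_apply_apply, hp]; abel)
  refine ⟨n, M.toContinuousLinearEquiv, ?_, fun x => rfl, fun u v => ?_⟩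
  · rw [M.finrank_eq]
    simp
    ring
  · have h₁ : M.toContinuousLinearEquiv.symm (1, 0) = ξ := by
      change (1 : ℂ) • ξ + (e.symm 0 : E) = ξ
      simp
    have h₂ : ∀ u, M.toContinuousLinearEquiv.symm (0, u) = e.symm u := fun u => by
      change (0 : ℂ) • ξ + (e.symm u : E) = e.symm u
      simp
    rw [h₁, h₂, h₂, omega₂_eq_im]
    have h₃ := he (e.symm u) (e.symm v)
    rw [e.apply_symm_apply, e.apply_symm_apply] at h₃
    rw [← h₃, h.bilin_im, neg_neg]

end Straightening

/-! ### The normal form in a chart -/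

section ChartNormalForm

set_option maxSynthPendingDepth 3

variable {E : Type*} [NormedAddCommGroup E] [NormedSpace ℂ E] [FiniteDimensional ℂ E]

/-- The map with components s and the fiber part of the pointwise normal form M has derivative M at
y₀, so the complex inverse function theorem makes it a holomorphic chart. Being holomorphic, it
turns the kernel of ds into {0} × ℂ²ⁿ and I into multiplication by i, so compatibility persists at
nearby points. -/
theorem exists_holomorphic_straightening {Θ : E → E [⋀^Fin 3]→L[ℝ] ℝ} {s : E → ℂ} {y₀ : E}
    {O : Set E} (hO : O ∈ 𝓝 y₀)
    (hΘ : ∀ᶠ y in 𝓝 y₀, ContDiffAt ℝ ∞ Θ y) (hd : ∀ᶠ y in 𝓝 y₀, extDeriv Θ y = 0)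
    (hs : ∀ᶠ y in 𝓝 y₀, ContDiffAt ℂ ω s y) (hs₀ : fderiv ℂ s y₀ ≠ 0)
    (hc : ∀ᶠ y in 𝓝 y₀, IsCompatibleForm (Θ y) (fderiv ℂ s y))
    (hnd : ∀ ξ, fderiv ℂ s y₀ ξ ≠ 0 → ∀ u, fderiv ℂ s y₀ u = 0 →
      (∀ v, fderiv ℂ s y₀ v = 0 → Θ y₀ ![ξ, u, v] = 0) → u = 0) :
    ∃ (n : ℕ) (h : OpenPartialHomeomorph E (ℂ × C2n n)), Module.finrank ℂ E = 2 * n + 1 ∧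
      y₀ ∈ h.source ∧ h.source ⊆ O ∧ h y₀ = (s y₀, 0) ∧ (∀ y, (h y).1 = s y) ∧
      (∀ y ∈ h.source, ContDiffAt ℂ ω h y) ∧ (∀ z ∈ h.target, ContDiffAt ℂ ω h.symm z) ∧
      (∀ᶠ z in 𝓝 (s y₀, (0 : C2n n)), ContDiffAt ℝ ∞ (pullbackForm h.symm Θ) z) ∧
      (∀ᶠ z in 𝓝 (s y₀, (0 : C2n n)), extDeriv (pullbackForm h.symm Θ) z = 0) ∧
      (∀ᶠ z in 𝓝 (s y₀, (0 : C2n n)), ∀ u v w,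
        pullbackForm h.symm Θ z ![(0, u), (0, v), (0, w)] = 0) ∧
      (∀ᶠ z in 𝓝 (s y₀, (0 : C2n n)), ∀ u v,
        pullbackForm h.symm Θ z ![(Complex.I, 0), (0, u), (0, v)] =
        - pullbackForm h.symm Θ z ![(1, 0), (0, u), (0, Complex.I • v)]) ∧
      ∀ u v, pullbackForm h.symm Θ (s y₀, 0) ![(1, 0), (0, u), (0, v)] = - omega₂ n u v := by
  obtain ⟨n, M, hdim, hM₁, hM₂⟩ := hc.self_of_nhds.exists_equiv hs₀ hnd
  let f : E → ℂ × C2n n := fun y => (s y, (M (y - y₀)).2)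
  have hω : (ω : ℕ∞ω) ≠ 0 := by simp
  have hq : ContDiff ℂ ω (fun y => (M (y - y₀)).2) :=
    contDiff_snd.comp (M.contDiff.comp (contDiff_id.sub contDiff_const))
  have hf : ∀ᶠ y in 𝓝 y₀, ContDiffAt ℂ ω f y := hs.mono fun y hy => hy.prodMk hq.contDiffAt
  have hf' : HasFDerivAt f (M : E →L[ℂ] ℂ × C2n n) y₀ := by
    have h₁ := (hs.self_of_nhds.differentiableAt hω).hasFDerivAt
    have h₂ : HasFDerivAt (fun y => (M (y - y₀)).2)
        ((ContinuousLinearMap.snd ℂ ℂ (C2n n)) ∘L (M : E →L[ℂ] ℂ × C2n n)) y₀ := by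
      have h₃ : HasFDerivAt (fun y => y - y₀) (ContinuousLinearMap.id ℂ E) y₀ :=
        (hasFDerivAt_id y₀).sub_const y₀
      exact ((ContinuousLinearMap.snd ℂ ℂ (C2n n)) ∘L
        (M : E →L[ℂ] ℂ × C2n n)).hasFDerivAt.comp y₀ h₃
    convert h₁.prodMk h₂ using 1
    exact ContinuousLinearMap.ext fun x => Prod.ext (hM₁ x) rfl
  have : CompleteSpace E := FiniteDimensional.complete ℂ E
  obtain ⟨h, hy₀, hsub, hhf, hsrc, htar⟩ := exists_openPartialHomeomorph_of_contDiffAt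
    (𝕂 := ℂ) (n := ω) hω hO hf hf'
  have hz₀ : h y₀ = (s y₀, 0) := by rw [hhf]; simp [f]
  have hmem : (s y₀, (0 : C2n n)) ∈ h.target := hz₀ ▸ h.map_source hy₀
  have hsymm₀ : h.symm (s y₀, 0) = y₀ := by rw [← hz₀, h.left_inv hy₀]
  have htarget : ∀ᶠ z in 𝓝 (s y₀, (0 : C2n n)), z ∈ h.target := h.open_target.mem_nhds hmem
  have htend : Tendsto h.symm (𝓝 (s y₀, (0 : C2n n))) (𝓝 y₀) := by
    have := (htar _ hmem).continuousAt
    rwa [ContinuousAt, hsymm₀] at this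
  have hsmooth : ∀ z ∈ h.target, ContDiffAt ℝ ∞ h.symm z := fun z hz =>
    ((htar z hz).restrict_scalars ℝ).of_le le_top
  have hder : ∀ z ∈ h.target, fderiv ℝ h.symm z = (fderiv ℂ h.symm z).restrictScalars ℝ :=
    fun z hz => ((htar z hz).differentiableAt hω).fderiv_restrictScalars ℝ
  have hfst : ∀ᶠ z in 𝓝 (s y₀, (0 : C2n n)), ∀ a,
      fderiv ℂ s (h.symm z) (fderiv ℂ h.symm z a) = a.1 := by
    filter_upwards [htarget.eventually_nhds, htend.eventually hs] with z hz hz' a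
    have h₁ : HasFDerivAt (s ∘ h.symm) _ z :=
      (hz'.differentiableAt hω).hasFDerivAt.comp z
        ((htar z hz.self_of_nhds).differentiableAt hω).hasFDerivAt
    have h₂ : s ∘ h.symm =ᶠ[𝓝 z] Prod.fst := hz.mono fun w hw =>
      congrArg Prod.fst ((congrFun hhf _).symm.trans (h.right_inv hw))
    exact congrArg (fun L => L a) (h₁.unique (hasFDerivAt_fst.congr_of_eventuallyEq h₂))
  have happ : ∀ z ∈ h.target, ∀ a b c, pullbackForm h.symm Θ z ![a, b, c] =
      Θ (h.symm z) ![fderiv ℂ h.symm z a, fderiv ℂ h.symm z b, fderiv ℂ h.symm z c] :=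
    fun z hz a b c => by
      rw [pullbackForm_apply, hder z hz]
      rfl
  refine ⟨n, h, hdim, hy₀, hsub, hz₀, fun y => by rw [hhf], ?_, htar, ?_, ?_, ?_, ?_, ?_⟩
  · rw [hhf]
    exact fun y hy => (hsrc y hy).1
  · filter_upwards [htarget, htend.eventually hΘ] with z hz hz'
    exact contDiffAt_pullbackForm (hsmooth z hz) hz'
  · filter_upwards [htarget, htend.eventually hΘ, htend.eventually hd] with z hz hz' hz''
    exact extDeriv_pullbackForm_eq_zero (hsmooth z hz) hz' hz''
  · filter_upwards [htarget, hfst, htend.eventually hc] with z hz hz' hz'' u v w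
    rw [happ z hz]
    exact hz''.horizontal _ _ _ (hz' _) (hz' _) (hz' _)
  · filter_upwards [htarget, hfst, htend.eventually hc] with z hz hz' hz'' u v
    rw [happ z hz, happ z hz]
    have e₁ : fderiv ℂ h.symm z (Complex.I, 0) = Complex.I • fderiv ℂ h.symm z (1, 0) := by
      rw [← map_smul]; simp
    have e₂ : fderiv ℂ h.symm z (0, Complex.I • v) = Complex.I • fderiv ℂ h.symm z (0, v) := by
      rw [← map_smul]
      exact congrArg _ (Prod.ext (smul_zero _).symm rfl)
    rw [e₁, e₂]
    exact hz''.compatible _ _ _ (hz' _) (hz' _)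
  · intro u v
    have e : fderiv ℂ h.symm (s y₀, 0) = (M.symm : (ℂ × C2n n) →L[ℂ] E) := by
      refine (h.hasFDerivAt_symm hmem ?_).fderiv
      rw [hsymm₀, hhf]
      exact hf'
    rw [happ _ hmem, e, hsymm₀]
    exact hM₂ u v

/-- The chart is the holomorphic straightening h followed by the inverse of the Moser map F. Having
the image of F inside the target of h makes the target the full product of balls. -/
theorem exists_chart_normalForm {Θ : E → E [⋀^Fin 3]→L[ℝ] ℝ} {s : E → ℂ} {y₀ : E}
    {O : Set E} (hO : O ∈ 𝓝 y₀)
    (hΘ : ∀ᶠ y in 𝓝 y₀, ContDiffAt ℝ ∞ Θ y) (hd : ∀ᶠ y in 𝓝 y₀, extDeriv Θ y = 0)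
    (hs : ∀ᶠ y in 𝓝 y₀, ContDiffAt ℂ ω s y) (hs₀ : fderiv ℂ s y₀ ≠ 0)
    (hc : ∀ᶠ y in 𝓝 y₀, IsCompatibleForm (Θ y) (fderiv ℂ s y))
    (hnd : ∀ ξ, fderiv ℂ s y₀ ξ ≠ 0 → ∀ u, fderiv ℂ s y₀ u = 0 →
      (∀ v, fderiv ℂ s y₀ v = 0 → Θ y₀ ![ξ, u, v] = 0) → u = 0) :
    ∃ (n : ℕ) (G : OpenPartialHomeomorph E (ℂ × C2n n)) (r : ℝ) (H : ℂ × C2n n → ℝ),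
      Module.finrank ℂ E = 2 * n + 1 ∧ 0 < r ∧ y₀ ∈ G.source ∧ G.source ⊆ O ∧
      G.target = Metric.ball (s y₀) r ×ˢ Metric.ball 0 r ∧ (∀ y ∈ G.source, (G y).1 = s y) ∧
      (∀ y ∈ G.source, ContDiffAt ℝ ∞ G y) ∧ (∀ z ∈ G.target, ContDiffAt ℝ ∞ G.symm z) ∧
      ContDiff ℝ ∞ H ∧ ∀ z ∈ G.target, ∀ a b c,
        Θ (G.symm z) ![fderiv ℝ G.symm z a, fderiv ℝ G.symm z b, fderiv ℝ G.symm z c] =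
        omegaStd n a b c - wedge21 (wedge11 (dHt H z) dt₁) dt₂ a b c := by
  obtain ⟨n, h, hdim, hy₀, hsub, hz₀, hfst, hsm, hsm', k₁, k₂, k₃, k₄, k₅⟩ :=
    exists_holomorphic_straightening hO hΘ hd hs hs₀ hc hnd
  have hmem : (s y₀, (0 : C2n n)) ∈ h.target := hz₀ ▸ h.map_source hy₀
  obtain ⟨F, r, H, hr, hFs, hFt, hF₀, hF₁, hFsm, hFsm', hH, hform⟩ :=
    exists_local_normalForm k₁ k₂ k₃ k₄ k₅ (h.open_target.mem_nhds hmem)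
  have hbase : (s y₀, (0 : C2n n)) ∈ F.source := by
    rw [hFs]; exact ⟨Metric.mem_ball_self hr, Metric.mem_ball_self hr⟩
  have hsr : ∀ {y}, ContDiffAt ℂ ω h y → ContDiffAt ℝ ∞ h y := fun hy =>
    (hy.restrict_scalars ℝ).of_le le_top
  have hsr' : ∀ {z}, ContDiffAt ℂ ω h.symm z → ContDiffAt ℝ ∞ h.symm z := fun hz =>
    (hz.restrict_scalars ℝ).of_le le_top
  have hT : (h.trans F.symm).target = F.source := by
    rw [OpenPartialHomeomorph.trans_target]
    exact inter_eq_left.2 fun z hz => hFt (F.map_source hz)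
  refine ⟨n, h.trans F.symm, r, H, hdim, hr, ?_, fun y hy => hsub hy.1, hT.trans hFs, ?_, ?_, ?_,
    hH, ?_⟩
  · refine ⟨hy₀, ?_⟩
    change h y₀ ∈ F.target
    rw [hz₀, ← hF₀]
    exact F.map_source hbase
  · intro y hy
    change (F.symm (h y)).1 = s y
    have hy' : h y ∈ F.target := hy.2
    rw [← hfst, ← hF₁ (F.symm (h y)), F.right_inv hy']
  · intro y hy
    exact (hFsm' _ hy.2).comp y (hsr (hsm y hy.1))
  · intro z hz
    rw [hT] at hz
    exact (hsr' (hsm' _ (hFt (F.map_source hz)))).comp z (hFsm z hz)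
  · intro z hz a b c
    rw [hT] at hz
    have e : fderiv ℝ (h.symm ∘ F) z = (fderiv ℝ h.symm (F z)) ∘L fderiv ℝ F z :=
      fderiv_comp z ((hsr' (hsm' _ (hFt (F.map_source hz)))).differentiableAt (by simp))
        ((hFsm z hz).differentiableAt (by simp))
    rw [← hform z hz a b c, pullbackForm_apply]
    change Θ (h.symm (F z)) ![fderiv ℝ (h.symm ∘ F) z a, fderiv ℝ (h.symm ∘ F) z b,
      fderiv ℝ (h.symm ∘ F) z c] = _
    rw [e]
    rfl

end ChartNormalForm

/-! ### Holomorphic maps between complex manifolds as maps of real manifolds -/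

section RestrictScalars

variable {E : Type*} [NormedAddCommGroup E] [NormedSpace ℂ E]
  {M : Type*} [TopologicalSpace M] [ChartedSpace E M]
  {E' : Type*} [NormedAddCommGroup E'] [NormedSpace ℂ E']
  {M' : Type*} [TopologicalSpace M'] [ChartedSpace E' M']

theorem ContMDiffAt.real_of_complex {n : ℕ∞ω} {f : M → M'} {x : M}
    (h : ContMDiffAt 𝓘(ℂ, E) 𝓘(ℂ, E') n f x) : ContMDiffAt 𝓘(ℝ, E) 𝓘(ℝ, E') n f x := by
  rw [contMDiffAt_iff] at h ⊢
  exact ⟨h.1, ContDiffWithinAt.restrict_scalars ℝ h.2⟩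

theorem mfderiv_complexStructure {f : M → M'} {x : M}
    (h : MDifferentiableAt 𝓘(ℂ, E) 𝓘(ℂ, E') f x) (v : TangentSpace 𝓘(ℝ, E) x) :
    mfderiv 𝓘(ℝ, E) 𝓘(ℝ, E') f x (complexStructure x v) =
      complexStructure (f x) (mfderiv 𝓘(ℝ, E) 𝓘(ℝ, E') f x v) := by
  let L : E →L[ℂ] E' := mfderiv 𝓘(ℂ, E) 𝓘(ℂ, E') f x
  have h₁ : HasMFDerivAt 𝓘(ℝ, E) 𝓘(ℝ, E') f x (L.restrictScalars ℝ : E →L[ℝ] E') :=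
    ⟨h.hasMFDerivAt.1, HasFDerivWithinAt.restrictScalars ℝ h.hasMFDerivAt.2⟩
  rw [h₁.mfderiv]
  exact L.map_smul Complex.I v

/-- A trivialization provides a smooth local section g through w, and σ ∘ g = id makes dσ surjective
at w. -/
theorem exists_mfderiv_ne_zero_of_isSmoothFiberBundle {EF : Type*} [NormedAddCommGroup EF] [NormedSpace ℝ EF]
    {F : Type*} [TopologicalSpace F] [ChartedSpace EF F]
    {B : Type*} [TopologicalSpace B] [ChartedSpace ℂ B] {σ : M → B}
    (hσ : IsSmoothFiberBundle (E := E) EF F σ) (w : M)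
    (hd : MDifferentiableAt 𝓘(ℝ, E) 𝓘(ℝ, ℂ) σ w) :
    ∃ ξ : TangentSpace 𝓘(ℝ, E) w, mfderiv 𝓘(ℝ, E) 𝓘(ℝ, ℂ) σ w ξ ≠ 0 := by
  obtain ⟨T, hT, -, hsymm⟩ := hσ (σ w)
  have hw : w ∈ T.source := T.mem_source.2 hT
  let g : B → M := fun b => T.toOpenPartialHomeomorph.symm (b, (T w).2)
  have hmem : ∀ b ∈ T.baseSet, (b, (T w).2) ∈ T.target := fun b hb => T.mem_target.2 hb
  have hTw : (σ w, (T w).2) = T w := Prod.ext (T.coe_fst hw).symm rfl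
  have hgw : g (σ w) = w := by
    change T.toOpenPartialHomeomorph.symm (σ w, (T w).2) = w
    rw [hTw]
    exact T.toOpenPartialHomeomorph.left_inv hw
  have h₁ : MDifferentiableAt (𝓘(ℝ, ℂ).prod 𝓘(ℝ, EF)) 𝓘(ℝ, E) T.toOpenPartialHomeomorph.symm
      (σ w, (T w).2) :=
    (hsymm.contMDiffAt (T.open_target.mem_nhds (hmem _ hT))).mdifferentiableAt (by simp)
  have h₂ : MDifferentiableAt 𝓘(ℝ, ℂ) (𝓘(ℝ, ℂ).prod 𝓘(ℝ, EF)) (fun b : B => (b, (T w).2)) (σ w) :=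
    mdifferentiableAt_id.prodMk mdifferentiableAt_const
  have h₃ : MDifferentiableAt 𝓘(ℝ, ℂ) 𝓘(ℝ, E) g (σ w) := h₁.comp (σ w) h₂
  have h₄ : mfderiv 𝓘(ℝ, ℂ) 𝓘(ℝ, ℂ) (σ ∘ g) (σ w) =
      (mfderiv 𝓘(ℝ, E) 𝓘(ℝ, ℂ) σ (g (σ w))).comp (mfderiv 𝓘(ℝ, ℂ) 𝓘(ℝ, E) g (σ w)) :=
    mfderiv_comp (σ w) (by rw [hgw]; exact hd) h₃
  have h₅ : σ ∘ g =ᶠ[𝓝 (σ w)] id := by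
    filter_upwards [T.open_baseSet.mem_nhds hT] with b hb
    exact T.proj_symm_apply (hmem b hb)
  rw [h₅.mfderiv_eq, mfderiv_id] at h₄
  have h₆ : mfderiv 𝓘(ℝ, E) 𝓘(ℝ, ℂ) σ (g (σ w)) (mfderiv 𝓘(ℝ, ℂ) 𝓘(ℝ, E) g (σ w) (1 : ℂ)) =
      (1 : ℂ) := (congrArg (fun L : ℂ →L[ℝ] ℂ => L 1) h₄).symm
  have h₇ : ∃ ξ : TangentSpace 𝓘(ℝ, E) (g (σ w)),
      mfderiv 𝓘(ℝ, E) 𝓘(ℝ, ℂ) σ (g (σ w)) ξ ≠ 0 := ⟨_, by rw [h₆]; exact one_ne_zero (α := ℂ)⟩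
  rwa [hgw] at h₇

/-- A chart of a complex manifold and its inverse are smooth as maps of real manifolds. -/
theorem contMDiffAt_chartAt_real [IsManifold 𝓘(ℂ, E) ω M] {w x : M}
    (hx : x ∈ (chartAt E w).source) :
    ContMDiffAt 𝓘(ℝ, E) 𝓘(ℝ, E) ∞ (chartAt E w) x :=
  ((contMDiffOn_chart (I := 𝓘(ℂ, E)) (n := ω)).contMDiffAt
    ((chartAt E w).open_source.mem_nhds hx)).real_of_complex.of_le le_top

theorem contMDiffAt_chartAt_symm_real [IsManifold 𝓘(ℂ, E) ω M] {w : M} {y : E}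
    (hy : y ∈ (chartAt E w).target) :
    ContMDiffAt 𝓘(ℝ, E) 𝓘(ℝ, E) ∞ (chartAt E w).symm y :=
  ((contMDiffOn_chart_symm (I := 𝓘(ℂ, E)) (n := ω)).contMDiffAt
    ((chartAt E w).open_target.mem_nhds hy)).real_of_complex.of_le le_top

theorem mdifferentiable_chartAt_real [IsManifold 𝓘(ℂ, E) ω M] (w : M) :
    (chartAt E w).MDifferentiable 𝓘(ℝ, E) 𝓘(ℝ, E) :=
  ⟨fun _ hx => ((contMDiffAt_chartAt_real hx).mdifferentiableAt
      (by simp)).mdifferentiableWithinAt,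
    fun _ hy => ((contMDiffAt_chartAt_symm_real hy).mdifferentiableAt
      (by simp)).mdifferentiableWithinAt⟩

end RestrictScalars

/-! ### Fiberwise compatibility with the complex structure -/

section Compatibility

theorem omega₂_sub_right (n : ℕ) (u v w : C2n n) :
    omega₂ n u (v - w) = omega₂ n u v - omega₂ n u w := by
  simp only [omega₂_eq_im, ← Complex.sub_im]
  congr 1
  simp only [omegaC, ← Finset.sum_sub_distrib]
  refine Finset.sum_congr rfl fun k _ => ?_
  simp
  ring

theorem omega₂_swap (n : ℕ) (u v : C2n n) : omega₂ n u v = - omega₂ n v u := by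
  simp only [omega₂_eq_im, ← Complex.neg_im]
  congr 1
  simp only [omegaC, ← Finset.sum_neg_distrib]
  exact Finset.sum_congr rfl fun k _ => by ring

/-- A real linear isomorphism onto `ℂ × ℂ²ⁿ` which brings a compatible form into normal form and
is complex linear in the horizontal direction is complex linear on vertical vectors. -/
theorem map_I_smul_of_normalForm {E : Type*} [NormedAddCommGroup E] [NormedSpace ℂ E] {n : ℕ}
    {A : E [⋀^Fin 3]→L[ℝ] ℝ} {D : E →L[ℝ] ℂ × C2n n} {D' : ℂ × C2n n →L[ℝ] E}
    (h₁ : ∀ v, D' (D v) = v) (h₂ : ∀ a, D (D' a) = a) {η : C2n n → ℝ}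
    (hA : ∀ a b c, A ![D' a, D' b, D' c] =
      omegaStd n a b c - wedge21 (wedge11 (fun a => η a.2) dt₁) dt₂ a b c)
    (hI : ∀ v, (D (Complex.I • v)).1 = Complex.I * (D v).1)
    (hc : ∀ ξ u v, (D u).1 = 0 → (D v).1 = 0 →
      A ![Complex.I • ξ, u, v] = - A ![ξ, u, Complex.I • v])
    {v : E} (hv : (D v).1 = 0) : D (Complex.I • v) = Complex.I • D v := by
  have hIv : (D (Complex.I • v)).1 = 0 := by rw [hI, hv, mul_zero]
  have key : ∀ a b c, b.1 = 0 → c.1 = 0 → A ![D' a, D' b, D' c] =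
      omega₁ n b.2 c.2 * a.1.im - omega₂ n b.2 c.2 * a.1.re := fun a b c hb hc => by
    rw [hA]
    simp [omegaStd, wedge21, wedge11, dt₁, dt₂, hb, hc]
  refine Prod.ext (by rw [hIv, Prod.smul_fst, hv, smul_zero]) (sub_eq_zero.1 ?_)
  -- Compatibility with ξ = D'(1, 0), tested against a vertical β, gives ω₂(β, D(Iv)) = ω₁(β, Dv) =
  -- ω₂(β, i Dv), and ω₂ is non-degenerate. Only the base component i of D(Iξ) enters; its unknown
  -- vertical part is annihilated.
  refine eq_zero_of_omega₂ fun β => ?_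
  rw [omega₂_swap, omega₂_sub_right, neg_eq_zero, sub_eq_zero]
  have h := hc (D' (1, 0)) (D' (0, β)) v (by rw [h₂]) hv
  have k₁ := key (D (Complex.I • D' (1, 0))) (0, β) (D v) rfl hv
  have k₂ := key (1, 0) (0, β) (D (Complex.I • v)) rfl hIv
  rw [h₁] at k₁ k₂
  rw [h₁] at k₁
  rw [k₁, k₂, hI, h₂] at h
  simpa [omega₂_I_smul] using h.symm

end Compatibility

/-! ### The expression of a CRMS bundle in charts -/

section Charts

variable {E : Type*} [NormedAddCommGroup E] [NormedSpace ℂ E]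
  {W : Type*} [TopologicalSpace W] [ChartedSpace E W]
  {B : Type*} [TopologicalSpace B] [ChartedSpace ℂ B]

theorem pullback3_apply {E : Type*} [NormedAddCommGroup E] [NormedSpace ℝ E]
    {M : Type*} [TopologicalSpace M] [ChartedSpace E M]
    {E' : Type*} [NormedAddCommGroup E'] [NormedSpace ℝ E']
    {M' : Type*} [TopologicalSpace M'] [ChartedSpace E' M']
    (f : M → M') (Ω : Form3 E' M') (x : M) (a b c : TangentSpace 𝓘(ℝ, E) x) :
    pullback3 f Ω x ![a, b, c] = Ω (f x) ![mfderiv 𝓘(ℝ, E) 𝓘(ℝ, E') f x a,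
      mfderiv 𝓘(ℝ, E) 𝓘(ℝ, E') f x b, mfderiv 𝓘(ℝ, E) 𝓘(ℝ, E') f x c] := by
  change Ω (f x) (fun i => mfderiv 𝓘(ℝ, E) 𝓘(ℝ, E') f x (![a, b, c] i)) = _
  congr 1
  ext i
  fin_cases i <;> rfl

/-- The expression of a map to a surface in the preferred charts at `w` and `σ w`. -/
def chartMap (σ : W → B) (w : W) : E → ℂ := chartAt ℂ (σ w) ∘ σ ∘ (chartAt E w).symm

/-- The domain of `chartMap σ w`. -/
def chartMapDomain (E : Type*) [NormedAddCommGroup E] [NormedSpace ℂ E] {W : Type*}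
    [TopologicalSpace W] [ChartedSpace E W] (σ : W → B) (w : W) : Set E :=
  (chartAt E w).target ∩ (chartAt E w).symm ⁻¹' (σ ⁻¹' (chartAt ℂ (σ w)).source)

theorem isOpen_chartMapDomain {σ : W → B} (hσ : Continuous σ) (w : W) :
    IsOpen (chartMapDomain E σ w) :=
  (chartAt E w).isOpen_inter_preimage_symm ((chartAt ℂ (σ w)).open_source.preimage hσ)

theorem mem_chartMapDomain_self (σ : W → B) (w : W) : chartAt E w w ∈ chartMapDomain E σ w :=
  ⟨mem_chart_target E w, by
    rw [mem_preimage, (chartAt E w).left_inv (mem_chart_source E w)]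
    exact mem_chart_source ℂ (σ w)⟩

theorem mdifferentiable_real_of_contMDiff {σ : W → B}
    (hσ : ContMDiff 𝓘(ℂ, E) 𝓘(ℂ, ℂ) ω σ) (x : W) :
    MDifferentiableAt 𝓘(ℝ, E) 𝓘(ℝ, ℂ) σ x :=
  (hσ x).real_of_complex.mdifferentiableAt (by simp)

variable [IsManifold 𝓘(ℂ, E) ω W] [IsManifold 𝓘(ℂ, ℂ) ω B] {σ : W → B}

theorem contDiffAt_chartMap (hσ : ContMDiff 𝓘(ℂ, E) 𝓘(ℂ, ℂ) ω σ) {w : W} {y : E}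
    (hy : y ∈ chartMapDomain E σ w) : ContDiffAt ℂ ω (chartMap σ w) y := by
  rw [← contMDiffAt_iff_contDiffAt]
  have h₁ : ContMDiffAt 𝓘(ℂ, E) 𝓘(ℂ, E) ω (chartAt E w).symm y :=
    (contMDiffOn_chart_symm (I := 𝓘(ℂ, E)) (n := ω)).contMDiffAt
      ((chartAt E w).open_target.mem_nhds hy.1)
  have h₂ : ContMDiffAt 𝓘(ℂ, ℂ) 𝓘(ℂ, ℂ) ω (chartAt ℂ (σ w)) (σ ((chartAt E w).symm y)) :=
    (contMDiffOn_chart (I := 𝓘(ℂ, ℂ)) (n := ω)).contMDiffAt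
      ((chartAt ℂ (σ w)).open_source.mem_nhds hy.2)
  exact h₂.comp y ((hσ _).comp y h₁)

theorem fderiv_chartMap (hσ : ContMDiff 𝓘(ℂ, E) 𝓘(ℂ, ℂ) ω σ) {w : W} {y : E}
    (hy : y ∈ chartMapDomain E σ w) (v : E) : fderiv ℂ (chartMap σ w) y v =
      mfderiv 𝓘(ℝ, ℂ) 𝓘(ℝ, ℂ) (chartAt ℂ (σ w)) (σ ((chartAt E w).symm y))
        (mfderiv 𝓘(ℝ, E) 𝓘(ℝ, ℂ) σ ((chartAt E w).symm y)
          (mfderiv 𝓘(ℝ, E) 𝓘(ℝ, E) (chartAt E w).symm y v)) := by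
  have hd : DifferentiableAt ℂ (chartMap σ w) y := (contDiffAt_chartMap hσ hy).differentiableAt
    (by simp)
  have h₀ : fderiv ℂ (chartMap σ w) y v = mfderiv 𝓘(ℝ, E) 𝓘(ℝ, ℂ) (chartMap σ w) y v := by
    rw [mfderiv_eq_fderiv, hd.fderiv_restrictScalars ℝ]
    rfl
  have h₁ : MDifferentiableAt 𝓘(ℝ, E) 𝓘(ℝ, E) (chartAt E w).symm y :=
    (mdifferentiable_chartAt_real w).mdifferentiableAt_symm hy.1
  have h₂ := mdifferentiable_real_of_contMDiff hσ ((chartAt E w).symm y)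
  have h₃ : MDifferentiableAt 𝓘(ℝ, ℂ) 𝓘(ℝ, ℂ) (chartAt ℂ (σ w)) (σ ((chartAt E w).symm y)) :=
    (mdifferentiable_chartAt_real (σ w)).mdifferentiableAt hy.2
  rw [h₀]
  change mfderiv 𝓘(ℝ, E) 𝓘(ℝ, ℂ) (chartAt ℂ (σ w) ∘ σ ∘ (chartAt E w).symm) y v = _
  rw [mfderiv_comp y h₃ (h₂.comp y h₁), mfderiv_comp y h₂ h₁]
  rfl

theorem mfderiv_chartAt_eq_zero_iff {b x : B} (hx : x ∈ (chartAt ℂ b).source)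
    {v : TangentSpace 𝓘(ℝ, ℂ) x} :
    mfderiv 𝓘(ℝ, ℂ) 𝓘(ℝ, ℂ) (chartAt ℂ b) x v = 0 ↔ v = 0 := by
  refine ⟨fun h => ?_, fun h => by rw [h]; exact map_zero _⟩
  have := congrArg (fun L : TangentSpace 𝓘(ℝ, ℂ) x →L[ℝ] TangentSpace 𝓘(ℝ, ℂ) x => L v)
    ((mdifferentiable_chartAt_real b).symm_comp_deriv hx)
  refine this.symm.trans ?_
  change mfderiv 𝓘(ℝ, ℂ) 𝓘(ℝ, ℂ) (chartAt ℂ b).symm _ (mfderiv 𝓘(ℝ, ℂ) 𝓘(ℝ, ℂ) _ x v) = 0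
  rw [h]
  exact map_zero _

theorem fderiv_chartMap_eq_zero_iff (hσ : ContMDiff 𝓘(ℂ, E) 𝓘(ℂ, ℂ) ω σ) {w : W} {y : E}
    (hy : y ∈ chartMapDomain E σ w) {v : E} : fderiv ℂ (chartMap σ w) y v = 0 ↔
      mfderiv 𝓘(ℝ, E) 𝓘(ℝ, E) (chartAt E w).symm y v ∈ verticalSpace σ ((chartAt E w).symm y) := by
  rw [fderiv_chartMap hσ hy]
  exact mfderiv_chartAt_eq_zero_iff hy.2

theorem mfderiv_chartAt_symm_smul_I {w : W} {y : E} (hy : y ∈ (chartAt E w).target) (v : E) :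
    mfderiv 𝓘(ℝ, E) 𝓘(ℝ, E) (chartAt E w).symm y (Complex.I • v) =
      complexStructure ((chartAt E w).symm y)
        (mfderiv 𝓘(ℝ, E) 𝓘(ℝ, E) (chartAt E w).symm y v) :=
  mfderiv_complexStructure (((contMDiffOn_chart_symm (I := 𝓘(ℂ, E)) (n := ω)).contMDiffAt
    ((chartAt E w).open_target.mem_nhds hy)).mdifferentiableAt (by simp)) v

variable {Ω : Form3 E W}

theorem IsCRMS.isCompatibleForm (hΩ : IsCRMS σ Ω) (hσ : ContMDiff 𝓘(ℂ, E) 𝓘(ℂ, ℂ) ω σ) {w : W}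
    {y : E} (hy : y ∈ chartMapDomain E σ w) :
    IsCompatibleForm (chartForm3 (chartAt E w) Ω y) (fderiv ℂ (chartMap σ w) y) where
  horizontal u v x hu hv hx :=
    (pullback3_apply (chartAt E w).symm Ω y u v x).trans (hΩ.horizontal _
      _ ((fderiv_chartMap_eq_zero_iff hσ hy).1 hu) _ ((fderiv_chartMap_eq_zero_iff hσ hy).1 hv)
      _ ((fderiv_chartMap_eq_zero_iff hσ hy).1 hx))
  compatible ξ u v hu hv := by
    have h := hΩ.compatible ((chartAt E w).symm y)
      (mfderiv 𝓘(ℝ, E) 𝓘(ℝ, E) (chartAt E w).symm y ξ)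
      _ ((fderiv_chartMap_eq_zero_iff hσ hy).1 hu) _ ((fderiv_chartMap_eq_zero_iff hσ hy).1 hv)
    rw [← mfderiv_chartAt_symm_smul_I hy.1, ← mfderiv_chartAt_symm_smul_I hy.1] at h
    exact (pullback3_apply (chartAt E w).symm Ω y (Complex.I • ξ : E) u v).trans
      (h.trans (congrArg Neg.neg
        (pullback3_apply (chartAt E w).symm Ω y ξ u (Complex.I • v : E)).symm))

theorem IsCRMS.chartForm3_nondegenerate (hΩ : IsCRMS σ Ω) (hσ : ContMDiff 𝓘(ℂ, E) 𝓘(ℂ, ℂ) ω σ)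
    {w : W} {y : E} (hy : y ∈ chartMapDomain E σ w) (ξ : E)
    (hξ : fderiv ℂ (chartMap σ w) y ξ ≠ 0) (u : E) (hu : fderiv ℂ (chartMap σ w) y u = 0)
    (h : ∀ v, fderiv ℂ (chartMap σ w) y v = 0 → chartForm3 (chartAt E w) Ω y ![ξ, u, v] = 0) :
    u = 0 := by
  let N : E →L[ℝ] E := mfderiv 𝓘(ℝ, E) 𝓘(ℝ, E) (chartAt E w).symm y
  let N' : E →L[ℝ] E := mfderiv 𝓘(ℝ, E) 𝓘(ℝ, E) (chartAt E w) ((chartAt E w).symm y)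
  have h₁ : ∀ v, N' (N v) = v := fun v =>
    congrArg (fun L : E →L[ℝ] E => L v) ((mdifferentiable_chartAt_real w).comp_symm_deriv hy.1)
  have h₂ : ∀ v, N (N' v) = v := fun v => by
    have := (mdifferentiable_chartAt_real w).symm_comp_deriv
      ((chartAt E w).map_target hy.1)
    rw [(chartAt E w).right_inv hy.1] at this
    exact congrArg (fun L : E →L[ℝ] E => L v) this
  have h₃ : N u = 0 := by
    refine hΩ.nondegenerate ((chartAt E w).symm y) (N ξ)
      (fun h₀ => hξ ((fderiv_chartMap_eq_zero_iff hσ hy).2 h₀)) (N u)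
      ((fderiv_chartMap_eq_zero_iff hσ hy).1 hu) fun v hv => ?_
    have hv' : N (N' v) ∈ verticalSpace σ ((chartAt E w).symm y) := by rwa [h₂ v]
    have h₄ := (pullback3_apply (chartAt E w).symm Ω y ξ u (N' v)).symm.trans
      (h (N' v) ((fderiv_chartMap_eq_zero_iff hσ hy).2 hv'))
    change Ω ((chartAt E w).symm y) ![N ξ, N u, N (N' v)] = 0 at h₄
    rwa [h₂ v] at h₄
  rw [← h₁ u, h₃, map_zero]

end Charts

/-! ### Complex linearity of the normal form chart along the fibers -/

section FiberwiseLinear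

variable {E : Type*} [NormedAddCommGroup E] [NormedSpace ℂ E]
  {W : Type*} [TopologicalSpace W] [ChartedSpace E W]
  {B : Type*} [TopologicalSpace B] [ChartedSpace ℂ B]

/-- A chart in which `Ω` has the normal form, and which lies over a holomorphic chart of the
base, is complex linear on vertical vectors. -/
theorem IsCRMS.mfderiv_complexStructure_of_normalForm {n : ℕ} {σ : W → B} {Ω : Form3 E W}
    (hΩ : IsCRMS σ Ω) {ψ : OpenPartialHomeomorph W (ℂ × C2n n)}
    (hψ : ψ.MDifferentiable 𝓘(ℝ, E) 𝓘(ℝ, ℂ × C2n n)) {x : W} (hx : x ∈ ψ.source) {χ : B → ℂ}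
    (hσ : MDifferentiableAt 𝓘(ℂ, E) 𝓘(ℂ, ℂ) σ x)
    (hχ : MDifferentiableAt 𝓘(ℂ, ℂ) 𝓘(ℂ, ℂ) χ (σ x))
    (hχ₀ : ∀ v, mfderiv 𝓘(ℝ, ℂ) 𝓘(ℝ, ℂ) χ (σ x) v = 0 → v = 0)
    (hpr : ∀ᶠ x' in 𝓝 x, (ψ x').1 = χ (σ x')) {η : C2n n → ℝ}
    (hform : ∀ a b c : ℂ × C2n n, pullback3 (M := ℂ × C2n n) ψ.symm Ω (ψ x) ![a, b, c] =
      omegaStd n a b c - wedge21 (wedge11 (fun a => η a.2) dt₁) dt₂ a b c)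
    {v : TangentSpace 𝓘(ℝ, E) x} (hv : v ∈ verticalSpace σ x) :
    mfderiv 𝓘(ℝ, E) 𝓘(ℝ, ℂ × C2n n) ψ x (complexStructure x v) =
      complexStructure (ψ x) (mfderiv 𝓘(ℝ, E) 𝓘(ℝ, ℂ × C2n n) ψ x v) := by
  let D : E →L[ℝ] ℂ × C2n n := mfderiv 𝓘(ℝ, E) 𝓘(ℝ, ℂ × C2n n) ψ x
  let D' : ℂ × C2n n →L[ℝ] E := mfderiv 𝓘(ℝ, ℂ × C2n n) 𝓘(ℝ, E) ψ.symm (ψ x)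
  have hσ' : MDifferentiableAt 𝓘(ℝ, E) 𝓘(ℝ, ℂ) σ x :=
    ⟨hσ.1, DifferentiableWithinAt.restrictScalars ℝ hσ.2⟩
  have hχ' : MDifferentiableAt 𝓘(ℝ, ℂ) 𝓘(ℝ, ℂ) χ (σ x) :=
    ⟨hχ.1, DifferentiableWithinAt.restrictScalars ℝ hχ.2⟩
  have h₁ : ∀ v, D' (D v) = v := fun v =>
    congrArg (fun L : E →L[ℝ] E => L v) (hψ.symm_comp_deriv hx)
  have h₂ : ∀ a, D (D' a) = a := fun a => by
    have := hψ.comp_symm_deriv (ψ.map_source hx)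
    rw [ψ.left_inv hx] at this
    exact congrArg (fun L : ℂ × C2n n →L[ℝ] ℂ × C2n n => L a) this
  -- The base component of dψ is dχ ∘ dσ, which is complex linear because χ and σ are holomorphic.
  have hfst : ∀ u, (D u).1 = mfderiv 𝓘(ℝ, ℂ) 𝓘(ℝ, ℂ) χ (σ x) (mfderiv 𝓘(ℝ, E) 𝓘(ℝ, ℂ) σ x u) := by
    intro u
    have e₁ : (fun x' => (ψ x').1) =ᶠ[𝓝 x] χ ∘ σ := hpr
    have e₂ := e₁.mfderiv_eq (I := 𝓘(ℝ, E)) (I' := 𝓘(ℝ, ℂ))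
    have e₃ : HasMFDerivAt 𝓘(ℝ, E) 𝓘(ℝ, ℂ) (Prod.fst ∘ ψ) x
        ((ContinuousLinearMap.fst ℝ ℂ (C2n n)).comp D) :=
      HasMFDerivAt.comp x
        (ContinuousLinearMap.hasMFDerivAt (ContinuousLinearMap.fst ℝ ℂ (C2n n)))
        (hψ.mdifferentiableAt hx).hasMFDerivAt
    rw [mfderiv_comp x hχ' hσ'] at e₂
    exact (congrArg (fun L : E →L[ℝ] ℂ => L u) (e₃.mfderiv.symm.trans e₂))
  have hvert : ∀ u : E, (D u).1 = 0 ↔ u ∈ verticalSpace σ x := fun u => by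
    rw [hfst]
    exact ⟨fun h => hχ₀ _ h, fun h => (congrArg _ h).trans (map_zero _)⟩
  refine map_I_smul_of_normalForm (E := E) (A := Ω x) h₁ h₂ (η := η) (fun a b c => ?_) (fun u => ?_)
    (fun ξ u v hu hv => hΩ.compatible x ξ u ((hvert u).1 hu) v ((hvert v).1 hv)) ((hvert v).2 hv)
  · rw [← hform]
    refine Eq.trans ?_ (pullback3_apply ψ.symm Ω (ψ x) a b c).symm
    change _ = Ω (ψ.symm (ψ x)) ![D' a, D' b, D' c]
    rw [ψ.left_inv hx]
    rfl
  · rw [hfst, hfst]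
    have := mfderiv_complexStructure hσ u
    change mfderiv 𝓘(ℝ, E) 𝓘(ℝ, ℂ) σ x (Complex.I • u : E) = _ at this
    rw [this]
    exact mfderiv_complexStructure hχ _

end FiberwiseLinear

end

/-! ### Assembly of the chart of W and the chart of the base -/

theorem mainTheorem1
    {E : Type*} [NormedAddCommGroup E] [NormedSpace ℂ E] [FiniteDimensional ℂ E]
    {W : Type*} [TopologicalSpace W] [ChartedSpace E W] [IsManifold 𝓘(ℂ, E) ω W]
    {B : Type*} [TopologicalSpace B] [ChartedSpace ℂ B] [IsManifold 𝓘(ℂ, ℂ) ω B]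
    {EF : Type*} [NormedAddCommGroup EF] [NormedSpace ℝ EF] [FiniteDimensional ℝ EF]
    {F : Type*} [TopologicalSpace F] [ChartedSpace EF F] [IsManifold 𝓘(ℝ, EF) ∞ F]
    (σ : W → B) (hσ : ContMDiff 𝓘(ℂ, E) 𝓘(ℂ, ℂ) ω σ) (hbundle : IsSmoothFiberBundle (E := E) EF F σ)
    (Ω : Form3 E W) (hΩ : IsCRMS σ Ω) (w : W) :
    ∃ (n : ℕ) (ψ : OpenPartialHomeomorph W (ℂ × C2n n)) (χ : OpenPartialHomeomorph B ℂ)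
      (S : Set ℂ) (U : Set (C2n n)) (H : ℂ × C2n n → ℝ),
      Module.finrank ℂ E = 2 * n + 1 ∧
      -- `ψ : 𝕌 → S × U` and `χ : σ(𝕌) → S` are diffeomorphisms, with `w ∈ 𝕌`
      IsOpen S ∧ IsOpen U ∧ w ∈ ψ.source ∧ ψ.target = S ×ˢ U ∧
      χ.source = σ '' ψ.source ∧ χ.target = S ∧
      ContMDiffOn 𝓘(ℝ, E) 𝓘(ℝ, ℂ × C2n n) ∞ ψ ψ.source ∧
      ContMDiffOn 𝓘(ℝ, ℂ × C2n n) 𝓘(ℝ, E) ∞ ψ.symm ψ.target ∧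
      -- `χ` is holomorphic, and so is its inverse
      ContMDiffOn 𝓘(ℂ, ℂ) 𝓘(ℂ, ℂ) ω χ χ.source ∧
      ContMDiffOn 𝓘(ℂ, ℂ) 𝓘(ℂ, ℂ) ω χ.symm χ.target ∧
      -- `pr ∘ ψ = χ ∘ σ`
      (∀ x ∈ ψ.source, (ψ x).1 = χ (σ x)) ∧
      -- `(ψ⁻¹)^*Ω = Ω_std - dH_t ∧ dt₁ ∧ dt₂`
      ContDiffOn ℝ ∞ H (S ×ˢ U) ∧
      (∀ y ∈ S ×ˢ U, ∀ a b c : ℂ × C2n n,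
        pullback3 (M := ℂ × C2n n) ψ.symm Ω y ![a, b, c] =
          omegaStd n a b c - wedge21 (wedge11 (dHt H y) dt₁) dt₂ a b c) ∧
      -- `dψ ∘ I = i ∘ dψ` on vertical vectors
      (∀ x ∈ ψ.source, ∀ v ∈ verticalSpace σ x,
        mfderiv 𝓘(ℝ, E) 𝓘(ℝ, ℂ × C2n n) ψ x (complexStructure x v) =
          complexStructure (ψ x) (mfderiv 𝓘(ℝ, E) 𝓘(ℝ, ℂ × C2n n) ψ x v)) := by
  have hO : IsOpen (chartMapDomain E σ w) := isOpen_chartMapDomain hσ.continuous w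
  have hw : chartAt E w w ∈ chartMapDomain E σ w := mem_chartMapDomain_self σ w
  have hO' : chartMapDomain E σ w ∈ 𝓝 (chartAt E w w) := hO.mem_nhds hw
  have hs₀ : fderiv ℂ (chartMap σ w) (chartAt E w w) ≠ 0 := fun h => by
    obtain ⟨ξ, hξ⟩ := exists_mfderiv_ne_zero_of_isSmoothFiberBundle hbundle
      ((chartAt E w).symm (chartAt E w w)) (mdifferentiable_real_of_contMDiff hσ _)
    have h₁ := (mdifferentiable_chartAt_real (E := E) w).symm_comp_deriv (mem_chart_source E w)
    refine hξ ?_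
    have h₂ := (fderiv_chartMap_eq_zero_iff hσ hw
      (v := mfderiv 𝓘(ℝ, E) 𝓘(ℝ, E) (chartAt E w) w ξ)).1 (by rw [h]; rfl)
    have h₃ : mfderiv 𝓘(ℝ, E) 𝓘(ℝ, E) (chartAt E w).symm (chartAt E w w)
        (mfderiv 𝓘(ℝ, E) 𝓘(ℝ, E) (chartAt E w) w ξ) = ξ :=
      congrArg (fun L : E →L[ℝ] E => L ξ) h₁
    rw [h₃] at h₂
    exact h₂
  obtain ⟨n, G, r, H, hn, hr, hwG, hGO, hGt, hfst, hG, hGs, hH, hform⟩ :=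
    exists_chart_normalForm (Θ := chartForm3 (chartAt E w) Ω) (s := chartMap σ w) hO'
      (by
        filter_upwards [hO'] with y hy
        exact (hΩ.smooth _ (chart_mem_atlas E w)).contDiffAt
          ((chartAt E w).open_target.mem_nhds hy.1))
      (by
        filter_upwards [hO'] with y hy using hΩ.closed _ (chart_mem_atlas E w) y hy.1)
      (by filter_upwards [hO'] with y hy using contDiffAt_chartMap hσ hy)
      hs₀
      (by filter_upwards [hO'] with y hy using hΩ.isCompatibleForm hσ hy)
      (hΩ.chartForm3_nondegenerate hσ hw)
  set S : Set ℂ := Metric.ball (chartMap σ w (chartAt E w w)) r with hS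
  have hSo : IsOpen S := Metric.isOpen_ball
  have hGsO : ∀ z ∈ G.target, G.symm z ∈ chartMapDomain E σ w := fun z hz =>
    hGO (G.map_target hz)
  let ψ := (chartAt E w).trans G
  -- The base chart is the preferred chart cut down to the preimage of S. The Moser map preserves t,
  -- so no change of the base coordinate is needed and χ stays holomorphic.
  let χ := (chartAt ℂ (σ w)).trans (OpenPartialHomeomorph.ofSet S hSo)
  have hψt : ψ.target = S ×ˢ Metric.ball (0 : C2n n) r := by
    rw [← hGt, OpenPartialHomeomorph.trans_target]
    exact Set.inter_eq_left.2 fun z hz => (hGsO z hz).1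
  have hψs : ∀ x ∈ ψ.source, x ∈ (chartAt E w).source ∧ chartAt E w x ∈ G.source := fun x hx => by
    rwa [OpenPartialHomeomorph.trans_source] at hx
  have hχs : ∀ b, b ∈ χ.source ↔ b ∈ (chartAt ℂ (σ w)).source ∧ chartAt ℂ (σ w) b ∈ S :=
    fun b => by
      rw [OpenPartialHomeomorph.trans_source]
      rfl
  have hpr : ∀ x ∈ ψ.source, (ψ x).1 = χ (σ x) := fun x hx => by
    refine (hfst _ (hψs x hx).2).trans ?_
    change chartAt ℂ (σ w) (σ ((chartAt E w).symm (chartAt E w x))) = chartAt ℂ (σ w) (σ x)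
    rw [(chartAt E w).left_inv (hψs x hx).1]
  have hσc : ∀ x ∈ ψ.source, σ x ∈ (chartAt ℂ (σ w)).source := fun x hx => by
    have := (hGO (hψs x hx).2).2
    rwa [Set.mem_preimage, (chartAt E w).left_inv (hψs x hx).1] at this
  have hσχ : ∀ x ∈ ψ.source, σ x ∈ χ.source := fun x hx => by
    refine (hχs _).2 ⟨hσc x hx, ?_⟩
    have := ψ.map_source hx
    rw [hψt] at this
    exact (hpr x hx) ▸ this.1
  -- The target of ψ contains S × {0}, so every t ∈ S is attained over the source of ψ. This yields
  -- χ.target = S, and with injectivity of χ also that its source is the image of σ and nothing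
  -- more.
  have hlift : ∀ t ∈ S, ∃ x ∈ ψ.source, χ (σ x) = t := fun t ht => by
    have hz : (t, (0 : C2n n)) ∈ ψ.target := by
      rw [hψt]
      exact ⟨ht, Metric.mem_ball_self hr⟩
    refine ⟨ψ.symm (t, 0), ψ.map_target hz, ?_⟩
    rw [← hpr _ (ψ.map_target hz), ψ.right_inv hz]
  have hχt : χ.target = S := by
    rw [OpenPartialHomeomorph.trans_target]
    refine Set.inter_eq_left.2 fun t ht => ?_
    obtain ⟨x, hx, rfl⟩ := hlift t ht
    exact (chartAt ℂ (σ w)).map_source (hσc x hx)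
  have hψd : ContMDiffOn 𝓘(ℝ, E) 𝓘(ℝ, ℂ × C2n n) ∞ ψ ψ.source := fun x hx =>
    ((contMDiffAt_iff_contDiffAt.2 (hG _ (hψs x hx).2)).comp x
      (contMDiffAt_chartAt_real (hψs x hx).1)).contMDiffWithinAt
  have hψd' : ContMDiffOn 𝓘(ℝ, ℂ × C2n n) 𝓘(ℝ, E) ∞ ψ.symm ψ.target := fun z hz => by
    rw [hψt, ← hGt] at hz
    exact ((contMDiffAt_chartAt_symm_real (hGsO z hz).1).comp z
      (contMDiffAt_iff_contDiffAt.2 (hGs z hz))).contMDiffWithinAt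
  have hpull : ∀ y ∈ S ×ˢ Metric.ball (0 : C2n n) r, ∀ a b c : ℂ × C2n n,
      pullback3 (M := ℂ × C2n n) ψ.symm Ω y ![a, b, c] =
        omegaStd n a b c - wedge21 (wedge11 (dHt H y) dt₁) dt₂ a b c := fun y hy a b c => by
    rw [← hGt] at hy
    have hcomp : mfderiv 𝓘(ℝ, ℂ × C2n n) 𝓘(ℝ, E) ((chartAt E w).symm ∘ G.symm) y =
        (mfderiv 𝓘(ℝ, E) 𝓘(ℝ, E) (chartAt E w).symm (G.symm y)).comp
          (mfderiv 𝓘(ℝ, ℂ × C2n n) 𝓘(ℝ, E) G.symm y) :=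
      mfderiv_comp y ((mdifferentiable_chartAt_real w).mdifferentiableAt_symm (hGsO y hy).1)
        ((hGs y hy).differentiableAt (by simp)).mdifferentiableAt
    rw [mfderiv_eq_fderiv] at hcomp
    rw [← hform y hy a b c]
    refine (pullback3_apply ((chartAt E w).symm ∘ G.symm) Ω y a b c).trans ?_
    rw [hcomp]
    exact (pullback3_apply (chartAt E w).symm Ω (G.symm y) _ _ _).symm
  have hχd : ContMDiffOn 𝓘(ℂ, ℂ) 𝓘(ℂ, ℂ) ω χ χ.source :=
    (contMDiffOn_chart (I := 𝓘(ℂ, ℂ)) (n := ω)).mono fun b hb => ((hχs b).1 hb).1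
  refine ⟨n, ψ, χ, S, Metric.ball 0 r, H, hn, hSo, Metric.isOpen_ball, ?_, hψt, ?_, hχt, hψd, hψd',
    hχd, ?_, hpr, hH.contDiffOn, hpull, fun x hx v hv => ?_⟩
  · rw [OpenPartialHomeomorph.trans_source]
    exact ⟨mem_chart_source E w, hwG⟩
  · refine Set.Subset.antisymm (fun b hb => ?_) (Set.image_subset_iff.2 hσχ)
    obtain ⟨x, hx, hxb⟩ := hlift (χ b) (hχt ▸ χ.map_source hb)
    exact ⟨x, hx, χ.injOn (hσχ x hx) hb hxb⟩
  · refine (contMDiffOn_chart_symm (I := 𝓘(ℂ, ℂ)) (n := ω) (x := σ w)).mono fun t ht => ?_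
    rw [OpenPartialHomeomorph.trans_target] at ht
    exact ht.2
  · refine hΩ.mfderiv_complexStructure_of_normalForm (χ := χ)
      ⟨hψd.mdifferentiableOn (by simp), hψd'.mdifferentiableOn (by simp)⟩ hx
      ((hσ x).mdifferentiableAt (by simp))
      ((hχd.contMDiffAt (χ.open_source.mem_nhds (hσχ x hx))).mdifferentiableAt (by simp))
      (fun v => (mfderiv_chartAt_eq_zero_iff (hσc x hx)).1) ?_
      (hpull (ψ x) (hψt ▸ ψ.map_source hx)) hv
    filter_upwards [ψ.open_source.mem_nhds hx] with x' hx' using hpr x' hx'
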